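/- Let $\mathbb{T}^3=\mathbb{R}^3/\mathbb{Z}^3$, $\mathbb{R}^+=(0,\infty)$, and let $\varrho,j,\varepsilon,\alpha,\beta,\gamma,\kappa>0$ be fixed. For $s\ge 0$ let $H^s=H^s(\mathbb{T}^3;\mathbb{R}^3)$ be the Sobolev space of real vector fields with norm $\|f\|_{H^s}^2=\sum_{k\in\mathbb{Z}^3}(1+|k|^2)^s|\hat f(k)|^2$. Let $\mathring H^s_\perp\subseteq H^s$ be the closed subspace of fields with mean zero and divergence zero, and let $H^s_\|\subseteq H^s$ be the closed subspace of conservative fields, i.e. those annihilated by the Leray projector. Let $s\ge 0$ and let $q$ satisfy $q>5/2$ if $s\le 3/2$, and $q\ge s+1$ if $s>3/2$. Let $\zeta_0\in H^q_\|$. Then there is a unique $\zeta\in L^2(\mathbb{R}^+;H^{q+1})\cap H^1(\mathbb{R}^+;H^{q-1})$, called the potential microflow generated by $\zeta_0$, with $$\partial_t\zeta-\tfrac{\alpha+\gamma}{j}\Delta\zeta-\Big(\tfrac{\alpha+3\beta}{3j}-\tfrac{\gamma}{j}\Big)\nabla\operatorname{div}\zeta+\tfrac{2\kappa}{j}\zeta=0\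 \text{ in }\mathbb{R}^+\times\mathbb{T}^3,\qquad \zeta(0)=\zeta_0,$$ where $\zeta(0)$ is the limit as $t\to0^+$, in $H^q$, of the representative of $\zeta$ that is continuous with values in $H^q$. Moreover, with this $\zeta$, the map $$\mathcal{M}(u,\omega)=\begin{pmatrix}u(0)\\ \omega(0)\\ \varrho\,\partial_tu-(\varepsilon+\frac{\kappa}{2})\Delta u-\kappa\operatorname{curl}\omega\\ j(\partial_t\omega+u\cdot\nabla\zeta)-(\alpha+\gamma)\Delta\omega-(\frac{\alpha}{3}+\beta-\gamma)\nabla\operatorname{div}\omega+2\kappa\omega-\kappa\operatorname{curl}u\end{pmatrix},$$ where $u(0)$ and $\omega(0)$ are limits in $H^{1+s}$ as $t\to0^+$ of the representatives that are continuous with values in $H^{1+s}$, is well defined and is a bounded linear isomorphism (bijective with bounded inverse) from $$\big(L^2(\mathbb{R}^+;\mathring H^{2+s}_\perp)\cap H^1(\mathbb{R}^+;\mathring H^{s}_\perp)\big)\times\big(L^2(\mathbb{R}^+;H^{2+s})\cap H^1(\mathbb{R}^+;H^{s})\big)$$ onto $$\mathring H^{1+s}_\perp\times H^{1+s}\times L^2(\mathbb{R}^+;\mathring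 H^{s}_\perp)\times L^2(\mathbb{R}^+;H^{s}).$$ -/

import Mathlib

open MeasureTheory Filter Topology Set
open scoped ENNReal ComplexConjugate

noncomputable section

namespace Micropolar

/-! ### Fields on the flat torus and their Fourier coefficients -/

/-- The flat torus `ℝ³ / ℤ³`. -/
abbrev T3 : Type := UnitAddTorus (Fin 3)

/-- Lebesgue (= normalised Haar) measure on the torus. -/
abbrev torusMeasure : Measure T3 := Measure.pi fun _ => AddCircle.haarAddCircle

/-- Real valued square integrable functions on the torus. -/
abbrev L2Fun : Type := Lp ℝ 2 torusMeasure

/-- Square integrable vector fields on the torus, given by their three components. -/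
abbrev VField : Type := Fin 3 → L2Fun

/-- The Fourier coefficient `∫ exp (-2πi k·x) f(x) dx`. -/
def fourierCoeff (f : T3 → ℝ) (k : Fin 3 → ℤ) : ℂ :=
  ∫ x, UnitAddTorus.mFourier (-k) x * (f x : ℂ) ∂torusMeasure

/-- The vector of Fourier coefficients of a vector field at the frequency `k`. -/
def vecCoeff (f : VField) (k : Fin 3 → ℤ) : EuclideanSpace ℂ (Fin 3) :=
  WithLp.toLp 2 fun i => fourierCoeff (f i) k

/-- `|k|²`. -/
def freqSq (k : Fin 3 → ℤ) : ℝ := ∑ i, (k i : ℝ) ^ 2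

lemma freqSq_nonneg (k : Fin 3 → ℤ) : 0 ≤ freqSq k :=
  Finset.sum_nonneg fun _ _ => sq_nonneg _

/-- The `L²` inclusion of real functions in complex functions. -/
def complexify : L2Fun →L[ℝ] Lp ℂ 2 torusMeasure :=
  ContinuousLinearMap.compLpL 2 torusMeasure Complex.ofRealCLM

lemma complexify_ae (f : L2Fun) : complexify f =ᵐ[torusMeasure] fun x => (f x : ℂ) :=
  ContinuousLinearMap.coeFn_compLpL _ _

lemma mFourierBasis_repr_complexify (f : L2Fun) (k : Fin 3 → ℤ) :
    (UnitAddTorus.mFourierBasis (d := Fin 3)).repr (complexify f) k = fourierCoeff f k := by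
  refine (UnitAddTorus.mFourierBasis_repr (complexify f) k).trans ?_
  refine integral_congr_ae ?_
  filter_upwards [complexify_ae f] with x hx
  simp [hx]

lemma fourierCoeff_add (f g : L2Fun) (k : Fin 3 → ℤ) :
    fourierCoeff (f + g : L2Fun) k = fourierCoeff f k + fourierCoeff g k := by
  rw [← mFourierBasis_repr_complexify, ← mFourierBasis_repr_complexify,
    ← mFourierBasis_repr_complexify, map_add, map_add]
  rfl

lemma fourierCoeff_smul (c : ℝ) (f : L2Fun) (k : Fin 3 → ℤ) :
    fourierCoeff (c • f : L2Fun) k = c • fourierCoeff f k := by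
  have h : complexify (c • f) = (c : ℂ) • complexify f := by
    rw [map_smul]; exact (Complex.coe_smul c _).symm
  rw [← mFourierBasis_repr_complexify, ← mFourierBasis_repr_complexify, h, map_smul]
  rfl

lemma fourierCoeff_zero (k : Fin 3 → ℤ) : fourierCoeff (0 : L2Fun) k = 0 := by
  rw [← mFourierBasis_repr_complexify, map_zero, map_zero]
  rfl

lemma eq_zero_of_fourierCoeff (f : L2Fun) (h : ∀ k, fourierCoeff f k = 0) : f = 0 := by
  have h1 : complexify f = 0 := by
    apply (UnitAddTorus.mFourierBasis (d := Fin 3)).repr.injective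
    ext k
    rw [mFourierBasis_repr_complexify, h k]; simp
  rw [Lp.eq_zero_iff_ae_eq_zero]
  have h2 := complexify_ae f
  rw [h1] at h2
  filter_upwards [h2, Lp.coeFn_zero ℂ 2 torusMeasure] with x hx hx0
  rw [hx0] at hx
  simpa using hx.symm

lemma fourierCoeff_neg (f : L2Fun) (k : Fin 3 → ℤ) :
    fourierCoeff f (-k) = conj (fourierCoeff f k) := by
  unfold fourierCoeff
  rw [← integral_conj]
  refine integral_congr_ae (.of_forall fun x => ?_)
  simp only [map_mul, Complex.conj_ofReal, ← UnitAddTorus.mFourier_neg]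

/-- A square summable family `c` with `c(-k) = conj (c k)` is the family of Fourier coefficients of
a real square integrable function. -/
lemma exists_fourierCoeff_eq (c : (Fin 3 → ℤ) → ℂ) (hc : Memℓp c 2)
    (hconj : ∀ k, c (-k) = conj (c k)) : ∃ f : L2Fun, ∀ k, fourierCoeff f k = c k := by
  let B := UnitAddTorus.mFourierBasis (d := Fin 3)
  let g : Lp ℂ 2 torusMeasure := B.repr.symm ⟨c, hc⟩
  have hg : ∀ k, ∫ x, UnitAddTorus.mFourier (-k) x * g x ∂torusMeasure = c k := by
    intro k
    refine ((UnitAddTorus.mFourierBasis_repr g k).symm).trans ?_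
    change (B.repr (B.repr.symm ⟨c, hc⟩)) k = c k
    rw [LinearIsometryEquiv.apply_symm_apply]
  have hgi : ∀ k, Integrable (fun x => UnitAddTorus.mFourier (-k) x * g x) torusMeasure := by
    intro k
    have h1 : Integrable g torusMeasure := (Lp.memLp g).integrable (by norm_num)
    refine h1.bdd_mul (c := 1) ?_ (.of_forall fun x => ?_)
    · exact (UnitAddTorus.mFourier (-k)).continuous.aestronglyMeasurable
    · exact (ContinuousMap.norm_coe_le_norm _ x).trans_eq UnitAddTorus.mFourier_norm
  refine ⟨ContinuousLinearMap.compLpL 2 torusMeasure Complex.reCLM g, fun k => ?_⟩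
  have h2 : fourierCoeff (ContinuousLinearMap.compLpL 2 torusMeasure Complex.reCLM g) k =
      ∫ x, ((UnitAddTorus.mFourier (-k) x * g x) +
        conj (UnitAddTorus.mFourier (- -k) x * g x)) / 2 ∂torusMeasure := by
    refine integral_congr_ae ?_
    filter_upwards [ContinuousLinearMap.coeFn_compLpL (p := 2) (μ := torusMeasure)
      Complex.reCLM g] with x hx
    rw [hx, UnitAddTorus.mFourier_neg (n := -k)]
    simp only [Complex.reCLM_apply, map_mul, Complex.conj_conj, Complex.re_eq_add_conj]
    ring
  have h3 : Integrable (fun x => conj (UnitAddTorus.mFourier (- -k) x * g x)) torusMeasure :=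
    (Complex.conjCLE.toContinuousLinearMap).integrable_comp (hgi (-k))
  rw [h2, integral_div, integral_add (hgi k) h3, integral_conj, hg, hg, hconj, Complex.conj_conj]
  ring

lemma vecCoeff_add (f g : VField) (k : Fin 3 → ℤ) :
    vecCoeff (f + g) k = vecCoeff f k + vecCoeff g k := by
  ext i; exact fourierCoeff_add (f i) (g i) k

lemma vecCoeff_smul (c : ℝ) (f : VField) (k : Fin 3 → ℤ) :
    vecCoeff (c • f) k = c • vecCoeff f k := by
  ext i; exact fourierCoeff_smul c (f i) k

lemma vecCoeff_zero (k : Fin 3 → ℤ) : vecCoeff 0 k = 0 := by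
  ext i; exact fourierCoeff_zero k

/-! ### Sobolev spaces of real vector fields on the torus -/

/-- The family `(1 + |k|²)^(s/2) f̂(k)`, whose `ℓ²` norm is the `H^s` norm of `f`. -/
def weighted (s : ℝ) (f : VField) (k : Fin 3 → ℤ) : EuclideanSpace ℂ (Fin 3) :=
  ((1 + freqSq k) ^ (s / 2)) • vecCoeff f k

/-- The vector fields `f` with `∑ₖ (1 + |k|²)^s |f̂(k)|² < ∞`. -/
def sobolevSubmodule (s : ℝ) : Submodule ℝ VField where
  carrier := {f | Memℓp (weighted s f) 2}
  zero_mem' := by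
    have : weighted s 0 = 0 := by ext k; simp [weighted, vecCoeff_zero]
    simp only [mem_ofPred_eq, this]; exact zero_memℓp
  add_mem' := by
    intro f g hf hg
    have : weighted s (f + g) = weighted s f + weighted s g := by
      funext k; simp [weighted, vecCoeff_add]
    simp only [mem_ofPred_eq, this]; exact Memℓp.add hf hg
  smul_mem' := by
    intro c f hf
    have : weighted s (c • f) = c • weighted s f := by
      funext k; simp only [weighted, vecCoeff_smul, Pi.smul_apply]; rw [smul_comm]
    simp only [mem_ofPred_eq, this]; exact Memℓp.const_smul hf c

/-- For `s ≥ 0`, the Sobolev space `H^s(𝕋³; ℝ³)`. Every distribution of nonnegative Sobolev order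
is a square integrable function, so the members are taken in `L²`. The norm, defined below, is
`(∑ₖ (1 + |k|²)^s |f̂(k)|²)^(1/2)`. -/
def H (s : ℝ) : Type := sobolevSubmodule s

namespace H

variable {s : ℝ}

instance : AddCommGroup (H s) := inferInstanceAs (AddCommGroup (sobolevSubmodule s))
instance : Module ℝ (H s) := inferInstanceAs (Module ℝ (sobolevSubmodule s))

/-- The underlying square integrable vector field. -/
def field : H s →ₗ[ℝ] VField := (sobolevSubmodule s).subtype

lemma memℓp (f : H s) : Memℓp (weighted s f.field) 2 := f.2

lemma field_injective : Function.Injective (field (s := s)) :=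
  (sobolevSubmodule s).injective_subtype

/-- The embedding `f ↦ ((1 + |k|²)^(s/2) f̂(k))ₖ` into `ℓ²`. -/
def toSeq (s : ℝ) : H s →ₗ[ℝ] lp (fun _ : Fin 3 → ℤ => EuclideanSpace ℂ (Fin 3)) 2 where
  toFun f := ⟨weighted s f.field, f.memℓp⟩
  map_add' f g := by
    ext k : 2
    change weighted s (field (f + g)) k = weighted s f.field k + weighted s g.field k
    simp [weighted, vecCoeff_add]
  map_smul' c f := by
    ext k : 2
    simp only [weighted, map_smul, vecCoeff_smul, RingHom.id_apply, lp.coeFn_smul, Pi.smul_apply]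
    rw [smul_comm]

lemma toSeq_injective (s : ℝ) : Function.Injective (toSeq s) := by
  rw [← LinearMap.ker_eq_bot, LinearMap.ker_eq_bot']
  intro f hf
  apply field_injective
  rw [map_zero]
  funext i
  refine eq_zero_of_fourierCoeff _ fun k => ?_
  have h1 : weighted s f.field k = 0 := congrFun (congrArg Subtype.val hf) k
  have h2 : (0 : ℝ) < (1 + freqSq k) ^ (s / 2) :=
    Real.rpow_pos_of_pos (by linarith [freqSq_nonneg k]) _
  have h3 : vecCoeff f.field k = 0 := (smul_eq_zero.mp h1).resolve_left h2.ne'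
  exact congrArg (fun v : EuclideanSpace ℂ (Fin 3) => v i) h3

instance : NormedAddCommGroup (H s) :=
  NormedAddCommGroup.induced (H s) _ (toSeq s) (toSeq_injective s)

instance : NormedSpace ℝ (H s) := NormedSpace.induced ℝ (H s) _ (toSeq s)

lemma norm_eq (f : H s) : ‖f‖ = ‖toSeq s f‖ := rfl

lemma norm_sq_eq (f : H s) :
    ‖f‖ ^ 2 = ∑' k, (1 + freqSq k) ^ s * ∑ i, ‖fourierCoeff (f.field i) k‖ ^ 2 := by
  have h := lp.norm_rpow_eq_tsum (p := 2) (by norm_num) (toSeq s f)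
  simp only [ENNReal.toReal_ofNat, Real.rpow_two] at h
  rw [norm_eq, h]
  refine tsum_congr fun k => ?_
  have hk : 0 ≤ 1 + freqSq k := by linarith [freqSq_nonneg k]
  change ‖((1 + freqSq k) ^ (s / 2)) • vecCoeff f.field k‖ ^ 2 = _
  rw [norm_smul, mul_pow, EuclideanSpace.norm_sq_eq, Real.norm_eq_abs, sq_abs, ← Real.rpow_natCast,
    ← Real.rpow_mul hk]
  norm_num [vecCoeff]

lemma norm_weighted_le {a b : ℝ} (h : b ≤ a) (f : VField) (k : Fin 3 → ℤ) :
    ‖weighted b f k‖ ≤ ‖weighted a f k‖ := by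
  have hk : 1 ≤ 1 + freqSq k := by linarith [freqSq_nonneg k]
  simp only [weighted, norm_smul, Real.norm_eq_abs]
  gcongr ?_ * _
  rw [abs_of_nonneg (by positivity), abs_of_nonneg (by positivity)]
  exact Real.rpow_le_rpow_of_exponent_le hk (by linarith)

lemma mem_of_le {a b : ℝ} (h : b ≤ a) (f : H a) : f.field ∈ sobolevSubmodule b := by
  refine memℓp_gen ?_
  have h1 := f.memℓp.summable (by norm_num)
  exact h1.of_nonneg_of_le (fun _ => by positivity)
    fun k => Real.rpow_le_rpow (norm_nonneg _) (norm_weighted_le h _ k) (by norm_num)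

/-- A square integrable field of finite `H^s` norm, as an element of `H^s`. -/
def mk (f : VField) (hf : f ∈ sobolevSubmodule s) : H s := (⟨f, hf⟩ : sobolevSubmodule s)

lemma field_mk (f : VField) (hf : f ∈ sobolevSubmodule s) : (mk f hf).field = f := rfl

/-- The inclusion `H^a ⊆ H^b` for `b ≤ a`, as a linear map. -/
def inclLinear {a b : ℝ} (h : b ≤ a) : H a →ₗ[ℝ] H b where
  toFun f := mk f.field (mem_of_le h f)
  map_add' f g := field_injective (by simp only [map_add, field_mk])
  map_smul' c f := field_injective (by simp only [map_smul, field_mk, RingHom.id_apply])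

lemma norm_inclLinear_le {a b : ℝ} (h : b ≤ a) (f : H a) : ‖inclLinear h f‖ ≤ 1 * ‖f‖ := by
  rw [one_mul, norm_eq, norm_eq]
  exact lp.norm_mono (by norm_num) fun k => norm_weighted_le h f.field k

/-- The inclusion `H^a ⊆ H^b` for `b ≤ a`. -/
def incl {a b : ℝ} (h : b ≤ a) : H a →L[ℝ] H b :=
  (inclLinear h).mkContinuous 1 (norm_inclLinear_le h)

lemma field_incl {a b : ℝ} (h : b ≤ a) (f : H a) : (incl h f).field = f.field :=
  field_mk f.field (mem_of_le h f)

end H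

lemma continuous_toSeq_coord (k : Fin 3 → ℤ) (i : Fin 3) :
    Continuous fun x : lp (fun _ : Fin 3 → ℤ => EuclideanSpace ℂ (Fin 3)) 2 => (x k) i := by
  have h0 := UniformContinuous.continuous
    (lp.uniformContinuous_coe (E := fun _ : Fin 3 → ℤ => EuclideanSpace ℂ (Fin 3)) (p := 2))
  have h1 : Continuous fun x : lp (fun _ : Fin 3 → ℤ => EuclideanSpace ℂ (Fin 3)) 2 => x k :=
    (continuous_apply k).comp h0
  exact (EuclideanSpace.proj (𝕜 := ℂ) i).continuous.comp h1

lemma isClosed_range_toSeq {s : ℝ} (hs : 0 ≤ s) : IsClosed (Set.range (H.toSeq s)) := by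
  have e : Set.range (H.toSeq s) = ⋂ k, ⋂ i, {x | (x (-k)) i = conj ((x k) i)} := by
    ext x
    simp only [mem_range, mem_iInter, mem_ofPred_eq]
    constructor
    · rintro ⟨f, rfl⟩ k i
      change (weighted s f.field (-k)) i = conj ((weighted s f.field k) i)
      have : freqSq (-k) = freqSq k := by simp [freqSq]
      simp [weighted, vecCoeff, this, fourierCoeff_neg]
    · intro hx
      have hpos : ∀ k, 0 < (1 + freqSq k) ^ (s / 2) := fun k =>
        Real.rpow_pos_of_pos (by linarith [freqSq_nonneg k]) _
      have hone : ∀ k, 1 ≤ (1 + freqSq k) ^ (s / 2) := fun k =>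
        Real.one_le_rpow (by linarith [freqSq_nonneg k]) (by linarith)
      have h1 : ∀ i, ∃ f : L2Fun, ∀ k, fourierCoeff f k =
          (((1 + freqSq k) ^ (s / 2))⁻¹ : ℝ) * (x k) i := by
        intro i
        refine exists_fourierCoeff_eq _ ?_ fun k => ?_
        · refine memℓp_gen ?_
          refine ((lp.memℓp x).summable (by norm_num)).of_nonneg_of_le (fun _ => by positivity)
            fun k => Real.rpow_le_rpow (norm_nonneg _) ?_ (by norm_num)
          rw [norm_mul, Complex.norm_real, Real.norm_eq_abs, abs_of_pos (inv_pos.mpr (hpos k))]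
          calc _ ≤ 1 * ‖(x k) i‖ := by gcongr; exact inv_le_one_of_one_le₀ (hone k)
            _ ≤ ‖x k‖ := by rw [one_mul]; exact PiLp.norm_apply_le _ _
        · have : freqSq (-k) = freqSq k := by simp [freqSq]
          rw [hx, this]; simp [Complex.conj_ofReal]
      choose f hf using h1
      have hw : weighted s f = x := by
        funext k; ext i
        change ((1 + freqSq k) ^ (s / 2)) • fourierCoeff (f i) k = _
        rw [hf, Complex.real_smul, ← mul_assoc, ← Complex.ofReal_mul,
          mul_inv_cancel₀ (hpos k).ne', Complex.ofReal_one, one_mul]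
      refine ⟨H.mk f (by change Memℓp (weighted s f) 2; rw [hw]; exact lp.memℓp x), ?_⟩
      exact Subtype.ext hw
  rw [e]
  refine isClosed_iInter fun k => isClosed_iInter fun i => ?_
  have hc : ∀ k, Continuous fun x : lp (fun _ : Fin 3 → ℤ => EuclideanSpace ℂ (Fin 3)) 2 =>
      (x k) i := fun k => continuous_toSeq_coord k i
  exact isClosed_eq (hc (-k)) (Complex.continuous_conj.comp (hc k))

/-- `H^s` is complete for `s ≥ 0`. -/
theorem completeSpace_H {s : ℝ} (hs : 0 ≤ s) : CompleteSpace (H s) := by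
  have hi : Isometry (H.toSeq s) :=
    AddMonoidHomClass.isometry_of_norm _ fun f => (H.norm_eq f).symm
  exact (completeSpace_iff_isComplete_range hi.isUniformInducing).mpr
    (isClosed_range_toSeq hs).isComplete

/-! ### Solenoidal and conservative fields -/

/-- The action of the Leray projector on Fourier coefficients: multiplication by
`I - k ⊗ k / |k|²` for `k ≠ 0`, and the identity for `k = 0`. -/
def leraySymbol (k : Fin 3 → ℤ) (c : Fin 3 → ℂ) : Fin 3 → ℂ :=
  if k = 0 then c else fun i => c i - (k i : ℂ) * (∑ j, (k j : ℂ) * c j) / (freqSq k : ℂ)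

/-- Fields in the range of the Leray projector `P`, i.e. fields with `P f = f`. -/
def IsSolenoidal (f : VField) : Prop :=
  ∀ k, leraySymbol k (vecCoeff f k) = vecCoeff f k

/-- Fields in the range of `I - P`, i.e. fields with `P f = 0`. -/
def IsConservative (f : VField) : Prop :=
  ∀ k, leraySymbol k (vecCoeff f k) = 0

lemma leraySymbol_add (k : Fin 3 → ℤ) (c d : Fin 3 → ℂ) :
    leraySymbol k (c + d) = leraySymbol k c + leraySymbol k d := by
  by_cases hk : k = 0
  · simp [leraySymbol, hk]
  · funext i
    simp only [leraySymbol, hk, if_false, Pi.add_apply, mul_add, Finset.sum_add_distrib, add_div]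
    ring

lemma leraySymbol_smul (k : Fin 3 → ℤ) (r : ℝ) (c : Fin 3 → ℂ) :
    leraySymbol k (r • c) = r • leraySymbol k c := by
  by_cases hk : k = 0
  · simp [leraySymbol, hk]
  · funext i
    simp only [leraySymbol, hk, if_false, Pi.smul_apply, Complex.real_smul, mul_left_comm _ (r : ℂ),
      ← Finset.mul_sum]
    ring

/-- The space of mean zero solenoidal fields of class `H^s`. It carries the norm of `H^s`, which is
equivalent on mean zero fields to the homogeneous norm `(∑_{k ≠ 0} |k|^(2s) |f̂(k)|²)^(1/2)`. -/
def HsolSub (s : ℝ) : Submodule ℝ (H s) where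
  carrier := {f | vecCoeff f.field 0 = 0 ∧ IsSolenoidal f.field}
  zero_mem' := by
    refine ⟨by rw [map_zero, vecCoeff_zero], fun k => ?_⟩
    rw [map_zero, vecCoeff_zero]
    simpa using leraySymbol_smul k 0 0
  add_mem' := by
    intro f g hf hg
    refine ⟨by rw [map_add, vecCoeff_add, hf.1, hg.1, add_zero], fun k => ?_⟩
    rw [map_add, vecCoeff_add, WithLp.ofLp_add, leraySymbol_add, hf.2 k, hg.2 k]
  smul_mem' := by
    intro c f hf
    refine ⟨by rw [map_smul, vecCoeff_smul, hf.1, smul_zero], fun k => ?_⟩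
    rw [map_smul, vecCoeff_smul, WithLp.ofLp_smul, leraySymbol_smul, hf.2 k]

/-- Mean zero solenoidal fields of class `H^s`. -/
abbrev Hsol (s : ℝ) : Type := HsolSub s

/-- The underlying square integrable vector field. -/
abbrev Hsol.field {s : ℝ} (f : Hsol s) : VField := H.field (f : H s)

lemma mem_HsolSub {s : ℝ} {f : H s} :
    f ∈ HsolSub s ↔ vecCoeff f.field 0 = 0 ∧ IsSolenoidal f.field := Iff.rfl

lemma continuous_vecCoeff {s : ℝ} (k : Fin 3 → ℤ) :
    Continuous fun f : H s => vecCoeff f.field k := by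
  have hi : Isometry (H.toSeq s) :=
    AddMonoidHomClass.isometry_of_norm _ fun f => (H.norm_eq f).symm
  have h0 := UniformContinuous.continuous
    (lp.uniformContinuous_coe (E := fun _ : Fin 3 → ℤ => EuclideanSpace ℂ (Fin 3)) (p := 2))
  have h1 : Continuous fun f : H s => H.toSeq s f k :=
    ((continuous_apply k).comp h0).comp hi.continuous
  have h2 : (fun f : H s => vecCoeff f.field k) =
      fun f => ((1 + freqSq k) ^ (s / 2))⁻¹ • H.toSeq s f k := by
    funext f
    have hpos : 0 < (1 + freqSq k) ^ (s / 2) :=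
      Real.rpow_pos_of_pos (by linarith [freqSq_nonneg k]) _
    change _ = ((1 + freqSq k) ^ (s / 2))⁻¹ • ((1 + freqSq k) ^ (s / 2)) • vecCoeff f.field k
    rw [smul_smul, inv_mul_cancel₀ hpos.ne', one_smul]
  rw [h2]
  exact h1.const_smul ((1 + freqSq k) ^ (s / 2))⁻¹

lemma continuous_leraySymbol (k : Fin 3 → ℤ) : Continuous (leraySymbol k) := by
  by_cases hk : k = 0
  · have : leraySymbol k = id := by funext c; simp [leraySymbol, hk]
    rw [this]; exact continuous_id
  · refine continuous_pi fun i => ?_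
    simp only [leraySymbol, hk, if_false]
    fun_prop

/-- The space of mean zero solenoidal fields is complete for `s ≥ 0`. -/
theorem completeSpace_Hsol {s : ℝ} (hs : 0 ≤ s) : CompleteSpace (Hsol s) := by
  have := completeSpace_H hs
  have e : (HsolSub s : Set (H s)) = {f | vecCoeff f.field 0 = 0} ∩
      ⋂ k, {f | leraySymbol k (vecCoeff f.field k) = vecCoeff f.field k} := by
    ext f
    simp only [SetLike.mem_coe, mem_HsolSub, mem_inter_iff, mem_iInter, mem_ofPred_eq,
      IsSolenoidal]
  have hc : IsClosed (HsolSub s : Set (H s)) := by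
    rw [e]
    have h1 : ∀ k, Continuous fun f : H s => (vecCoeff f.field k).ofLp := fun k =>
      (PiLp.continuous_ofLp 2 _).comp (continuous_vecCoeff k)
    exact (isClosed_eq (continuous_vecCoeff 0) continuous_const).inter
      (isClosed_iInter fun k => isClosed_eq ((continuous_leraySymbol k).comp (h1 k)) (h1 k))
  exact hc.completeSpace_coe

lemma incl_mem_HsolSub {a b : ℝ} (h : b ≤ a) (f : Hsol a) : H.incl h (f : H a) ∈ HsolSub b := by
  rw [mem_HsolSub, H.field_incl]
  exact mem_HsolSub.mp f.2

/-- The inclusion of mean zero solenoidal fields of class `H^a` in those of class `H^b`. -/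
def Hsol.incl {a b : ℝ} (h : b ≤ a) : Hsol a →L[ℝ] Hsol b :=
  ((H.incl h).comp (HsolSub a).subtypeL).codRestrict (HsolSub b) (incl_mem_HsolSub h)

/-! ### Spatial differential operators -/

/-- `g` is the weak partial derivative `∂ⱼ f` (tested against the exponentials
`exp (-2πi k·x)`, whose span is dense in the test functions). -/
def IsWeakPartial (j : Fin 3) (f g : L2Fun) : Prop :=
  ∀ k, fourierCoeff g k = 2 * Real.pi * Complex.I * (k j : ℂ) * fourierCoeff f k

open scoped Classical in
/-- The weak partial derivative `∂ⱼ f` of an `L²` function, when it exists in `L²`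
(and `0` otherwise). It exists as soon as `f` is of class `H¹`. -/
def partialD (j : Fin 3) (f : L2Fun) : L2Fun :=
  if h : ∃ g, IsWeakPartial j f g then h.choose else 0

/-- Functions of class `H¹` have weak partial derivatives in `L²`. -/
lemma isWeakPartial_partialD (j : Fin 3) (f : L2Fun)
    (hf : Memℓp (fun k => (k j : ℂ) * fourierCoeff f k) 2) : IsWeakPartial j f (partialD j f) := by
  have h : ∃ g, IsWeakPartial j f g := by
    refine exists_fourierCoeff_eq _ ?_ fun k => ?_
    · simpa only [mul_assoc] using hf.const_mul (2 * Real.pi * Complex.I)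
    · rw [fourierCoeff_neg]
      simp only [map_mul, Complex.conj_ofReal, Complex.conj_I, map_ofNat, map_intCast, Pi.neg_apply,
        Int.cast_neg]
      ring
  rw [partialD, dif_pos h]
  exact h.choose_spec

/-- The divergence. -/
def divergence (v : VField) : L2Fun := ∑ j, partialD j (v j)

/-- The gradient. -/
def grad (p : L2Fun) : VField := fun i => partialD i p

/-- The componentwise Laplacian. -/
def laplacian (v : VField) : VField := fun i => ∑ j, partialD j (partialD j (v i))

/-- The curl. -/
def curl (v : VField) : VField :=
  ![partialD 1 (v 2) - partialD 2 (v 1),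
    partialD 2 (v 0) - partialD 0 (v 2),
    partialD 0 (v 1) - partialD 1 (v 0)]

/-- The `i`-th component `∑ⱼ uⱼ ∂ⱼ zᵢ` of `u · ∇ z`, as a pointwise product. -/
def advect (u z : VField) (i : Fin 3) (x : T3) : ℝ := ∑ j, u j x * partialD j (z i) x

/-! ### Functions of time -/

/-- Lebesgue measure on `(0, ∞)`. -/
abbrev timeMeasure : Measure ℝ := volume.restrict (Ioi 0)

/-- `L²((0, ∞); E)`. -/
abbrev L2Time (E : Type) [NormedAddCommGroup E] : Type := Lp E 2 timeMeasure

section Time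

variable {E F : Type} [NormedAddCommGroup E] [NormedSpace ℝ E]
  [NormedAddCommGroup F] [NormedSpace ℝ F]

/-- `v` is the weak time derivative of `u` on `(0, ∞)`. -/
def IsWeakTimeDeriv (u v : ℝ → F) : Prop :=
  ∀ ψ : ℝ → ℝ, ContDiff ℝ (⊤ : ℕ∞) ψ → HasCompactSupport ψ → tsupport ψ ⊆ Ioi 0 →
    ∫ t, deriv ψ t • u t ∂timeMeasure = -∫ t, ψ t • v t ∂timeMeasure

lemma integrable_smul_L2Time {ψ : ℝ → ℝ} (h : Continuous ψ) (hc : HasCompactSupport ψ)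
    (u : L2Time F) : Integrable (fun t => ψ t • u t) timeMeasure := by
  have h1 : MemLp ψ 2 timeMeasure :=
    (h.memLp_of_hasCompactSupport hc (μ := volume)).restrict _
  exact memLp_one_iff_integrable.mp ((Lp.memLp u).smul h1)

/-- For `E` continuously included in `F` by `ι`, the space `L²((0, ∞); E) ∩ H¹((0, ∞); F)`.
An element is recorded as the pair `(u, ∂ₜu)` of a function and its weak derivative, with the norm
`max ‖u‖_{L² E} ‖∂ₜu‖_{L² F}`, equivalent to `‖u‖_{L² E} + ‖u‖_{H¹ F}`. -/
def ParabolicSub (ι : E →L[ℝ] F) : Submodule ℝ (L2Time E × L2Time F) where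
  carrier := {p | IsWeakTimeDeriv (fun t => ι (p.1 t)) p.2}
  zero_mem' := by
    intro ψ _ _ _
    have h1 : (fun t => deriv ψ t • ι ((0 : L2Time E) t)) =ᵐ[timeMeasure] 0 := by
      filter_upwards [Lp.coeFn_zero E 2 timeMeasure] with t ht
      rw [ht]; simp
    have h2 : (fun t => ψ t • (0 : L2Time F) t) =ᵐ[timeMeasure] 0 := by
      filter_upwards [Lp.coeFn_zero F 2 timeMeasure] with t ht
      rw [ht]; simp
    simp only [Prod.fst_zero, Prod.snd_zero]
    rw [integral_congr_ae h1, integral_congr_ae h2]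
    simp
  add_mem' := by
    intro p p' hp hp' ψ hψ hc ht
    have hd : Continuous (deriv ψ) := hψ.continuous_deriv (by simp)
    have e : ∀ u : L2Time E, (fun t => deriv ψ t • ι (u t)) =ᵐ[timeMeasure]
        fun t => deriv ψ t • (ι.compLp u) t := by
      intro u
      filter_upwards [ι.coeFn_compLp u] with t h
      rw [h]
    have i : ∀ u : L2Time E, Integrable (fun t => deriv ψ t • ι (u t)) timeMeasure := fun u =>
      (integrable_smul_L2Time hd hc.deriv (ι.compLp u)).congr (e u).symm
    have i' : ∀ v : L2Time F, Integrable (fun t => ψ t • v t) timeMeasure :=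
      integrable_smul_L2Time hψ.continuous hc
    have h1 : (fun t => deriv ψ t • ι ((p.1 + p'.1) t)) =ᵐ[timeMeasure]
        fun t => deriv ψ t • ι (p.1 t) + deriv ψ t • ι (p'.1 t) := by
      filter_upwards [Lp.coeFn_add p.1 p'.1] with t h
      rw [h]; simp
    have h2 : (fun t => ψ t • (p.2 + p'.2) t) =ᵐ[timeMeasure]
        fun t => ψ t • p.2 t + ψ t • p'.2 t := by
      filter_upwards [Lp.coeFn_add p.2 p'.2] with t h
      rw [h]; simp
    simp only [Prod.fst_add, Prod.snd_add]
    rw [integral_congr_ae h1, integral_congr_ae h2, integral_add (i _) (i _),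
      integral_add (i' _) (i' _), hp ψ hψ hc ht, hp' ψ hψ hc ht, neg_add]
  smul_mem' := by
    intro c p hp ψ hψ hc ht
    have h1 : (fun t => deriv ψ t • ι ((c • p.1) t)) =ᵐ[timeMeasure]
        fun t => c • (deriv ψ t • ι (p.1 t)) := by
      filter_upwards [Lp.coeFn_smul c p.1] with t h
      rw [h]; simp [smul_comm c]
    have h2 : (fun t => ψ t • (c • p.2) t) =ᵐ[timeMeasure] fun t => c • (ψ t • p.2 t) := by
      filter_upwards [Lp.coeFn_smul c p.2] with t h
      rw [h]; simp [smul_comm c]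
    simp only [Prod.smul_fst, Prod.smul_snd]
    rw [integral_congr_ae h1, integral_congr_ae h2, integral_smul, integral_smul, hp ψ hψ hc ht,
      smul_neg]

/-- The space `L²((0, ∞); E) ∩ H¹((0, ∞); F)`. -/
abbrev Parabolic (ι : E →L[ℝ] F) : Type := ParabolicSub ι

/-- The function underlying an element of `L²((0, ∞); E) ∩ H¹((0, ∞); F)`. -/
abbrev Parabolic.fn {ι : E →L[ℝ] F} (u : Parabolic ι) : L2Time E := u.1.1

/-- Its weak time derivative. -/
abbrev Parabolic.dt {ι : E →L[ℝ] F} (u : Parabolic ι) : L2Time F := u.1.2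

/-- `u(0) = a` in the topology of `F`: after modification on a null set, `u` is continuous with
values in `F` and `u(t) → a` in `F` as `t → 0⁺`. -/
def HasInitialValue (ι : E →L[ℝ] F) (u : ℝ → E) (a : F) : Prop :=
  ∃ v : ℝ → F, ContinuousOn v (Ioi 0) ∧ (∀ᵐ t ∂timeMeasure, v t = ι (u t)) ∧
    Tendsto v (𝓝[>] 0) (𝓝 a)

end Time

lemma le_add_two' (s : ℝ) : s ≤ s + 2 := by linarith

lemma one_le_add_two' (s : ℝ) : s + 1 ≤ s + 2 := by linarith

/-- `L²((0, ∞); H^{s+2}) ∩ H¹((0, ∞); H^s)`. -/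
abbrev X (s : ℝ) : Type := Parabolic (H.incl (le_add_two' s))

/-- `L²((0, ∞); H^{s+2}) ∩ H¹((0, ∞); H^s)` for mean zero solenoidal fields. -/
abbrev Xsol (s : ℝ) : Type := Parabolic (Hsol.incl (le_add_two' s))

/-! ### Physical parameters and potential microflows -/

/-- The physical parameters of a micropolar fluid. -/
structure Params where
  rho : ℝ
  j : ℝ
  eps : ℝ
  alpha : ℝ
  beta : ℝ
  gamma : ℝ
  kappa : ℝ
  rho_pos : 0 < rho
  j_pos : 0 < j
  eps_pos : 0 < eps
  alpha_pos : 0 < alpha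
  beta_pos : 0 < beta
  gamma_pos : 0 < gamma
  kappa_pos : 0 < kappa

lemma le_sub_one_add_two (q : ℝ) : q ≤ q - 1 + 2 := by linarith

/-- `z ∈ L²((0, ∞); H^{q+1}) ∩ H¹((0, ∞); H^{q-1})` is the solution of
`∂ₜz - (a + c) Δz - (b - c) ∇ div z + d z = 0`, `z(0) = z₀`, where `a = α/j`, `b = (α + 3β)/(3j)`,
`c = γ/j`, `d = 2κ/j`. -/
def IsPotentialMicroflow (P : Params) {q : ℝ} (z₀ : H q) (z : X (q - 1)) : Prop :=
  HasInitialValue (H.incl (le_sub_one_add_two q)) z.fn z₀ ∧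
  ∀ᵐ t ∂timeMeasure,
    (z.dt t).field
      - (P.alpha / P.j + P.gamma / P.j) • laplacian (z.fn t).field
      - ((P.alpha + 3 * P.beta) / (3 * P.j) - P.gamma / P.j) •
          grad (divergence (z.fn t).field)
      + (2 * P.kappa / P.j) • (z.fn t).field = 0

/-- `f = ϱ ∂ₜu - (ε + κ/2) Δu - κ curl w` for almost every time. -/
def MomentumEq (P : Params) {s : ℝ} (u : Xsol s) (w : X s) (f : L2Time (Hsol s)) : Prop :=
  ∀ᵐ t ∂timeMeasure,
    (f t).field = P.rho • (u.dt t).field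
      - (P.eps + P.kappa / 2) • laplacian (u.fn t).field
      - P.kappa • curl (w.fn t).field

/-- `g = j (∂ₜw + u · ∇z) - (α + γ) Δw - (α/3 + β - γ) ∇ div w + 2κ w - κ curl u`
almost everywhere in space-time. -/
def MicrorotationEq (P : Params) {s r : ℝ} (z : X r) (u : Xsol s) (w : X s)
    (g : L2Time (H s)) : Prop :=
  ∀ᵐ t ∂timeMeasure, ∀ i, ∀ᵐ x ∂torusMeasure,
    (g t).field i x =
      P.j * ((w.dt t).field i x + advect (u.fn t).field (z.fn t).field i x)
      - (P.alpha + P.gamma) * laplacian (w.fn t).field i x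
      - (P.alpha / 3 + P.beta - P.gamma) * grad (divergence (w.fn t).field) i x
      + 2 * P.kappa * (w.fn t).field i x
      - P.kappa * curl (u.fn t).field i x

end Micropolar

end

noncomputable section

namespace Micropolar

/-! ### Primitives of vector-valued functions -/

section Primitive

variable {E F G : Type*} [NormedAddCommGroup E] [NormedSpace ℝ E]
  [NormedAddCommGroup F] [NormedSpace ℝ F] [NormedAddCommGroup G] [NormedSpace ℝ G]

/-! Write the operator as `M₀ + N`. Here `M₀` is the constant coefficient system coupling `u` and
`ω` through the curl, together with the two traces at time zero. The term `N(u, ω) = j u · ∇ζ`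
enters only the last component and involves only `u`. First `M₀` is shown to be an isomorphism; then
`N` is shown to be a perturbation of Volterra type in time, so no smallness of `ζ` is needed.

For `M₀`, everything is computed on Fourier coefficients. With `a = α + γ` and `b = α/3 + β - γ`,
the form of `-aΔ - b∇div` is controlled from below by `min a (a + b)`, and `a + b > 0` even if `b <
0`. The curl is self-adjoint, so the two coupling terms add up to `-2κ⟨curl u, ω⟩`. This is absorbed
by the `κ/2` part of the viscosity and the damping `2κ|ω|²`, leaving a coercive form
(`exists_coupled_coercive`); the zero frequency is harmless because `u` has mean zero.

Existence is Lions' projection method (`exists_inner_eq_of_le_norm`, `exists_parabolic_solution`).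
The equation is tested against `Lψ`, where `L` multiplies coefficients by `1 + |k|²`. Then the
elliptic part is coercive in `H^{s+2}`, the time derivative produces the squared `H^{s+1}` norm at
time zero, and the full regularity is obtained at once. Test functions need not vanish at zero, so
the initial value is part of the weak formulation. The trace itself (`exists_trace`) is a bound at
each frequency, summed by dominated convergence, because `s + 1` is midway between `s` and `s + 2`.
Uniqueness is the energy estimate `norm_sq_le_of_equation`, which also gives `‖u(t)‖² ≤ C ∫₀ᵗ ‖g‖²`
in `H^s` when all data except the last, `g`, vanish.

For `N`, the product estimate `‖u · ∇ζ‖ ≤ C ‖u‖_{H^s} ‖ζ‖_{H^{q+1}}` in `H^s` (`exists_conv_bound`,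
`exists_advectL`) is combined with that energy estimate. The operator `T g = N (M₀⁻¹ (0, 0, 0, g))`
then satisfies `‖T g (t)‖² ≤ μ(t) ∫₀ᵗ ‖g‖²`, where `μ` is a multiple of `‖ζ(t)‖²` and hence
integrable. Iteration gives `‖Tⁿ‖² ≤ (∫ μ)ⁿ / n!`, so `1 + T` is bijective
(`IsVolterra.bijective_id_add`), and with it `M₀ + N` (`bijective_add_volterra`). Bounded inverses
come from the open mapping theorem.

The potential microflow is obtained from the same existence and uniqueness results, applied to a
single equation. -/

omit [NormedSpace ℝ E] in
lemma absolutelyContinuousOnInterval_of_dist_le {f : ℝ → E} {g : ℝ → ℝ} {a b C : ℝ}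
    (hC : 0 ≤ C) (hg : AbsolutelyContinuousOnInterval g a b)
    (h : ∀ s ∈ uIcc a b, ∀ t ∈ uIcc a b, dist (f s) (f t) ≤ C * dist (g s) (g t)) :
    AbsolutelyContinuousOnInterval f a b := by
  rw [absolutelyContinuousOnInterval_iff] at hg ⊢
  intro ε hε
  obtain ⟨δ, hδ, H⟩ := hg (ε / (C + 1)) (by positivity)
  refine ⟨δ, hδ, fun I hI hlt => ?_⟩
  have h1 := H I hI hlt
  calc ∑ i ∈ Finset.range I.1, dist (f (I.2 i).1) (f (I.2 i).2)
      ≤ ∑ i ∈ Finset.range I.1, C * dist (g (I.2 i).1) (g (I.2 i).2) :=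
        Finset.sum_le_sum fun i hi => h _ (hI.1 i hi).1 _ (hI.1 i hi).2
    _ = C * ∑ i ∈ Finset.range I.1, dist (g (I.2 i).1) (g (I.2 i).2) :=
        (Finset.mul_sum _ _ _).symm
    _ ≤ C * (ε / (C + 1)) := by gcongr
    _ < (C + 1) * (ε / (C + 1)) := by gcongr; linarith
    _ = ε := by field_simp

/-- Increments of a vector-valued primitive are dominated by those of the scalar primitive of `‖f‖`,
so absolute continuity is inherited from the real case. -/
lemma absolutelyContinuousOnInterval_primitive {f : ℝ → E} {T : ℝ}
    (hf : IntervalIntegrable f volume 0 T) :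
    AbsolutelyContinuousOnInterval (fun t => ∫ r in (0 : ℝ)..t, f r) 0 T := by
  refine absolutelyContinuousOnInterval_of_dist_le zero_le_one
    (hf.norm.absolutelyContinuousOnInterval_intervalIntegral (c := 0) (by simp)) ?_
  intro s hs t ht
  have i : ∀ r ∈ uIcc (0 : ℝ) T, IntervalIntegrable f volume 0 r := fun r hr =>
    hf.mono_set (uIcc_subset_uIcc_left hr)
  rw [dist_eq_norm, dist_eq_norm, intervalIntegral.integral_interval_sub_left (i s hs) (i t ht),
    intervalIntegral.integral_interval_sub_left (i s hs).norm (i t ht).norm, one_mul,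
    Real.norm_eq_abs]
  exact intervalIntegral.norm_integral_le_abs_integral_norm

/-- Both primitives are bounded on the compact interval, so the increments are dominated by those of
the primitive of `‖x'‖ + ‖y'‖`. -/
lemma absolutelyContinuousOnInterval_bilin (B : E →L[ℝ] F →L[ℝ] G) {x' : ℝ → E} {y' : ℝ → F}
    {T : ℝ} (hx : IntervalIntegrable x' volume 0 T) (hy : IntervalIntegrable y' volume 0 T)
    (a : E) (b : F) :
    AbsolutelyContinuousOnInterval
      (fun t => B (a + ∫ r in (0 : ℝ)..t, x' r) (b + ∫ r in (0 : ℝ)..t, y' r)) 0 T := by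
  have cx : ContinuousOn (fun t => a + ∫ r in (0 : ℝ)..t, x' r) (uIcc 0 T) :=
    continuousOn_const.add (absolutelyContinuousOnInterval_primitive hx).continuousOn
  have cy : ContinuousOn (fun t => b + ∫ r in (0 : ℝ)..t, y' r) (uIcc 0 T) :=
    continuousOn_const.add (absolutelyContinuousOnInterval_primitive hy).continuousOn
  obtain ⟨C₁, h₁⟩ := isCompact_uIcc.exists_bound_of_continuousOn cx
  obtain ⟨C₂, h₂⟩ := isCompact_uIcc.exists_bound_of_continuousOn cy
  have p₁ : 0 ≤ C₁ := (norm_nonneg _).trans (h₁ 0 (by simp))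
  have p₂ : 0 ≤ C₂ := (norm_nonneg _).trans (h₂ 0 (by simp))
  refine absolutelyContinuousOnInterval_of_dist_le (C := ‖B‖ * (C₁ + C₂)) (by positivity)
    ((hx.norm.add hy.norm).absolutelyContinuousOnInterval_intervalIntegral (c := 0) (by simp)) ?_
  intro s hs t ht
  have i : ∀ r ∈ uIcc (0 : ℝ) T, IntervalIntegrable x' volume 0 r := fun r hr =>
    hx.mono_set (uIcc_subset_uIcc_left hr)
  have j : ∀ r ∈ uIcc (0 : ℝ) T, IntervalIntegrable y' volume 0 r := fun r hr =>
    hy.mono_set (uIcc_subset_uIcc_left hr)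
  have its : IntervalIntegrable x' volume t s := (i t ht).symm.trans (i s hs)
  have jts : IntervalIntegrable y' volume t s := (j t ht).symm.trans (j s hs)
  -- The points `s` and `t` are not ordered, but the two integrals of norms have the same sign, so
  -- their absolute values add.
  have key : ∀ {X Y X' Y' : ℝ}, 0 ≤ X → 0 ≤ Y → X ≤ |X'| → Y ≤ |Y'| →
      (0 ≤ X' ∧ 0 ≤ Y' ∨ X' ≤ 0 ∧ Y' ≤ 0) →
      X + Y ≤ |X' + Y'| := by
    intro X Y X' Y' hX hY h1 h2 h3
    rcases h3 with ⟨h3, h4⟩ | ⟨h3, h4⟩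
    · rw [abs_of_nonneg h3] at h1; rw [abs_of_nonneg h4] at h2
      rw [abs_of_nonneg (by linarith)]; linarith
    · rw [abs_of_nonpos h3] at h1; rw [abs_of_nonpos h4] at h2
      rw [abs_of_nonpos (by linarith)]; linarith
  have hsum : ‖∫ r in t..s, x' r‖ + ‖∫ r in t..s, y' r‖ ≤
      |∫ r in t..s, (‖x' r‖ + ‖y' r‖)| := by
    rw [intervalIntegral.integral_add its.norm jts.norm]
    refine key (norm_nonneg _) (norm_nonneg _) intervalIntegral.norm_integral_le_abs_integral_norm
      intervalIntegral.norm_integral_le_abs_integral_norm ?_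
    rcases le_total t s with h | h
    · exact Or.inl ⟨intervalIntegral.integral_nonneg h fun _ _ => norm_nonneg _,
        intervalIntegral.integral_nonneg h fun _ _ => norm_nonneg _⟩
    · right
      rw [intervalIntegral.integral_symm, intervalIntegral.integral_symm (a := s)]
      exact ⟨neg_nonpos.mpr (intervalIntegral.integral_nonneg h fun _ _ => norm_nonneg _),
        neg_nonpos.mpr (intervalIntegral.integral_nonneg h fun _ _ => norm_nonneg _)⟩
  have e : ∀ X X' : E, ∀ Y Y' : F, B X Y - B X' Y' = B (X - X') Y + B X' (Y - Y') := by
    intro X X' Y Y'; simp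
  rw [dist_eq_norm, Real.dist_eq, e, add_sub_add_left_eq_sub, add_sub_add_left_eq_sub,
    intervalIntegral.integral_interval_sub_left (i s hs) (i t ht),
    intervalIntegral.integral_interval_sub_left (j s hs) (j t ht),
    intervalIntegral.integral_interval_sub_left ((i s hs).norm.add (j s hs).norm)
      ((i t ht).norm.add (j t ht).norm)]
  calc _ ≤ ‖B‖ * ‖∫ r in t..s, x' r‖ * C₂ + ‖B‖ * C₁ * ‖∫ r in t..s, y' r‖ := by
        refine (norm_add_le _ _).trans (add_le_add ?_ ?_)
        · refine (B.le_opNorm₂ _ _).trans ?_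
          gcongr; exact h₂ s hs
        · refine (B.le_opNorm₂ _ _).trans ?_
          gcongr; exact h₁ t ht
    _ ≤ ‖B‖ * (C₁ + C₂) * (‖∫ r in t..s, x' r‖ + ‖∫ r in t..s, y' r‖) := by
        have := norm_nonneg (∫ r in t..s, x' r)
        have := norm_nonneg (∫ r in t..s, y' r)
        have := norm_nonneg B
        have t1 : 0 ≤ ‖B‖ * C₁ * ‖∫ r in t..s, x' r‖ := by positivity
        have t2 : 0 ≤ ‖B‖ * C₂ * ‖∫ r in t..s, y' r‖ := by positivity
        nlinarith
    _ ≤ _ := by gcongr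

/-- The product rule for a bilinear map applied to two primitives. -/
theorem bilin_primitive [CompleteSpace E] [CompleteSpace F] [CompleteSpace G]
    (B : E →L[ℝ] F →L[ℝ] G) {x' : ℝ → E} {y' : ℝ → F}
    {T : ℝ} (hx : IntervalIntegrable x' volume 0 T) (hy : IntervalIntegrable y' volume 0 T)
    (a : E) (b : F) :
    IntervalIntegrable (fun t => B (x' t) (b + ∫ r in (0 : ℝ)..t, y' r) +
      B (a + ∫ r in (0 : ℝ)..t, x' r) (y' t)) volume 0 T ∧
    B (a + ∫ r in (0 : ℝ)..T, x' r) (b + ∫ r in (0 : ℝ)..T, y' r) = B a b +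
      ∫ t in (0 : ℝ)..T, (B (x' t) (b + ∫ r in (0 : ℝ)..t, y' r) +
        B (a + ∫ r in (0 : ℝ)..t, x' r) (y' t)) := by
  have cx : ContinuousOn (fun t => a + ∫ r in (0 : ℝ)..t, x' r) (uIcc 0 T) :=
    continuousOn_const.add (absolutelyContinuousOnInterval_primitive hx).continuousOn
  have cy : ContinuousOn (fun t => b + ∫ r in (0 : ℝ)..t, y' r) (uIcc 0 T) :=
    continuousOn_const.add (absolutelyContinuousOnInterval_primitive hy).continuousOn
  obtain ⟨C₁, h₁⟩ := isCompact_uIcc.exists_bound_of_continuousOn cx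
  obtain ⟨C₂, h₂⟩ := isCompact_uIcc.exists_bound_of_continuousOn cy
  have mx : AEStronglyMeasurable (fun t => a + ∫ r in (0 : ℝ)..t, x' r)
      (volume.restrict (uIoc 0 T)) :=
    (cx.mono uIoc_subset_uIcc).aestronglyMeasurable measurableSet_uIoc
  have my : AEStronglyMeasurable (fun t => b + ∫ r in (0 : ℝ)..t, y' r)
      (volume.restrict (uIoc 0 T)) :=
    (cy.mono uIoc_subset_uIcc).aestronglyMeasurable measurableSet_uIoc
  have i1 : IntervalIntegrable (fun t => B (x' t) (b + ∫ r in (0 : ℝ)..t, y' r)) volume 0 T := by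
    rw [intervalIntegrable_iff] at hx ⊢
    refine B.integrable_of_bilin_of_bdd_right C₂ hx my ?_
    filter_upwards [ae_restrict_mem measurableSet_uIoc] with t ht using h₂ t (uIoc_subset_uIcc ht)
  have i2 : IntervalIntegrable (fun t => B (a + ∫ r in (0 : ℝ)..t, x' r) (y' t)) volume 0 T := by
    rw [intervalIntegrable_iff] at hy ⊢
    refine B.integrable_of_bilin_of_bdd_left C₁ mx ?_ hy
    filter_upwards [ae_restrict_mem measurableSet_uIoc] with t ht using h₁ t (uIoc_subset_uIcc ht)
  refine ⟨i1.add i2, ?_⟩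
  -- The difference of the two sides is absolutely continuous with derivative zero almost
  -- everywhere, hence constant; it is compared at `0` and `T`.
  have hd := (absolutelyContinuousOnInterval_bilin B hx hy a b).sub
    (absolutelyContinuousOnInterval_primitive (i1.add i2))
  obtain ⟨C, hC⟩ := hd.const_of_ae_hasDerivAt_zero (by
    filter_upwards [hx.ae_hasDerivAt_integral, hy.ae_hasDerivAt_integral,
      (i1.add i2).ae_hasDerivAt_integral] with t k1 k2 k3 ht
    have d1 := (k1 ht 0 (by simp)).const_add a
    have d2 := (k2 ht 0 (by simp)).const_add b
    have d3 := k3 ht 0 (by simp)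
    have := (B.hasDerivAt_of_bilinear (fun _ => d1) (fun _ => d2)).sub d3
    convert! this using 1
    abel)
  have e0 := hC 0 (by simp)
  have e1 := hC T (by simp)
  simp only [Pi.sub_apply, intervalIntegral.integral_same, add_zero, sub_zero] at e0 e1
  rw [e0, ← e1]
  abel

end Primitive

/-! ### Weak derivatives in time -/

section TimeCalculus

variable {E F : Type} [NormedAddCommGroup E] [NormedSpace ℝ E]
  [NormedAddCommGroup F] [NormedSpace ℝ F]

omit [NormedSpace ℝ F] in
lemma intervalIntegrable_L2Time (v : L2Time F) {t : ℝ} (ht : 0 ≤ t) :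
    IntervalIntegrable v volume 0 t := by
  rw [intervalIntegrable_iff_integrableOn_Ioc_of_le ht]
  have h : MemLp v 2 (volume.restrict (Ioc 0 t)) :=
    (Lp.memLp v).mono_measure (Measure.restrict_mono Ioc_subset_Ioi_self le_rfl)
  have : IsFiniteMeasure (volume.restrict (Ioc (0 : ℝ) t)) := ⟨by simp⟩
  exact h.integrable (by norm_num)

lemma continuousOn_primitive_L2Time (v : L2Time F) (a : F) :
    ContinuousOn (fun t => a + ∫ r in (0 : ℝ)..t, v r) (Ici 0) := by
  intro t ht
  -- The interval reaches to `t + 1` so that it is a neighbourhood of `t` within `Ici 0`.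
  have h := (absolutelyContinuousOnInterval_primitive
    (intervalIntegrable_L2Time v (t := t + 1) (by linarith [mem_Ici.mp ht]))).continuousOn
  rw [uIcc_of_le (by linarith [mem_Ici.mp ht])] at h
  refine continuousWithinAt_const.add ((h t ⟨ht, by linarith⟩).mono_of_mem_nhdsWithin ?_)
  exact mem_nhdsWithin.mpr ⟨Iio (t + 1), isOpen_Iio, by simp, fun x hx => ⟨hx.2, hx.1.le⟩⟩

lemma exists_support_bound {ψ : ℝ → ℝ} (hc : HasCompactSupport ψ) :
    ∃ T, 0 ≤ T ∧ ∀ t, T ≤ t → ψ t = 0 ∧ deriv ψ t = 0 := by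
  obtain ⟨R, hR⟩ := hc.isCompact.isBounded.subset_closedBall 0
  refine ⟨max 0 (R + 1), le_max_left _ _, fun t ht => ?_⟩
  have h : t ∉ tsupport ψ := fun h => by
    have h1 := hR h
    rw [Metric.mem_closedBall, dist_zero_right, Real.norm_eq_abs] at h1
    have := le_max_right 0 (R + 1)
    have := le_abs_self t
    linarith
  exact ⟨image_eq_zero_of_notMem_tsupport h,
    image_eq_zero_of_notMem_tsupport fun h' => h (tsupport_deriv_subset h')⟩

lemma integral_timeMeasure_eq {f : ℝ → F} {T : ℝ} (hT : 0 ≤ T) (h : ∀ t, T ≤ t → f t = 0) :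
    ∫ t, f t ∂timeMeasure = ∫ t in (0 : ℝ)..T, f t := by
  rw [intervalIntegral.integral_of_le hT]
  refine setIntegral_eq_of_subset_of_forall_sdiff_eq_zero measurableSet_Ioi Ioc_subset_Ioi_self ?_
  intro x hx
  refine h x ?_
  by_contra hlt
  exact hx.2 ⟨hx.1, (not_le.mp hlt).le⟩

/-- Integration by parts of a primitive against a test function on `[0, ∞)`. -/
theorem integral_deriv_smul_primitive [CompleteSpace F] {ψ : ℝ → ℝ}
    (hψ : ContDiff ℝ (⊤ : ℕ∞) ψ) (hc : HasCompactSupport ψ) (v : L2Time F) (a : F) :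
    ∫ t, deriv ψ t • (a + ∫ r in (0 : ℝ)..t, v r) ∂timeMeasure =
      -(ψ 0 • a) - ∫ t, ψ t • v t ∂timeMeasure := by
  obtain ⟨T, hT, hz⟩ := exists_support_bound hc
  have hd : Continuous (deriv ψ) := hψ.continuous_deriv (by simp)
  have hp : ∀ t, ψ 0 + ∫ r in (0 : ℝ)..t, deriv ψ r = ψ t := by
    intro t
    rw [intervalIntegral.integral_deriv_eq_sub (fun x _ => (hψ.differentiable (by simp)) x)
      (hd.intervalIntegrable _ _)]
    ring
  have i1 : IntervalIntegrable (fun t => deriv ψ t • (a + ∫ r in (0 : ℝ)..t, v r)) volume 0 T := by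
    refine ContinuousOn.intervalIntegrable ?_
    refine hd.continuousOn.smul ((continuousOn_primitive_L2Time v a).mono ?_)
    rw [uIcc_of_le hT]; exact Icc_subset_Ici_self
  have i2 : IntervalIntegrable (fun t => ψ t • v t) volume 0 T :=
    (intervalIntegrable_L2Time v hT).continuousOn_smul hψ.continuous.continuousOn
  have h := (bilin_primitive (ContinuousLinearMap.lsmul ℝ ℝ (E := F)) (hd.intervalIntegrable 0 T)
    (intervalIntegrable_L2Time v hT) (ψ 0) a).2
  simp only [ContinuousLinearMap.lsmul_apply, hp] at h
  rw [(hz T le_rfl).1, zero_smul, intervalIntegral.integral_add i1 i2] at h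
  rw [integral_timeMeasure_eq hT fun t ht => by rw [(hz t ht).2, zero_smul],
    integral_timeMeasure_eq hT fun t ht => by rw [(hz t ht).1, zero_smul]]
  rw [← add_assoc] at h
  rw [eq_sub_iff_add_eq, eq_neg_iff_add_eq_zero, h]
  abel

/-- A locally integrable function on `(0, ∞)` with zero weak derivative is constant. -/
theorem ae_eq_const_of_integral_deriv_smul [CompleteSpace F] {w : ℝ → F}
    (hw : LocallyIntegrableOn w (Ioi 0))
    (h : ∀ ψ : ℝ → ℝ, ContDiff ℝ (⊤ : ℕ∞) ψ → HasCompactSupport ψ → tsupport ψ ⊆ Ioi 0 →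
      ∫ t, deriv ψ t • w t ∂timeMeasure = 0) :
    ∃ c, ∀ᵐ t ∂timeMeasure, w t = c := by
  have hint : ∀ ψ : ℝ → ℝ, Continuous ψ → HasCompactSupport ψ → tsupport ψ ⊆ Ioi 0 →
      ∀ u : ℝ → F, LocallyIntegrableOn u (Ioi 0) → Integrable (fun t => ψ t • u t) := by
    intro ψ h1 h2 h3 u hu
    have := (hu.integrableOn_compact_subset h3 h2).continuousOn_smul h1.continuousOn h2
    rwa [integrableOn_iff_integrable_of_support_subset] at this
    intro t ht
    exact subset_tsupport _ fun h0 => ht (by simp [h0])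
  have hrestr : ∀ ψ : ℝ → ℝ, tsupport ψ ⊆ Ioi 0 → ∀ u : ℝ → F,
      ∫ t, ψ t • u t ∂timeMeasure = ∫ t, ψ t • u t := by
    intro ψ h3 u
    refine setIntegral_eq_integral_of_forall_compl_eq_zero fun t ht => ?_
    rw [image_eq_zero_of_notMem_tsupport fun h' => ht (h3 h'), zero_smul]
  -- A reference bump supported in `[1, 3]`, inside the open half-line. The constant is the average
  -- of `w` against it.
  let b : ContDiffBump (2 : ℝ) := ⟨1 / 2, 1, by norm_num, by norm_num⟩
  have hb : tsupport (b.normed volume) ⊆ Ioi 0 := by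
    rw [b.tsupport_normed_eq, Real.closedBall_eq_Icc]
    intro t ht
    have : (2 : ℝ) - 1 ≤ t := ht.1
    exact mem_Ioi.mpr (by linarith)
  refine ⟨∫ t, b.normed volume t • w t, ?_⟩
  set c := ∫ t, b.normed volume t • w t with hcdef
  have hconst : LocallyIntegrableOn (fun _ : ℝ => c) (Ioi 0) :=
    (locallyIntegrable_const c).locallyIntegrableOn _
  have key := IsOpen.ae_eq_zero_of_integral_contDiff_smul_eq_zero (μ := volume) isOpen_Ioi
    (hw.sub hconst) (fun ψ h1 h2 h3 => by
      set m := ∫ t, ψ t with hm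
      -- Subtracting a multiple of the bump makes the mean zero, so the primitive of `φ` is again a
      -- compactly supported test function and the hypothesis applies to it.
      let φ : ℝ → ℝ := fun t => ψ t - m * b.normed volume t
      have φs : ContDiff ℝ (⊤ : ℕ∞) φ := h1.sub (contDiff_const.mul b.contDiff_normed)
      let K : Set ℝ := tsupport ψ ∪ tsupport (b.normed volume)
      have hK : IsCompact K := h2.isCompact.union b.hasCompactSupport_normed.isCompact
      have hKpos : K ⊆ Ioi 0 := union_subset h3 hb
      have φz : ∀ t, t ∉ K → φ t = 0 := by
        intro t ht
        simp only [φ]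
        rw [image_eq_zero_of_notMem_tsupport fun h' => ht (Or.inl h'),
          image_eq_zero_of_notMem_tsupport fun h' => ht (Or.inr h')]
        simp
      have φi : ∫ t, φ t = 0 := by
        simp only [φ]
        rw [integral_sub (h1.continuous.integrable_of_hasCompactSupport h2)
          (b.integrable_normed.const_mul m), integral_const_mul, b.integral_normed, ← hm]
        ring
      have hKne : K.Nonempty := ⟨2, Or.inr (by
        rw [b.tsupport_normed_eq]; exact Metric.mem_closedBall_self b.rOut_pos.le)⟩
      obtain ⟨α, hα, hα'⟩ := hK.exists_isLeast hKne
      obtain ⟨β, hβ, hβ'⟩ := hK.exists_isGreatest hKne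
      have hαβ : α ≤ β := hα' hβ
      have φz1 : ∀ t, t < α → φ t = 0 := fun t ht => φz t fun h' => absurd (hα' h') (not_le.mpr ht)
      have φz2 : ∀ t, β < t → φ t = 0 := fun t ht => φz t fun h' => absurd (hβ' h') (not_le.mpr ht)
      have φint : Integrable φ := φs.continuous.integrable_of_hasCompactSupport
        (HasCompactSupport.of_support_subset_isCompact hK fun t ht => by
          by_contra h'; exact ht (φz t h'))
      let θ : ℝ → ℝ := fun t => ∫ r in α..t, φ r
      have θd : ∀ t, HasDerivAt θ (φ t) t := fun t =>
        intervalIntegral.integral_hasDerivAt_right (φs.continuous.intervalIntegrable _ _)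
          (φs.continuous.stronglyMeasurableAtFilter _ _) φs.continuous.continuousAt
      have θderiv : deriv θ = φ := funext fun t => (θd t).deriv
      have θs : ContDiff ℝ (⊤ : ℕ∞) θ := by
        rw [contDiff_infty_iff_deriv, θderiv]
        exact ⟨fun t => (θd t).differentiableAt, φs⟩
      have θz : ∀ t, t ∉ Icc α β → θ t = 0 := by
        intro t ht
        rcases lt_or_ge t α with h' | h'
        · refine intervalIntegral.integral_zero_ae (.of_forall fun r hr => ?_)
          rw [uIoc_of_ge h'.le] at hr
          -- For `t < α` the half-open interval contains its endpoint `α`, where `φ` vanishes only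
          -- by continuity from the left.
          rcases eq_or_lt_of_le hr.2 with h'' | h''
          · rw [h'']
            have : Tendsto φ (𝓝[<] α) (𝓝 (φ α)) := φs.continuous.continuousAt.mono_left
              nhdsWithin_le_nhds
            refine tendsto_nhds_unique this (tendsto_const_nhds.congr' ?_)
            filter_upwards [self_mem_nhdsWithin] with x hx using (φz1 x hx).symm
          · exact φz1 r h''
        · have h'' : β < t := by
            by_contra h0; exact ht ⟨h', not_lt.mp h0⟩
          have : ∫ r in α..t, φ r = ∫ r, φ r := by
            rw [intervalIntegral.integral_of_le h', ← integral_Icc_eq_integral_Ioc]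
            refine setIntegral_eq_integral_of_forall_compl_eq_zero fun r hr => ?_
            by_cases hr1 : r < α
            · exact φz1 r hr1
            · exact φz2 r (h''.trans (by
                by_contra h0; exact hr ⟨not_lt.mp hr1, not_lt.mp h0⟩))
          exact this.trans φi
      have θt : tsupport θ ⊆ Icc α β :=
        closure_minimal (fun t ht => by by_contra h'; exact ht (θz t h')) isClosed_Icc
      have θc : HasCompactSupport θ := isCompact_Icc.of_isClosed_subset (isClosed_tsupport _) θt
      have θp : tsupport θ ⊆ Ioi 0 := θt.trans fun t ht => lt_of_lt_of_le (hKpos hα) ht.1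
      have h0 := h θ θs θc θp
      rw [hrestr (deriv θ) ((tsupport_deriv_subset).trans θp) w, θderiv] at h0
      have i1 := hint ψ h1.continuous h2 h3 w hw
      have i2 := hint _ b.continuous_normed b.hasCompactSupport_normed hb w hw
      have e : (fun t => φ t • w t) = fun t => ψ t • w t - m • (b.normed volume t • w t) := by
        funext t; simp only [φ, sub_smul, mul_smul]
      rw [e, integral_sub i1 (by exact i2.smul m), integral_smul, ← hcdef] at h0
      simp only [Pi.sub_apply, smul_sub]
      rw [integral_sub i1 ((h1.continuous.integrable_of_hasCompactSupport h2).smul_const c),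
        integral_smul_const, ← hm, h0])
  rw [ae_restrict_iff' measurableSet_Ioi]
  filter_upwards [key] with t ht h0
  exact sub_eq_zero.mp (ht h0)

omit [NormedSpace ℝ F] in
lemma locallyIntegrableOn_L2Time (u : L2Time F) : LocallyIntegrableOn u (Ioi 0) :=
  locallyIntegrableOn_of_locallyIntegrable_restrict ((Lp.memLp u).locallyIntegrable (by norm_num))

/-- A function with a weak derivative in `L²` is a primitive of it. -/
theorem IsWeakTimeDeriv.ae_eq_primitive [CompleteSpace F] {u v : L2Time F}
    (h : IsWeakTimeDeriv u v) :
    ∃ a, ∀ᵐ t ∂timeMeasure, u t = a + ∫ r in (0 : ℝ)..t, v r := by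
  have hcont := (continuousOn_primitive_L2Time v 0).mono (Ioi_subset_Ici_self)
  have hU : LocallyIntegrableOn (fun t => (0 : F) + ∫ r in (0 : ℝ)..t, v r) (Ioi 0) :=
    hcont.locallyIntegrableOn measurableSet_Ioi
  -- The function minus the primitive of `v` starting from `0` has zero weak derivative; the initial
  -- value `0` removes the boundary term.
  obtain ⟨c, hc⟩ := ae_eq_const_of_integral_deriv_smul
    ((locallyIntegrableOn_L2Time u).sub hU) (fun ψ h1 h2 h3 => by
      have e := integral_deriv_smul_primitive h1 h2 v 0
      have hd : Continuous (deriv ψ) := h1.continuous_deriv (by simp)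
      have i1 := integrable_smul_L2Time hd h2.deriv u
      obtain ⟨T, hT, hz⟩ := exists_support_bound h2
      have i2 : Integrable (fun t => deriv ψ t • ((0 : F) + ∫ r in (0 : ℝ)..t, v r))
          timeMeasure := by
        have k : IntegrableOn (fun t => deriv ψ t • ((0 : F) + ∫ r in (0 : ℝ)..t, v r))
            (Icc 0 T) :=
          (hd.continuousOn.smul ((continuousOn_primitive_L2Time v 0).mono
            Icc_subset_Ici_self)).integrableOn_compact isCompact_Icc
        refine k.of_forall_sdiff_eq_zero measurableSet_Ioi fun t ht => ?_
        have : T ≤ t := by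
          by_contra hlt
          exact ht.2 ⟨(mem_Ioi.mp ht.1).le, (not_le.mp hlt).le⟩
        rw [(hz t this).2, zero_smul]
      simp only [Pi.sub_apply, smul_sub]
      rw [integral_sub i1 i2, e, h ψ h1 h2 h3]
      simp)
  refine ⟨c, ?_⟩
  filter_upwards [hc] with t ht
  rw [← ht]
  simp

/-- This makes the almost-everywhere filter nontrivial, so properties valid almost everywhere can be
evaluated at some time. -/
instance : NeZero timeMeasure := ⟨by
  rw [Ne, Measure.restrict_eq_zero]; simp⟩

lemma primitive_const_unique {a a' : F} {u v : ℝ → F}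
    (h : ∀ᵐ t ∂timeMeasure, u t = a + ∫ r in (0 : ℝ)..t, v r)
    (h' : ∀ᵐ t ∂timeMeasure, u t = a' + ∫ r in (0 : ℝ)..t, v r) : a = a' := by
  obtain ⟨t, h1, h2⟩ := (h.and h').exists
  exact add_right_cancel (h1.symm.trans h2)

end TimeCalculus

/-! ### Energy identity and bounds uniform in time. -/

section Energy

variable {F : Type} [NormedAddCommGroup F] [InnerProductSpace ℝ F] [CompleteSpace F]

/-- The energy identity for a primitive with values in a Hilbert space. -/
theorem norm_sq_primitive (v : L2Time F) (a : F) {t : ℝ} (ht : 0 ≤ t) :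
    IntervalIntegrable (fun r => inner ℝ (a + ∫ x in (0 : ℝ)..r, v x) (v r)) volume 0 t ∧
    ‖a + ∫ r in (0 : ℝ)..t, v r‖ ^ 2 =
      ‖a‖ ^ 2 + 2 * ∫ r in (0 : ℝ)..t, inner ℝ (a + ∫ x in (0 : ℝ)..r, v x) (v r) := by
  obtain ⟨h1, h2⟩ := bilin_primitive (innerSL ℝ (E := F)) (intervalIntegrable_L2Time v ht)
    (intervalIntegrable_L2Time v ht) a a
  have e : ∀ r, (innerSL ℝ (v r)) (a + ∫ x in (0 : ℝ)..r, v x) +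
      (innerSL ℝ (a + ∫ x in (0 : ℝ)..r, v x)) (v r) =
      2 * inner ℝ (a + ∫ x in (0 : ℝ)..r, v x) (v r) := by
    intro r
    rw [innerSL_apply_apply, innerSL_apply_apply, real_inner_comm]; ring
  simp only [e] at h1 h2
  refine ⟨by simpa using h1.const_mul (1 / 2), ?_⟩
  rw [innerSL_apply_apply, innerSL_apply_apply, real_inner_self_eq_norm_sq,
    real_inner_self_eq_norm_sq, intervalIntegral.integral_const_mul] at h2
  exact h2

omit [InnerProductSpace ℝ F] [CompleteSpace F] in
lemma integrable_norm_mul_norm (u v : L2Time F) :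
    Integrable (fun t => ‖u t‖ * ‖v t‖) timeMeasure := by
  have := (Lp.memLp u).norm.integrable_mul (Lp.memLp v).norm
  exact this

omit [InnerProductSpace ℝ F] [CompleteSpace F] in
lemma integrable_norm_sq (u : L2Time F) : Integrable (fun t => ‖u t‖ ^ 2) timeMeasure := by
  simpa only [pow_two] using integrable_norm_mul_norm u u

omit [CompleteSpace F] in
lemma norm_sq_L2Time (u : L2Time F) : ‖u‖ ^ 2 = ∫ t, ‖u t‖ ^ 2 ∂timeMeasure := by
  rw [← real_inner_self_eq_norm_sq, L2.inner_def]
  simp only [real_inner_self_eq_norm_sq]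

/-- The energy identity between `t` and a later time `r` bounds `‖x(t)‖²` by `‖x(r)‖²` plus twice
the integral of `‖u‖‖v‖`. Averaging over `r` in `[t, t + 1]` replaces the value at `r` by the `L²`
norm. The bound does not depend on `t`; it underlies both the traces and the control of the
advection term. -/
theorem norm_sq_primitive_le {u v : L2Time F} {a : F}
    (h : ∀ᵐ t ∂timeMeasure, u t = a + ∫ r in (0 : ℝ)..t, v r) {t : ℝ} (ht : 0 ≤ t) :
    ‖a + ∫ r in (0 : ℝ)..t, v r‖ ^ 2 ≤
      ∫ r, (‖u r‖ ^ 2 + 2 * (‖u r‖ * ‖v r‖)) ∂timeMeasure := by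
  set x : ℝ → F := fun t => a + ∫ r in (0 : ℝ)..t, v r with hx
  have iuv := integrable_norm_mul_norm u v
  have iu := integrable_norm_sq u
  set J := ∫ r, ‖u r‖ * ‖v r‖ ∂timeMeasure with hJ
  have h' : ∀ᵐ r, r ∈ Ioi (0 : ℝ) → u r = x r := (ae_restrict_iff' measurableSet_Ioi).mp h
  have step : ∀ r, t ≤ r → ‖x t‖ ^ 2 - 2 * J ≤ ‖x r‖ ^ 2 := by
    intro r hr
    obtain ⟨i1, e1⟩ := norm_sq_primitive v a ht
    obtain ⟨i2, e2⟩ := norm_sq_primitive v a (ht.trans hr)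
    have e3 : ‖x r‖ ^ 2 - ‖x t‖ ^ 2 = 2 * ∫ y in t..r, inner ℝ (x y) (v y) := by
      rw [← intervalIntegral.integral_interval_sub_left i2 i1]
      simp only [hx]
      rw [e1, e2]; ring
    have e4 : |∫ y in t..r, inner ℝ (x y) (v y)| ≤ J := by
      rw [← Real.norm_eq_abs]
      refine (intervalIntegral.norm_integral_le_integral_norm hr).trans ?_
      rw [intervalIntegral.integral_of_le hr]
      calc ∫ y in Ioc t r, ‖inner ℝ (x y) (v y)‖ ≤ ∫ y in Ioc t r, ‖u y‖ * ‖v y‖ := by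
            refine integral_mono_of_nonneg (.of_forall fun _ => norm_nonneg _)
              (iuv.mono_measure (Measure.restrict_mono (fun y hy =>
                mem_Ioi.mpr (ht.trans_lt hy.1)) le_rfl)) ?_
            filter_upwards [ae_restrict_of_ae h', ae_restrict_mem measurableSet_Ioc] with y hy hy'
            rw [← hy (mem_Ioi.mpr (ht.trans_lt hy'.1))]
            exact norm_inner_le_norm _ _
        _ ≤ J := setIntegral_mono_set iuv (.of_forall fun _ => by positivity)
            (.of_forall fun y hy => mem_Ioi.mpr (ht.trans_lt hy.1))
    have := abs_le.mp e4
    linarith [this.1]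
  have cx : ContinuousOn x (Ici 0) := continuousOn_primitive_L2Time v a
  -- An interval of length one, so the constant on the left integrates to itself.
  have avg : ∫ r in t..(t + 1), (‖x t‖ ^ 2 - 2 * J) ≤ ∫ r in t..(t + 1), ‖x r‖ ^ 2 := by
    refine intervalIntegral.integral_mono_on (by linarith) (by simp) ?_ fun r hr => step r hr.1
    refine ContinuousOn.intervalIntegrable ?_
    rw [uIcc_of_le (by linarith)]
    exact ((cx.mono fun r hr => mem_Ici.mpr (ht.trans hr.1)).norm.pow 2)
  have avg2 : ∫ r in t..(t + 1), ‖x r‖ ^ 2 ≤ ∫ r, ‖u r‖ ^ 2 ∂timeMeasure := by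
    rw [intervalIntegral.integral_of_le (by linarith)]
    calc ∫ r in Ioc t (t + 1), ‖x r‖ ^ 2 = ∫ r in Ioc t (t + 1), ‖u r‖ ^ 2 := by
          refine integral_congr_ae ?_
          filter_upwards [ae_restrict_of_ae h', ae_restrict_mem measurableSet_Ioc] with y hy hy'
          rw [← hy (mem_Ioi.mpr (ht.trans_lt hy'.1))]
      _ ≤ _ := setIntegral_mono_set iu (.of_forall fun _ => by positivity)
            (.of_forall fun y hy => mem_Ioi.mpr (ht.trans_lt hy.1))
  rw [integral_add iu (iuv.const_mul 2), integral_const_mul, ← hJ]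
  simp at avg
  linarith

end Energy

/-! ### Linear parabolic equations in Hilbert spaces -/

/-- Lions' projection lemma. -/
theorem exists_inner_eq_of_le_norm {Φ W : Type*} [AddCommGroup Φ] [Module ℝ Φ]
    [NormedAddCommGroup W] [InnerProductSpace ℝ W] [CompleteSpace W]
    (K : Φ →ₗ[ℝ] W) (l : Φ →ₗ[ℝ] ℝ) {C : ℝ} (h : ∀ φ, |l φ| ≤ C * ‖K φ‖) :
    ∃ y : W, ∀ φ, inner ℝ y (K φ) = l φ := by
  have hker : LinearMap.ker K ≤ LinearMap.ker l := by
    intro φ hφ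
    have h1 := h φ
    rw [LinearMap.mem_ker.mp hφ, norm_zero, mul_zero] at h1
    exact LinearMap.mem_ker.mpr (abs_nonpos_iff.mp h1)
  let g : LinearMap.range K →ₗ[ℝ] ℝ :=
    ((LinearMap.ker K).liftQ l hker).comp K.quotKerEquivRange.symm.toLinearMap
  have hg : ∀ φ, g ⟨K φ, LinearMap.mem_range_self K φ⟩ = l φ := by
    intro φ
    have : K.quotKerEquivRange.symm ⟨K φ, LinearMap.mem_range_self K φ⟩ =
        (LinearMap.ker K).mkQ φ := by
      rw [LinearEquiv.symm_apply_eq]; rfl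
    simp only [g, LinearMap.comp_apply, LinearEquiv.coe_coe, this]
    simp
  have hb : ∀ x, ‖g x‖ ≤ C * ‖x‖ := by
    rintro ⟨_, φ, rfl⟩
    rw [hg]
    exact h φ
  -- The bound lets `l` descend to a continuous functional on the range of `K`; Hahn-Banach extends
  -- it and Riesz represents it.
  obtain ⟨f, hf, -⟩ := exists_extension_norm_eq (𝕜 := ℝ) (LinearMap.range K) (g.mkContinuous C hb)
  refine ⟨(InnerProductSpace.toDual ℝ W).symm f, fun φ => ?_⟩
  rw [InnerProductSpace.toDual_symm_apply, ← hg]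
  exact hf ⟨K φ, LinearMap.mem_range_self K φ⟩

/-! ### Existence for one abstract parabolic equation by Lions' method. -/

section Lions

variable {V F : Type} [NormedAddCommGroup V] [InnerProductSpace ℝ V] [CompleteSpace V]
  [NormedAddCommGroup F] [InnerProductSpace ℝ F] [CompleteSpace F]

/-- Smooth compactly supported functions of time. -/
def testSub (V : Type) [NormedAddCommGroup V] [NormedSpace ℝ V] : Submodule ℝ (ℝ → V) where
  carrier := {ψ | ContDiff ℝ (⊤ : ℕ∞) ψ ∧ HasCompactSupport ψ}
  zero_mem' := ⟨contDiff_const, HasCompactSupport.zero⟩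
  add_mem' := fun h h' => ⟨h.1.add h'.1, h.2.add h'.2⟩
  smul_mem' := fun c _ h => ⟨h.1.const_smul c, h.2.smul_left (f := fun _ => c)⟩

omit [CompleteSpace V] in
lemma testSub.memLp (ψ : testSub V) : MemLp ψ.1 2 timeMeasure :=
  (ψ.2.1.continuous.memLp_of_hasCompactSupport ψ.2.2 (μ := volume)).restrict _

omit [CompleteSpace V] in
lemma testSub.memLp_deriv (ψ : testSub V) : MemLp (deriv ψ.1) 2 timeMeasure :=
  ((ψ.2.1.continuous_deriv (by simp)).memLp_of_hasCompactSupport ψ.2.2.deriv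
    (μ := volume)).restrict _

/-- A test function as an element of `L²`. -/
def testSub.toL2 : testSub V →ₗ[ℝ] L2Time V where
  toFun ψ := (testSub.memLp ψ).toLp
  map_add' ψ φ := MemLp.toLp_add (testSub.memLp ψ) (testSub.memLp φ)
  map_smul' c ψ := MemLp.toLp_const_smul c (testSub.memLp ψ)

/-- The derivative of a test function as an element of `L²`. -/
def testSub.derivL2 : testSub V →ₗ[ℝ] L2Time V where
  toFun ψ := (testSub.memLp_deriv ψ).toLp
  map_add' ψ φ := by
    rw [← MemLp.toLp_add]
    congr 1
    funext t
    exact deriv_add ((ψ.2.1.differentiable (by simp)) t) ((φ.2.1.differentiable (by simp)) t)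
  map_smul' c ψ := by
    rw [RingHom.id_apply, ← MemLp.toLp_const_smul]
    congr 1
    funext t
    exact deriv_const_smul c ((ψ.2.1.differentiable (by simp)) t)

omit [CompleteSpace V] [CompleteSpace F] in
lemma inner_compLp (S T : V →L[ℝ] F) (u v : L2Time V) :
    inner ℝ (S.compLp u) (T.compLp v) = ∫ t, inner ℝ (S (u t)) (T (v t)) ∂timeMeasure := by
  rw [L2.inner_def]
  refine integral_congr_ae ?_
  filter_upwards [S.coeFn_compLp u, T.coeFn_compLp v] with t h1 h2
  rw [h1, h2]

variable (ι : V →L[ℝ] F) (A : V →L[ℝ] F) (L : V ≃L[ℝ] F) (m : F ≃L[ℝ] F)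

-- By the symmetry of the form, the integrand is half the derivative of `⟨m ι ψ, L ψ⟩`. Test
-- functions vanish at infinity but not at zero, so only the boundary term at `0` remains.
omit [CompleteSpace V] [CompleteSpace F] in
lemma integral_inner_deriv_test
    (hsymm : ∀ v w, inner ℝ (m (ι v)) (L w) = inner ℝ (m (ι w)) (L v)) (ψ : testSub V) :
    ∫ t, inner ℝ (m (ι (ψ.1 t))) (L (deriv ψ.1 t)) ∂timeMeasure =
      -(1 / 2 * inner ℝ (m (ι (ψ.1 0))) (L (ψ.1 0))) := by
  have hd : Continuous (deriv ψ.1) := ψ.2.1.continuous_deriv (by simp)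
  have hderiv : ∀ t, HasDerivAt (fun t => inner ℝ (m (ι (ψ.1 t))) (L (ψ.1 t)))
      (2 * inner ℝ (m (ι (ψ.1 t))) (L (deriv ψ.1 t))) t := by
    intro t
    have h0 := ((ψ.2.1.differentiable (by simp)) t).hasDerivAt
    have h1 : HasDerivAt (fun t => m (ι (ψ.1 t))) (m (ι (deriv ψ.1 t))) t :=
      (m.toContinuousLinearMap.comp ι).hasFDerivAt.comp_hasDerivAt t h0
    have h2 : HasDerivAt (fun t => L (ψ.1 t)) (L (deriv ψ.1 t)) t :=
      L.toContinuousLinearMap.hasFDerivAt.comp_hasDerivAt t h0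
    have h3 := h1.inner ℝ h2
    rw [hsymm (deriv ψ.1 t)] at h3
    convert! h3 using 1
    ring
  have hcs : HasCompactSupport (fun t => inner ℝ (m (ι (ψ.1 t))) (L (ψ.1 t))) :=
    ψ.2.2.comp_left (g := fun v => inner ℝ (m (ι v)) (L v)) (by simp)
  have hcd : ContDiff ℝ 1 (fun t => inner ℝ (m (ι (ψ.1 t))) (L (ψ.1 t))) := by
    have h1 : ContDiff ℝ 1 ψ.1 := ψ.2.1.of_le (by simp)
    exact ((m.toContinuousLinearMap.comp ι).contDiff.comp h1).inner ℝ
      (L.toContinuousLinearMap.contDiff.comp h1)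
  have h := hcs.integral_Ioi_deriv_eq hcd 0
  rw [funext fun t => (hderiv t).deriv, integral_const_mul] at h
  linarith

/-- Testing `m y' + A y = f`, `y(0) = y₀` against `L ψ` and moving the derivative onto `ψ` gives
`⟨y, S ψ⟩ = l ψ`. Coercivity of `A` relative to `L` and the sign of the boundary term make `l`
bounded by `‖S ψ‖`, and Lions' lemma provides `y`. The hypothesis on `y₀` expresses that it lies in
the trace space: its pairing is controlled by the energy `⟨m ι v, L v⟩`, which is the quantity at
time zero that the estimate controls. -/
theorem exists_parabolic_solution {c K : ℝ} (hc : 0 < c)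
    (hsymm : ∀ v w, inner ℝ (m (ι v)) (L w) = inner ℝ (m (ι w)) (L v))
    (hpos : ∀ v, 0 ≤ inner ℝ (m (ι v)) (L v))
    (hcoer : ∀ v, c * ‖v‖ ^ 2 ≤ inner ℝ (A v) (L v)) (f : L2Time F) (y₀ : F)
    (hy₀ : ∀ v, |inner ℝ (m y₀) (L v)| ≤ K * Real.sqrt (inner ℝ (m (ι v)) (L v))) :
    ∃ p : Parabolic ι, (∀ᵐ t ∂timeMeasure, m (p.dt t) + A (p.fn t) = f t) ∧
      ∀ᵐ t ∂timeMeasure, ι (p.fn t) = y₀ + ∫ r in (0 : ℝ)..t, p.dt r := by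
  let M : V →L[ℝ] F := m.toContinuousLinearMap.comp ι
  let L' : V →L[ℝ] F := L.toContinuousLinearMap
  -- The adjoint operator `A* L ψ - M* L ψ'`.
  let S : testSub V →ₗ[ℝ] L2Time V :=
    ((ContinuousLinearMap.adjoint (A.compLpL 2 timeMeasure)).comp
      (L'.compLpL 2 timeMeasure)).toLinearMap.comp testSub.toL2 -
    ((ContinuousLinearMap.adjoint (M.compLpL 2 timeMeasure)).comp
      (L'.compLpL 2 timeMeasure)).toLinearMap.comp testSub.derivL2
  have hS : ∀ (y : L2Time V) (ψ : testSub V), inner ℝ y (S ψ) =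
      (∫ t, inner ℝ (A (y t)) (L (ψ.1 t)) ∂timeMeasure) -
        ∫ t, inner ℝ (M (y t)) (L (deriv ψ.1 t)) ∂timeMeasure := by
    intro y ψ
    simp only [S, LinearMap.sub_apply, LinearMap.comp_apply, ContinuousLinearMap.coe_coe,
      ContinuousLinearMap.comp_apply, inner_sub_right, ContinuousLinearMap.adjoint_inner_right]
    refine congrArg₂ _ ((inner_compLp A L' y _).trans ?_) ((inner_compLp M L' y _).trans ?_)
    · refine integral_congr_ae ?_
      filter_upwards [MemLp.coeFn_toLp (testSub.memLp ψ)] with t ht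
      have : (testSub.toL2 ψ) t = ψ.1 t := ht
      rw [this]; rfl
    · refine integral_congr_ae ?_
      filter_upwards [MemLp.coeFn_toLp (testSub.memLp_deriv ψ)] with t ht
      have : (testSub.derivL2 ψ) t = deriv ψ.1 t := ht
      rw [this]; rfl
  let l : testSub V →ₗ[ℝ] ℝ :=
    ((innerSL ℝ f).comp (L'.compLpL 2 timeMeasure)).toLinearMap.comp testSub.toL2 +
      ((innerSL ℝ (m y₀)).comp L').toLinearMap.comp
        ((LinearMap.proj (0 : ℝ)).comp (testSub V).subtype)
  have hl : ∀ ψ : testSub V, l ψ = inner ℝ f (L'.compLp (testSub.toL2 ψ)) +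
      inner ℝ (m y₀) (L (ψ.1 0)) := fun ψ => rfl
  -- The first part of the constant bounds the forcing, through `N ≤ ‖S ψ‖ / c`; the second bounds
  -- the initial datum, through `√β ≤ √(2/c) ‖S ψ‖`.
  have hbound : ∀ ψ : testSub V, |l ψ| ≤
      (‖f‖ * ‖L'‖ / c + |K| * Real.sqrt (2 / c)) * ‖S ψ‖ := by
    intro ψ
    set N := ‖testSub.toL2 ψ‖ with hN
    set β := inner ℝ (m (ι (ψ.1 0))) (L (ψ.1 0)) with hβ
    have hβ0 : 0 ≤ β := hpos _
    -- Pairing `ψ` with `S ψ` gives coercivity from `A`, and the derivative term contributes half of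
    -- the energy at time zero with a favourable sign.
    have h1 : c * N ^ 2 + 1 / 2 * β ≤ inner ℝ (testSub.toL2 ψ) (S ψ) := by
      rw [hS, hN, norm_sq_L2Time, ← integral_const_mul]
      have e1 : ∫ t, inner ℝ (M ((testSub.toL2 ψ) t)) (L (deriv ψ.1 t)) ∂timeMeasure =
          -(1 / 2 * β) := by
        rw [hβ, ← integral_inner_deriv_test ι L m hsymm ψ]
        refine integral_congr_ae ?_
        filter_upwards [MemLp.coeFn_toLp (testSub.memLp ψ)] with t ht
        have : (testSub.toL2 ψ) t = ψ.1 t := ht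
        rw [this]; rfl
      rw [e1, sub_neg_eq_add]
      refine add_le_add ?_ le_rfl
      refine integral_mono_ae ((integrable_norm_sq (testSub.toL2 ψ)).const_mul c) ?_ ?_
      · refine (L2.integrable_inner (𝕜 := ℝ) (E := F) (A.compLp (testSub.toL2 ψ))
          (L'.compLp (testSub.toL2 ψ))).congr ?_
        filter_upwards [MemLp.coeFn_toLp (testSub.memLp ψ), A.coeFn_compLp (testSub.toL2 ψ),
          L'.coeFn_compLp (testSub.toL2 ψ)] with t ht h2 h3
        have : (testSub.toL2 ψ) t = ψ.1 t := ht
        rw [h2, h3, this]; rfl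
      · filter_upwards [MemLp.coeFn_toLp (testSub.memLp ψ)] with t ht
        have : (testSub.toL2 ψ) t = ψ.1 t := ht
        rw [this]; exact hcoer _
    have h2 : inner ℝ (testSub.toL2 ψ) (S ψ) ≤ N * ‖S ψ‖ := real_inner_le_norm _ _
    have hN0 : 0 ≤ N := norm_nonneg _
    have hn0 : 0 ≤ ‖S ψ‖ := norm_nonneg _
    have h3 : N ≤ ‖S ψ‖ / c := by
      rw [le_div_iff₀ hc]
      rcases hN0.eq_or_lt with h0 | h0
      · rw [← h0]; simp
      · refine le_of_mul_le_mul_left ?_ h0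
        nlinarith
    have h4 : β ≤ 2 / c * ‖S ψ‖ ^ 2 := by
      have : N * ‖S ψ‖ ≤ ‖S ψ‖ / c * ‖S ψ‖ := by gcongr
      have e : 2 / c * ‖S ψ‖ ^ 2 = 2 * (‖S ψ‖ / c * ‖S ψ‖) := by ring
      rw [e]
      nlinarith [mul_nonneg hc.le (sq_nonneg N)]
    have h5 : Real.sqrt β ≤ Real.sqrt (2 / c) * ‖S ψ‖ := by
      refine (Real.sqrt_le_sqrt h4).trans ?_
      rw [Real.sqrt_mul (by positivity), Real.sqrt_sq hn0]
    rw [hl]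
    refine (abs_add_le _ _).trans ?_
    rw [add_mul]
    refine add_le_add ?_ ?_
    · calc _ ≤ ‖f‖ * ‖L'.compLp (testSub.toL2 ψ)‖ := abs_real_inner_le_norm _ _
        _ ≤ ‖f‖ * (‖L'‖ * N) := by
            gcongr; exact L'.norm_compLp_le _
        _ ≤ ‖f‖ * (‖L'‖ * (‖S ψ‖ / c)) := by gcongr
        _ = _ := by ring
    · calc _ ≤ K * Real.sqrt β := hy₀ _
        _ ≤ |K| * Real.sqrt β := by gcongr; exact le_abs_self K
        _ ≤ |K| * (Real.sqrt (2 / c) * ‖S ψ‖) := by gcongr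
        _ = _ := by ring
  obtain ⟨y, hy⟩ := exists_inner_eq_of_le_norm S l hbound
  -- The derivative is defined by solving the equation for it; what remains is that it is the weak
  -- derivative of `ι y` and that the initial value is `y₀`.
  let dt : L2Time F := m.symm.toContinuousLinearMap.compLp (f - A.compLp y)
  have hdt : ∀ᵐ t ∂timeMeasure, dt t = m.symm (f t - A (y t)) := by
    filter_upwards [m.symm.toContinuousLinearMap.coeFn_compLp (f - A.compLp y),
      Lp.coeFn_sub f (A.compLp y), A.coeFn_compLp y] with t h1 h2 h3
    rw [h1, h2, Pi.sub_apply, h3]; rfl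
  -- Since `θ` may be nonzero at `0`, this one identity contains both the weak derivative and the
  -- initial condition.
  have hweak : ∀ θ : ℝ → ℝ, ContDiff ℝ (⊤ : ℕ∞) θ → HasCompactSupport θ →
      ∫ t, deriv θ t • ι (y t) ∂timeMeasure =
        -(θ 0 • y₀) - ∫ t, θ t • dt t ∂timeMeasure := by
    intro θ h1 h2
    have hd : Continuous (deriv θ) := h1.continuous_deriv (by simp)
    have i1 : Integrable (fun t => deriv θ t • ι (y t)) timeMeasure := by
      refine (integrable_smul_L2Time hd h2.deriv (ι.compLp y)).congr ?_
      filter_upwards [ι.coeFn_compLp y] with t ht using by rw [ht]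
    have i2 := integrable_smul_L2Time h1.continuous h2 dt
    apply m.injective
    apply ext_inner_right ℝ
    intro x
    -- The vectors `L v` exhaust `F`, so the tests `ψ = θ v` determine the vector-valued identity.
    obtain ⟨v, rfl⟩ := L.surjective x
    let ψ : testSub V := ⟨fun t => θ t • v, h1.smul contDiff_const, h2.smul_right⟩
    have hψd : ∀ t, deriv ψ.1 t = deriv θ t • v := fun t =>
      deriv_smul_const ((h1.differentiable (by simp)) t) v
    have e := hy ψ
    rw [hS, hl] at e
    have m1 : m (∫ t, deriv θ t • ι (y t) ∂timeMeasure) =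
        ∫ t, deriv θ t • m (ι (y t)) ∂timeMeasure := by
      rw [← ContinuousLinearEquiv.integral_comp_comm]
      simp only [map_smul]
    have m2 : m (∫ t, θ t • dt t ∂timeMeasure) = ∫ t, θ t • m (dt t) ∂timeMeasure := by
      rw [← ContinuousLinearEquiv.integral_comp_comm]
      simp only [map_smul]
    have i1' : Integrable (fun t => deriv θ t • m (ι (y t))) timeMeasure := by
      have := m.toContinuousLinearMap.integrable_comp i1
      simpa only [ContinuousLinearEquiv.coe_coe, map_smul] using this
    have i2' : Integrable (fun t => θ t • m (dt t)) timeMeasure := by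
      have := m.toContinuousLinearMap.integrable_comp i2
      simpa only [ContinuousLinearEquiv.coe_coe, map_smul] using this
    rw [map_sub, map_neg, map_smul, inner_sub_left, inner_neg_left, inner_smul_left, m1, m2]
    rw [real_inner_comm, ← integral_inner i1', real_inner_comm _ (∫ t, θ t • m (dt t) ∂timeMeasure),
      ← integral_inner i2']
    have e1 : ∫ t, inner ℝ (L v) (deriv θ t • m (ι (y t))) ∂timeMeasure =
        ∫ t, inner ℝ (M (y t)) (L (deriv ψ.1 t)) ∂timeMeasure := by
      refine integral_congr_ae (.of_forall fun t => ?_)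
      simp only [hψd, map_smul, inner_smul_right, real_inner_comm (L v)]
      rfl
    have e2 : ∫ t, inner ℝ (L v) (θ t • m (dt t)) ∂timeMeasure =
        inner ℝ f (L'.compLp (testSub.toL2 ψ)) -
          ∫ t, inner ℝ (A (y t)) (L (ψ.1 t)) ∂timeMeasure := by
      have hA : ∫ t, inner ℝ (A (y t)) (L (ψ.1 t)) ∂timeMeasure =
          inner ℝ (A.compLp y) (L'.compLp (testSub.toL2 ψ)) := by
        rw [inner_compLp]
        refine integral_congr_ae ?_
        filter_upwards [MemLp.coeFn_toLp (testSub.memLp ψ)] with t ht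
        have : (testSub.toL2 ψ) t = ψ.1 t := ht
        rw [this]; rfl
      rw [hA, ← inner_sub_left, L2.inner_def]
      refine integral_congr_ae ?_
      filter_upwards [hdt, Lp.coeFn_sub f (A.compLp y), A.coeFn_compLp y,
        L'.coeFn_compLp (testSub.toL2 ψ), MemLp.coeFn_toLp (testSub.memLp ψ)] with t k1 k2 k3 k4 k5
      have k5' : (testSub.toL2 ψ) t = ψ.1 t := k5
      rw [k1, k2, k4, k5', Pi.sub_apply, k3, m.apply_symm_apply]
      simp only [ψ, L', ContinuousLinearEquiv.coe_coe, map_smul, inner_smul_right]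
      rw [real_inner_comm]
    rw [e1, e2]
    have e3 : inner ℝ (m y₀) (L (ψ.1 0)) = θ 0 * inner ℝ (m y₀) (L v) := by
      simp only [ψ, map_smul, inner_smul_right]
    rw [e3] at e
    simp only [conj_trivial]
    linarith
  have hwd : IsWeakTimeDeriv (fun t => ι (y t)) dt := by
    intro θ h1 h2 h3
    rw [hweak θ h1 h2, image_eq_zero_of_notMem_tsupport fun h0 => lt_irrefl (0 : ℝ) (h3 h0)]
    simp
  refine ⟨⟨(y, dt), hwd⟩, ?_, ?_⟩
  · filter_upwards [hdt] with t ht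
    change m (dt t) + A (y t) = f t
    rw [ht, m.apply_symm_apply]; abel
  · have hcongr : (ι.compLp y : ℝ → F) =ᵐ[timeMeasure] fun t => ι (y t) := ι.coeFn_compLp y
    have hwd' : IsWeakTimeDeriv (ι.compLp y) dt := by
      intro θ h1 h2 h3
      rw [← hwd θ h1 h2 h3]
      refine integral_congr_ae ?_
      filter_upwards [hcongr] with t ht using by rw [ht]
    obtain ⟨a, ha⟩ := hwd'.ae_eq_primitive
    have haa : a = y₀ := by
      -- A test function equal to one at time zero compares the two boundary terms.
      let b : ContDiffBump (0 : ℝ) := ⟨1, 2, by norm_num, by norm_num⟩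
      have h1 := hweak b b.contDiff b.hasCompactSupport
      have h2 := integral_deriv_smul_primitive b.contDiff b.hasCompactSupport dt a
      have h3 : ∫ t, deriv b t • ι (y t) ∂timeMeasure =
          ∫ t, deriv b t • (a + ∫ r in (0 : ℝ)..t, dt r) ∂timeMeasure := by
        refine integral_congr_ae ?_
        filter_upwards [hcongr, ha] with t k1 k2
        rw [← k2, k1]
      rw [← h3, h1] at h2
      have hb : b (0 : ℝ) = 1 := b.one_of_mem_closedBall (Metric.mem_closedBall_self b.rIn_pos.le)
      rw [hb, one_smul, one_smul] at h2
      exact (neg_injective (sub_left_injective h2)).symm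
    filter_upwards [hcongr, ha] with t k1 k2
    rw [← haa]
    exact k1.symm.trans k2

end Lions

/-! ### Sobolev spaces through Fourier coefficients -/

/-- Complex vectors. -/
abbrev CVec : Type := EuclideanSpace ℂ (Fin 3)

/-- The weight `1 + |k|²`. -/
def wt (k : Fin 3 → ℤ) : ℝ := 1 + freqSq k

lemma one_le_wt (k : Fin 3 → ℤ) : 1 ≤ wt k := by
  have := freqSq_nonneg k
  rw [wt]; linarith

lemma wt_pos (k : Fin 3 → ℤ) : 0 < wt k := zero_lt_one.trans_le (one_le_wt k)

lemma wt_rpow_pos (k : Fin 3 → ℤ) (r : ℝ) : 0 < wt k ^ r := Real.rpow_pos_of_pos (wt_pos k) r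

lemma freqSq_neg (k : Fin 3 → ℤ) : freqSq (-k) = freqSq k := by simp [freqSq]

lemma wt_neg (k : Fin 3 → ℤ) : wt (-k) = wt k := by rw [wt, wt, freqSq_neg]

lemma wt_rpow_half_sq (k : Fin 3 → ℤ) (s : ℝ) : (wt k ^ (s / 2)) ^ 2 = wt k ^ s := by
  rw [← Real.rpow_natCast, ← Real.rpow_mul (wt_pos k).le]
  congr 1
  push_cast
  ring

/-- Componentwise complex conjugation. -/
def conjVec (c : CVec) : CVec := WithLp.toLp 2 fun i => conj (c i)

lemma conjVec_apply (c : CVec) (i : Fin 3) : conjVec c i = conj (c i) := rfl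

lemma inner_cvec (x y : CVec) :
    inner ℝ x y = ∑ i, ((x i).re * (y i).re + (x i).im * (y i).im) := by
  rw [PiLp.inner_apply]
  refine Finset.sum_congr rfl fun i _ => ?_
  rw [Complex.inner]
  simp [mul_comm]

lemma norm_sq_cvec (x : CVec) : ‖x‖ ^ 2 = ∑ i, ((x i).re ^ 2 + (x i).im ^ 2) := by
  rw [← real_inner_self_eq_norm_sq, inner_cvec]
  simp only [pow_two]

/-- Three components give the factor `√3`, rounded up to `2`. -/
lemma norm_cvec_le {x : CVec} {B : ℝ} (hB : 0 ≤ B) (h : ∀ i, ‖x i‖ ≤ B) : ‖x‖ ≤ 2 * B := by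
  refine le_of_sq_le_sq ?_ (by positivity)
  rw [EuclideanSpace.norm_sq_eq, Fin.sum_univ_three]
  have h0 := pow_le_pow_left₀ (norm_nonneg _) (h 0) 2
  have h1 := pow_le_pow_left₀ (norm_nonneg _) (h 1) 2
  have h2 := pow_le_pow_left₀ (norm_nonneg _) (h 2) 2
  nlinarith [sq_nonneg B]

lemma vecCoeff_neg (f : VField) (k : Fin 3 → ℤ) : vecCoeff f (-k) = conjVec (vecCoeff f k) := by
  ext i; exact fourierCoeff_neg (f i) k

lemma vecCoeff_injective {f g : VField} (h : ∀ k, vecCoeff f k = vecCoeff g k) : f = g := by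
  funext i
  rw [← sub_eq_zero]
  refine eq_zero_of_fourierCoeff _ fun k => ?_
  have h1 : fourierCoeff (f i) k = fourierCoeff (g i) k :=
    congrArg (fun v : CVec => v i) (h k)
  have h2 : f i - g i = f i + (-1 : ℝ) • g i := by
    rw [neg_one_smul, sub_eq_add_neg]
  rw [h2, fourierCoeff_add, fourierCoeff_smul, h1]
  simp

namespace H

variable {s : ℝ}

/-- The Fourier coefficients of a Sobolev field. -/
def coeff (k : Fin 3 → ℤ) : H s →ₗ[ℝ] CVec where
  toFun f := vecCoeff f.field k
  map_add' f g := by rw [map_add, vecCoeff_add]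
  map_smul' c f := by rw [map_smul, vecCoeff_smul, RingHom.id_apply]

lemma coeff_def (f : H s) (k : Fin 3 → ℤ) : coeff k f = vecCoeff f.field k := rfl

lemma ext_coeff {f g : H s} (h : ∀ k, coeff k f = coeff k g) : f = g :=
  field_injective (vecCoeff_injective h)

lemma toSeq_apply (f : H s) (k : Fin 3 → ℤ) : toSeq s f k = wt k ^ (s / 2) • coeff k f := rfl

lemma coeff_incl {a b : ℝ} (h : b ≤ a) (f : H a) (k : Fin 3 → ℤ) :
    coeff k (incl h f) = coeff k f := by
  rw [coeff_def, field_incl]; rfl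

/-- The real inner product is pulled back along `toSeq`, so it is compatible with the existing norm
and makes the Hilbert space methods available. -/
instance : InnerProductSpace ℝ (H s) where
  inner f g := inner ℝ (toSeq s f) (toSeq s g)
  norm_sq_eq_re_inner f := by
    rw [norm_eq]; exact norm_sq_eq_re_inner (𝕜 := ℝ) (toSeq s f)
  conj_inner_symm f g := inner_conj_symm (𝕜 := ℝ) (toSeq s f) (toSeq s g)
  add_left f g h := by
    rw [map_add]; exact inner_add_left _ _ _
  smul_left f g c := by
    rw [map_smul]; exact inner_smul_left _ _ _

lemma hasSum_inner (f g : H s) :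
    HasSum (fun k => wt k ^ s * inner ℝ (coeff k f) (coeff k g)) (inner ℝ f g) := by
  have h := lp.hasSum_inner (𝕜 := ℝ) (toSeq s f) (toSeq s g)
  refine h.congr_fun ?_
  intro k
  rw [toSeq_apply, toSeq_apply, inner_smul_left, inner_smul_right, ← mul_assoc, conj_trivial,
    ← pow_two, wt_rpow_half_sq]

lemma hasSum_norm_sq (f : H s) : HasSum (fun k => wt k ^ s * ‖coeff k f‖ ^ 2) (‖f‖ ^ 2) := by
  have h := hasSum_inner f f
  simpa only [real_inner_self_eq_norm_sq] using h

/-- The `k`-th Fourier coefficient as a continuous linear map. -/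
def coeffL (s : ℝ) (k : Fin 3 → ℤ) : H s →L[ℝ] CVec :=
  ⟨coeff k, continuous_vecCoeff k⟩

lemma coeffL_apply (f : H s) (k : Fin 3 → ℤ) : coeffL s k f = coeff k f := rfl

lemma memℓp_weighted_iff {c : (Fin 3 → ℤ) → CVec} :
    Memℓp (fun k => wt k ^ (s / 2) • c k) 2 ↔ Summable fun k => wt k ^ s * ‖c k‖ ^ 2 := by
  rw [memℓp_gen_iff (by norm_num)]
  refine summable_congr fun k => ?_
  rw [norm_smul, Real.norm_of_nonneg (wt_rpow_pos k _).le, ENNReal.toReal_ofNat, Real.rpow_two,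
    mul_pow, wt_rpow_half_sq]

/-- A conjugation symmetric family with finite `H^s` norm is the family of Fourier coefficients of
a field of class `H^s`. -/
theorem exists_coeff_eq (hs : 0 ≤ s) (c : (Fin 3 → ℤ) → CVec)
    (hc : Summable fun k => wt k ^ s * ‖c k‖ ^ 2) (hconj : ∀ k, c (-k) = conjVec (c k)) :
    ∃ f : H s, ∀ k, coeff k f = c k := by
  have h1 : ∀ i, ∃ f : L2Fun, ∀ k, fourierCoeff f k = c k i := by
    intro i
    refine exists_fourierCoeff_eq _ ?_ fun k => by rw [hconj]; rfl
    refine memℓp_gen ?_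
    refine hc.of_nonneg_of_le (fun _ => by positivity) fun k => ?_
    rw [ENNReal.toReal_ofNat, Real.rpow_two]
    refine (pow_le_pow_left₀ (norm_nonneg _) (PiLp.norm_apply_le (c k) i) 2).trans ?_
    exact le_mul_of_one_le_left (sq_nonneg _) (Real.one_le_rpow (one_le_wt k) hs)
  choose f hf using h1
  have hv : ∀ k, vecCoeff f k = c k := fun k => by ext i; exact hf i k
  have hw : weighted s f = fun k => wt k ^ (s / 2) • c k := by
    funext k; rw [weighted, hv]; rfl
  refine ⟨mk f (by change Memℓp (weighted s f) 2; rw [hw]; exact memℓp_weighted_iff.mpr hc), ?_⟩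
  intro k
  rw [coeff_def, field_mk, hv]

end H

/-! ### Fourier multipliers -/

/-- A symbol of order `r` commuting with conjugation. -/
structure IsSymbol (r : ℝ) (σ : (Fin 3 → ℤ) → CVec →ₗ[ℝ] CVec) : Prop where
  bound : ∃ C, ∀ k c, ‖σ k c‖ ≤ C * (wt k ^ (r / 2) * ‖c‖)
  map_conj : ∀ k c, σ (-k) (conjVec c) = conjVec (σ k c)

/-- The order `a - b` is exactly what turns the weight of `H^b` on the image into that of `H^a` on
the argument. Compatibility with conjugation keeps the image a real field. -/
theorem exists_multiplier {a b : ℝ} (hb : 0 ≤ b) {σ : (Fin 3 → ℤ) → CVec →ₗ[ℝ] CVec}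
    (h : IsSymbol (a - b) σ) :
    ∃ T : H a →L[ℝ] H b, ∀ f k, H.coeff k (T f) = σ k (H.coeff k f) := by
  obtain ⟨C, hC⟩ := h.bound
  have hle : ∀ (f : H a) k, wt k ^ b * ‖σ k (H.coeff k f)‖ ^ 2 ≤
      C ^ 2 * (wt k ^ a * ‖H.coeff k f‖ ^ 2) := by
    intro f k
    calc wt k ^ b * ‖σ k (H.coeff k f)‖ ^ 2
        ≤ wt k ^ b * (C * (wt k ^ ((a - b) / 2) * ‖H.coeff k f‖)) ^ 2 := by
          gcongr
          · exact (wt_rpow_pos k b).le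
          · exact hC _ _
      _ = C ^ 2 * ((wt k ^ b * wt k ^ (a - b)) * ‖H.coeff k f‖ ^ 2) := by
          rw [mul_pow, mul_pow, wt_rpow_half_sq]; ring
      _ = _ := by rw [← Real.rpow_add (wt_pos k)]; ring_nf
  have hex : ∀ f : H a, ∃ g : H b, ∀ k, H.coeff k g = σ k (H.coeff k f) := by
    intro f
    refine H.exists_coeff_eq hb _ ?_ fun k => ?_
    · exact ((H.hasSum_norm_sq f).summable.mul_left (C ^ 2)).of_nonneg_of_le
        (fun k => mul_nonneg (wt_rpow_pos k b).le (sq_nonneg _)) (hle f)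
    · rw [← h.map_conj, H.coeff_def, H.coeff_def, vecCoeff_neg]
  choose T hT using hex
  refine ⟨LinearMap.mkContinuous
    { toFun := T
      map_add' := fun f g => H.ext_coeff fun k => by
        rw [map_add, hT, hT, hT, map_add, map_add]
      map_smul' := fun c f => H.ext_coeff fun k => by
        rw [map_smul, hT, hT, map_smul, map_smul, RingHom.id_apply] } |C| fun f => ?_, hT⟩
  refine le_of_sq_le_sq ?_ (by positivity)
  rw [mul_pow, sq_abs]
  refine hasSum_le (fun k => ?_) (H.hasSum_norm_sq (T f))
    ((H.hasSum_norm_sq f).mul_left (C ^ 2))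
  rw [hT]
  exact hle f k

/-- The Fourier multiplier with a given symbol. -/
def multiplier {a b : ℝ} (hb : 0 ≤ b) {σ : (Fin 3 → ℤ) → CVec →ₗ[ℝ] CVec}
    (h : IsSymbol (a - b) σ) : H a →L[ℝ] H b := (exists_multiplier hb h).choose

lemma coeff_multiplier {a b : ℝ} (hb : 0 ≤ b) {σ : (Fin 3 → ℤ) → CVec →ₗ[ℝ] CVec}
    (h : IsSymbol (a - b) σ) (f : H a) (k : Fin 3 → ℤ) :
    H.coeff k (multiplier hb h f) = σ k (H.coeff k f) := (exists_multiplier hb h).choose_spec f k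

/-- The symbol of `1 + |k|²` to the power `r / 2`. -/
def besselSymbol (r : ℝ) (k : Fin 3 → ℤ) : CVec →ₗ[ℝ] CVec := wt k ^ (r / 2) • LinearMap.id

lemma besselSymbol_apply (r : ℝ) (k : Fin 3 → ℤ) (c : CVec) :
    besselSymbol r k c = wt k ^ (r / 2) • c := rfl

lemma isSymbol_bessel (r : ℝ) : IsSymbol r (besselSymbol r) where
  bound := ⟨1, fun k c => by
    rw [besselSymbol_apply, norm_smul, Real.norm_of_nonneg (wt_rpow_pos k _).le, one_mul]⟩
  map_conj k c := by
    ext i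
    simp [besselSymbol_apply, wt_neg, conjVec_apply]

/-- The isomorphism `H^a → H^b` multiplying the Fourier coefficients by
`(1 + |k|²)^((a - b) / 2)`. -/
def bessel {a b : ℝ} (ha : 0 ≤ a) (hb : 0 ≤ b) : H a ≃L[ℝ] H b :=
  ContinuousLinearEquiv.equivOfInverse
    (multiplier hb (isSymbol_bessel (a - b))) (multiplier ha (isSymbol_bessel (b - a)))
    (fun f => H.ext_coeff fun k => by
      rw [coeff_multiplier, coeff_multiplier, besselSymbol_apply, besselSymbol_apply, smul_smul,
        ← Real.rpow_add (wt_pos k)]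
      ring_nf
      simp)
    (fun f => H.ext_coeff fun k => by
      rw [coeff_multiplier, coeff_multiplier, besselSymbol_apply, besselSymbol_apply, smul_smul,
        ← Real.rpow_add (wt_pos k)]
      ring_nf
      simp)

lemma coeff_bessel {a b : ℝ} (ha : 0 ≤ a) (hb : 0 ≤ b) (f : H a) (k : Fin 3 → ℤ) :
    H.coeff k (bessel ha hb f) = wt k ^ ((a - b) / 2) • H.coeff k f :=
  coeff_multiplier hb (isSymbol_bessel (a - b)) f k

/-- `∑ⱼ kⱼ cⱼ`. -/
def freqDot (k : Fin 3 → ℤ) (c : CVec) : ℂ := ∑ j, (k j : ℂ) * c j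

/-- The symbol of the Laplacian. -/
def lapSymbol (k : Fin 3 → ℤ) : CVec →ₗ[ℝ] CVec := (-(4 * Real.pi ^ 2 * freqSq k)) • LinearMap.id

/-- The symbol of `∇ div`. -/
def gradDivSymbol (k : Fin 3 → ℤ) : CVec →ₗ[ℝ] CVec where
  toFun c := WithLp.toLp 2 fun i => -(4 * Real.pi ^ 2) * ((k i : ℂ) * freqDot k c)
  map_add' c d := by
    ext i; simp only [freqDot, PiLp.add_apply, Fin.sum_univ_three]; ring
  map_smul' r c := by
    ext i
    simp only [freqDot, PiLp.smul_apply, Fin.sum_univ_three, RingHom.id_apply, Complex.real_smul]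
    ring

/-- The symbol of the curl. -/
def curlSymbol (k : Fin 3 → ℤ) : CVec →ₗ[ℝ] CVec where
  toFun c := WithLp.toLp 2
    ![2 * Real.pi * Complex.I * ((k 1 : ℂ) * c 2 - (k 2 : ℂ) * c 1),
      2 * Real.pi * Complex.I * ((k 2 : ℂ) * c 0 - (k 0 : ℂ) * c 2),
      2 * Real.pi * Complex.I * ((k 0 : ℂ) * c 1 - (k 1 : ℂ) * c 0)]
  map_add' c d := by
    ext i; fin_cases i <;> simp <;> ring
  map_smul' r c := by
    ext i; fin_cases i <;> simp <;> ring

lemma lapSymbol_apply (k : Fin 3 → ℤ) (c : CVec) :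
    lapSymbol k c = (-(4 * Real.pi ^ 2 * freqSq k)) • c := rfl

lemma freqSq_le_wt (k : Fin 3 → ℤ) : freqSq k ≤ wt k := by rw [wt]; linarith

lemma abs_freq_sq_le (k : Fin 3 → ℤ) (i : Fin 3) : (k i : ℝ) ^ 2 ≤ freqSq k :=
  Finset.single_le_sum (f := fun i => (k i : ℝ) ^ 2) (fun _ _ => sq_nonneg _) (Finset.mem_univ i)

/-- Cauchy-Schwarz through Lagrange's identity: the difference is the sum of the six squares
supplied, for the real and imaginary parts of `k × c`. -/
lemma norm_sq_freqDot_le (k : Fin 3 → ℤ) (c : CVec) :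
    ‖freqDot k c‖ ^ 2 ≤ freqSq k * ‖c‖ ^ 2 := by
  rw [Complex.sq_norm, Complex.normSq_apply, norm_sq_cvec, freqSq, freqDot]
  simp only [Fin.sum_univ_three, Complex.add_re, Complex.add_im, Complex.mul_re, Complex.mul_im,
    Complex.intCast_re, Complex.intCast_im]
  nlinarith [sq_nonneg ((k 0 : ℝ) * (c 1).re - k 1 * (c 0).re),
    sq_nonneg ((k 0 : ℝ) * (c 2).re - k 2 * (c 0).re),
    sq_nonneg ((k 1 : ℝ) * (c 2).re - k 2 * (c 1).re),
    sq_nonneg ((k 0 : ℝ) * (c 1).im - k 1 * (c 0).im),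
    sq_nonneg ((k 0 : ℝ) * (c 2).im - k 2 * (c 0).im),
    sq_nonneg ((k 1 : ℝ) * (c 2).im - k 2 * (c 1).im)]

lemma norm_sq_gradDivSymbol (k : Fin 3 → ℤ) (c : CVec) :
    ‖gradDivSymbol k c‖ ^ 2 = (4 * Real.pi ^ 2) ^ 2 * (freqSq k * ‖freqDot k c‖ ^ 2) := by
  rw [EuclideanSpace.norm_sq_eq]
  have : ∀ i, ‖gradDivSymbol k c i‖ = 4 * Real.pi ^ 2 * (|(k i : ℝ)| * ‖freqDot k c‖) := by
    intro i
    change ‖-(4 * (Real.pi : ℂ) ^ 2) * ((k i : ℂ) * freqDot k c)‖ = _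
    have : (k i : ℂ) = ((k i : ℝ) : ℂ) := by simp
    rw [norm_mul, norm_mul, norm_neg, norm_mul, norm_pow, this, Complex.norm_real,
      Complex.norm_real, Real.norm_eq_abs, Real.norm_eq_abs, abs_of_pos Real.pi_pos]
    simp
  simp only [this, mul_pow, sq_abs, freqSq, Fin.sum_univ_three]
  ring

/-- Lagrange's identity `|k × c|² = |k|²|c|² - |k · c|²`. -/
lemma norm_sq_curlSymbol (k : Fin 3 → ℤ) (c : CVec) :
    ‖curlSymbol k c‖ ^ 2 = 4 * Real.pi ^ 2 * (freqSq k * ‖c‖ ^ 2 - ‖freqDot k c‖ ^ 2) := by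
  rw [Complex.sq_norm, Complex.normSq_apply, norm_sq_cvec, norm_sq_cvec, freqSq, freqDot]
  simp [curlSymbol, Fin.sum_univ_three]
  ring

/-- The factor `i` compensates the antisymmetry of the cross product. Self-adjointness makes the two
coupling terms of the system equal. -/
lemma inner_curlSymbol (k : Fin 3 → ℤ) (c d : CVec) :
    inner ℝ (curlSymbol k c) d = inner ℝ c (curlSymbol k d) := by
  rw [inner_cvec, inner_cvec]
  simp [curlSymbol, Fin.sum_univ_three]
  ring

lemma inner_gradDivSymbol (k : Fin 3 → ℤ) (c : CVec) :
    inner ℝ (gradDivSymbol k c) c = -(4 * Real.pi ^ 2) * ‖freqDot k c‖ ^ 2 := by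
  rw [Complex.sq_norm, Complex.normSq_apply, inner_cvec, freqDot]
  simp [gradDivSymbol, freqDot, Fin.sum_univ_three, pow_two]
  ring

lemma inner_lapSymbol (k : Fin 3 → ℤ) (c : CVec) :
    inner ℝ (lapSymbol k c) c = -(4 * Real.pi ^ 2 * freqSq k) * ‖c‖ ^ 2 := by
  rw [lapSymbol_apply, inner_smul_left, real_inner_self_eq_norm_sq, conj_trivial]

lemma IsSymbol.of_norm_sq_le {σ : (Fin 3 → ℤ) → CVec →ₗ[ℝ] CVec} {C : ℝ} (hC : 0 ≤ C)
    (hb : ∀ k c, ‖σ k c‖ ^ 2 ≤ C ^ 2 * (wt k ^ 2 * ‖c‖ ^ 2))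
    (hc : ∀ k c, σ (-k) (conjVec c) = conjVec (σ k c)) : IsSymbol 2 σ where
  bound := ⟨C, fun k c => by
    have := wt_pos k
    refine le_of_sq_le_sq ?_ (by positivity)
    refine (hb k c).trans_eq ?_
    rw [mul_pow, mul_pow]
    norm_num⟩
  map_conj := hc

lemma isSymbol_lap : IsSymbol 2 lapSymbol := by
  refine .of_norm_sq_le (C := 4 * Real.pi ^ 2) (by positivity) (fun k c => ?_) fun k c => ?_
  · have h0 := freqSq_nonneg k
    rw [lapSymbol_apply, norm_smul, norm_neg, Real.norm_of_nonneg (by positivity), mul_pow, mul_pow,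
      mul_assoc]
    gcongr
    exact freqSq_le_wt k
  · ext i
    simp [lapSymbol_apply, freqSq_neg, conjVec_apply, map_ofNat]

lemma isSymbol_gradDiv : IsSymbol 2 gradDivSymbol := by
  refine .of_norm_sq_le (C := 4 * Real.pi ^ 2) (by positivity) (fun k c => ?_) fun k c => ?_
  · have h0 := freqSq_nonneg k
    rw [norm_sq_gradDivSymbol]
    refine mul_le_mul_of_nonneg_left ?_ (by positivity)
    calc freqSq k * ‖freqDot k c‖ ^ 2 ≤ freqSq k * (freqSq k * ‖c‖ ^ 2) := by
          gcongr; exact norm_sq_freqDot_le k c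
      _ ≤ wt k * (wt k * ‖c‖ ^ 2) := by
          have := wt_pos k
          gcongr <;> exact freqSq_le_wt k
      _ = _ := by ring
  · ext i
    simp [gradDivSymbol, freqDot, conjVec_apply, Fin.sum_univ_three, map_ofNat]
    ring

/-- The curl has order one, but it is recorded with order two because it is only needed as a map
`H^{s+2} → H^s`. -/
lemma isSymbol_curl : IsSymbol 2 curlSymbol := by
  refine .of_norm_sq_le (C := 2 * Real.pi) (by positivity) (fun k c => ?_) fun k c => ?_
  · have h0 := freqSq_nonneg k
    rw [norm_sq_curlSymbol, mul_pow]
    calc 4 * Real.pi ^ 2 * (freqSq k * ‖c‖ ^ 2 - ‖freqDot k c‖ ^ 2)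
        ≤ 4 * Real.pi ^ 2 * (wt k ^ 2 * ‖c‖ ^ 2) := by
          gcongr
          have : freqSq k ≤ wt k ^ 2 := by
            nlinarith [freqSq_le_wt k, one_le_wt k]
          nlinarith [sq_nonneg ‖freqDot k c‖, sq_nonneg ‖c‖]
      _ = _ := by ring
  · ext i
    fin_cases i <;> simp [curlSymbol, conjVec_apply, map_ofNat] <;> ring

/-! ### Differential operators as Fourier multipliers -/

lemma H.memℓp_of_norm_le {a : ℝ} (f : H a) {E : Type*} [NormedAddCommGroup E]
    {c : (Fin 3 → ℤ) → E} (C : ℝ)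
    (h : ∀ k, ‖c k‖ ≤ C * (wt k ^ (a / 2) * ‖H.coeff k f‖)) : Memℓp c 2 := by
  refine memℓp_gen ?_
  refine ((H.hasSum_norm_sq f).summable.mul_left (C ^ 2)).of_nonneg_of_le
    (fun _ => by positivity) fun k => ?_
  rw [ENNReal.toReal_ofNat, Real.rpow_two]
  refine (pow_le_pow_left₀ (norm_nonneg _) (h k) 2).trans_eq ?_
  rw [mul_pow, mul_pow, wt_rpow_half_sq]

lemma abs_freq_le (k : Fin 3 → ℤ) (j : Fin 3) : ‖(k j : ℂ)‖ ≤ wt k ^ (1 / 2 : ℝ) := by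
  refine le_of_sq_le_sq ?_ (wt_rpow_pos k _).le
  rw [wt_rpow_half_sq, Real.rpow_one]
  refine le_trans ?_ ((abs_freq_sq_le k j).trans (freqSq_le_wt k))
  simp

lemma norm_fourierCoeff_le {a : ℝ} (f : H a) (i : Fin 3) (k : Fin 3 → ℤ) :
    ‖fourierCoeff (f.field i) k‖ ≤ ‖H.coeff k f‖ := PiLp.norm_apply_le (H.coeff k f) i

/-- Functions of class `H¹` are weakly differentiable. -/
lemma fourierCoeff_partialD {a : ℝ} (ha : 1 ≤ a) (f : H a) (i j : Fin 3) (k : Fin 3 → ℤ) :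
    fourierCoeff (partialD j (f.field i)) k =
      2 * Real.pi * Complex.I * (k j : ℂ) * fourierCoeff (f.field i) k := by
  refine isWeakPartial_partialD j _ (f.memℓp_of_norm_le 1 fun k => ?_) k
  rw [norm_mul, one_mul]
  refine mul_le_mul ?_ (norm_fourierCoeff_le f i k) (norm_nonneg _) (wt_rpow_pos k _).le
  exact (abs_freq_le k j).trans (Real.rpow_le_rpow_of_exponent_le (one_le_wt k) (by linarith))

lemma norm_freq_mul_freq_le (k : Fin 3 → ℤ) (i j : Fin 3) {a : ℝ} (ha : 2 ≤ a) {x : ℂ} {B : ℝ}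
    (hx : ‖x‖ ≤ B) : ‖(k i : ℂ) * (2 * Real.pi * Complex.I * (k j : ℂ) * x)‖ ≤
      (2 * Real.pi) * (wt k ^ (a / 2) * B) := by
  have h1 := abs_freq_le k i
  have h2 := abs_freq_le k j
  have h3 : wt k ^ (1 / 2 : ℝ) * wt k ^ (1 / 2 : ℝ) ≤ wt k ^ (a / 2) := by
    rw [← Real.rpow_add (wt_pos k)]
    exact Real.rpow_le_rpow_of_exponent_le (one_le_wt k) (by linarith)
  have h0 := (wt_rpow_pos k (1 / 2)).le
  have hB : 0 ≤ B := (norm_nonneg _).trans hx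
  have e : ‖(k i : ℂ) * (2 * Real.pi * Complex.I * (k j : ℂ) * x)‖ =
      2 * Real.pi * ((‖(k i : ℂ)‖ * ‖(k j : ℂ)‖) * ‖x‖) := by
    simp only [norm_mul, Complex.norm_I, Complex.norm_real, Real.norm_of_nonneg Real.pi_pos.le,
      Complex.norm_ofNat]
    ring
  rw [e]
  refine mul_le_mul_of_nonneg_left (mul_le_mul ?_ hx (norm_nonneg _) (wt_rpow_pos k _).le)
    (by positivity)
  exact (mul_le_mul h1 h2 (norm_nonneg _) h0).trans h3

lemma fourierCoeff_partialD_partialD {a : ℝ} (ha : 2 ≤ a) (f : H a) (i j l : Fin 3)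
    (k : Fin 3 → ℤ) :
    fourierCoeff (partialD l (partialD j (f.field i))) k =
      2 * Real.pi * Complex.I * (k l : ℂ) *
        (2 * Real.pi * Complex.I * (k j : ℂ) * fourierCoeff (f.field i) k) := by
  rw [← fourierCoeff_partialD (by linarith)]
  -- The first derivative is only an `L²` function here, so the existence of its derivative is
  -- checked directly on coefficients.
  refine isWeakPartial_partialD l _ (f.memℓp_of_norm_le (2 * Real.pi) fun k => ?_) k
  rw [fourierCoeff_partialD (by linarith)]
  exact norm_freq_mul_freq_le k l j ha (norm_fourierCoeff_le f i k)

lemma fourierCoeff_sub (f g : L2Fun) (k : Fin 3 → ℤ) :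
    fourierCoeff (f - g : L2Fun) k = fourierCoeff f k - fourierCoeff g k := by
  have h2 : f - g = f + (-1 : ℝ) • g := by rw [neg_one_smul, sub_eq_add_neg]
  rw [h2, fourierCoeff_add, fourierCoeff_smul, neg_one_smul, sub_eq_add_neg]

lemma vecCoeff_laplacian {a : ℝ} (ha : 2 ≤ a) (f : H a) (k : Fin 3 → ℤ) :
    vecCoeff (laplacian f.field) k = lapSymbol k (H.coeff k f) := by
  ext i
  change fourierCoeff (laplacian f.field i) k = _
  have hI := Complex.I_sq
  have e : ((freqSq k : ℝ) : ℂ) = (k 0 : ℂ) ^ 2 + (k 1 : ℂ) ^ 2 + (k 2 : ℂ) ^ 2 := by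
    simp [freqSq, Fin.sum_univ_three]
  simp only [laplacian, Fin.sum_univ_three]
  rw [fourierCoeff_add, fourierCoeff_add, fourierCoeff_partialD_partialD ha,
    fourierCoeff_partialD_partialD ha, fourierCoeff_partialD_partialD ha]
  change _ = ((-(4 * Real.pi ^ 2 * freqSq k) : ℝ) : ℂ) * fourierCoeff (f.field i) k
  push_cast
  rw [e]
  linear_combination (4 * Real.pi ^ 2 * ((k 0 : ℂ) ^ 2 + (k 1 : ℂ) ^ 2 + (k 2 : ℂ) ^ 2) *
    fourierCoeff (f.field i) k) * hI

lemma fourierCoeff_divergence {a : ℝ} (ha : 1 ≤ a) (f : H a) (k : Fin 3 → ℤ) :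
    fourierCoeff (divergence f.field) k =
      2 * Real.pi * Complex.I * freqDot k (H.coeff k f) := by
  simp only [divergence, Fin.sum_univ_three, freqDot]
  rw [fourierCoeff_add, fourierCoeff_add, fourierCoeff_partialD ha, fourierCoeff_partialD ha,
    fourierCoeff_partialD ha]
  simp only [H.coeff_def, vecCoeff]
  ring

lemma vecCoeff_grad_divergence {a : ℝ} (ha : 2 ≤ a) (f : H a) (k : Fin 3 → ℤ) :
    vecCoeff (grad (divergence f.field)) k = gradDivSymbol k (H.coeff k f) := by
  ext i
  have hI := Complex.I_sq
  have h : fourierCoeff (partialD i (divergence f.field)) k =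
      2 * Real.pi * Complex.I * (k i : ℂ) * fourierCoeff (divergence f.field) k := by
    refine isWeakPartial_partialD i _ (f.memℓp_of_norm_le (3 * (2 * Real.pi)) fun k => ?_) k
    rw [fourierCoeff_divergence (by linarith)]
    have e : (k i : ℂ) * (2 * Real.pi * Complex.I * freqDot k (H.coeff k f)) =
        ∑ j, (k i : ℂ) * (2 * Real.pi * Complex.I * (k j : ℂ) * H.coeff k f j) := by
      simp only [freqDot, Fin.sum_univ_three]; ring
    rw [e]
    refine (norm_sum_le_of_le _ fun j _ =>
      norm_freq_mul_freq_le k i j ha (norm_fourierCoeff_le f j k)).trans ?_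
    rw [Fin.sum_univ_three]
    exact le_of_eq (by ring)
  refine h.trans ?_
  rw [fourierCoeff_divergence (by linarith)]
  change _ = -(4 * (Real.pi : ℂ) ^ 2) * ((k i : ℂ) * freqDot k (H.coeff k f))
  linear_combination (4 * Real.pi ^ 2 * (k i : ℂ) * freqDot k (H.coeff k f)) * hI

lemma vecCoeff_curl {a : ℝ} (ha : 1 ≤ a) (f : H a) (k : Fin 3 → ℤ) :
    vecCoeff (curl f.field) k = curlSymbol k (H.coeff k f) := by
  ext i
  fin_cases i
  · change fourierCoeff (partialD 1 (f.field 2) - partialD 2 (f.field 1) : L2Fun) k = _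
    rw [fourierCoeff_sub, fourierCoeff_partialD ha, fourierCoeff_partialD ha]
    change _ = 2 * (Real.pi : ℂ) * Complex.I * ((k 1 : ℂ) * fourierCoeff (f.field 2) k -
      (k 2 : ℂ) * fourierCoeff (f.field 1) k)
    ring
  · change fourierCoeff (partialD 2 (f.field 0) - partialD 0 (f.field 2) : L2Fun) k = _
    rw [fourierCoeff_sub, fourierCoeff_partialD ha, fourierCoeff_partialD ha]
    change _ = 2 * (Real.pi : ℂ) * Complex.I * ((k 2 : ℂ) * fourierCoeff (f.field 0) k -
      (k 0 : ℂ) * fourierCoeff (f.field 2) k)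
    ring
  · change fourierCoeff (partialD 0 (f.field 1) - partialD 1 (f.field 0) : L2Fun) k = _
    rw [fourierCoeff_sub, fourierCoeff_partialD ha, fourierCoeff_partialD ha]
    change _ = 2 * (Real.pi : ℂ) * Complex.I * ((k 0 : ℂ) * fourierCoeff (f.field 1) k -
      (k 1 : ℂ) * fourierCoeff (f.field 0) k)
    ring

section Operators

variable {s : ℝ} (hs : 0 ≤ s)

/-- The Laplacian `H^{s+2} → H^s`. -/
def lapL : H (s + 2) →L[ℝ] H s :=
  multiplier hs (by rw [add_sub_cancel_left]; exact isSymbol_lap)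

/-- `∇ div : H^{s+2} → H^s`. -/
def gradDivL : H (s + 2) →L[ℝ] H s :=
  multiplier hs (by rw [add_sub_cancel_left]; exact isSymbol_gradDiv)

/-- The curl as an operator `H^{s+2} → H^s`. -/
def curlL : H (s + 2) →L[ℝ] H s :=
  multiplier hs (by rw [add_sub_cancel_left]; exact isSymbol_curl)

lemma coeff_lapL (f : H (s + 2)) (k : Fin 3 → ℤ) :
    H.coeff k (lapL hs f) = lapSymbol k (H.coeff k f) := coeff_multiplier _ _ _ _

lemma coeff_gradDivL (f : H (s + 2)) (k : Fin 3 → ℤ) :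
    H.coeff k (gradDivL hs f) = gradDivSymbol k (H.coeff k f) := coeff_multiplier _ _ _ _

lemma coeff_curlL (f : H (s + 2)) (k : Fin 3 → ℤ) :
    H.coeff k (curlL hs f) = curlSymbol k (H.coeff k f) := coeff_multiplier _ _ _ _

include hs

/-- Since `f` has two derivatives in `L²`, no `partialD` takes its default value `0`, and the
iterated weak derivatives have the coefficients of the multiplier. -/
lemma field_lapL (f : H (s + 2)) : (lapL hs f).field = laplacian f.field :=
  vecCoeff_injective fun k => by
    rw [vecCoeff_laplacian (by linarith), ← coeff_lapL hs]; rfl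

lemma field_gradDivL (f : H (s + 2)) : (gradDivL hs f).field = grad (divergence f.field) :=
  vecCoeff_injective fun k => by
    rw [vecCoeff_grad_divergence (by linarith), ← coeff_gradDivL hs]; rfl

lemma field_curlL (f : H (s + 2)) : (curlL hs f).field = curl f.field :=
  vecCoeff_injective fun k => by
    rw [vecCoeff_curl (by linarith), ← coeff_curlL hs]; rfl

end Operators

/-! ### Solenoidal fields -/

lemma freqSq_eq_zero_iff {k : Fin 3 → ℤ} : freqSq k = 0 ↔ k = 0 := by
  constructor
  · intro h
    funext i
    have := abs_freq_sq_le k i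
    rw [h] at this
    have h2 : (k i : ℝ) = 0 := by nlinarith [sq_nonneg (k i : ℝ)]
    exact_mod_cast h2
  · rintro rfl; simp [freqSq]

lemma one_le_freqSq {k : Fin 3 → ℤ} (h : k ≠ 0) : 1 ≤ freqSq k := by
  have e : freqSq k = ((∑ i, k i ^ 2 : ℤ) : ℝ) := by simp [freqSq]
  rw [e]
  have h0 : 0 ≤ ∑ i, k i ^ 2 := Finset.sum_nonneg fun _ _ => sq_nonneg _
  have h1 : ∑ i, k i ^ 2 ≠ 0 := by
    intro h2
    apply h
    rw [← freqSq_eq_zero_iff, e, h2]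
    simp
  exact_mod_cast lt_of_le_of_ne h0 h1.symm

/-- For `k ≠ 0` the projector subtracts a multiple of `k` proportional to `k · c`, and some
coordinate of `k` is nonzero. -/
lemma leraySymbol_eq_self_iff (k : Fin 3 → ℤ) (c : CVec) :
    leraySymbol k c = c ↔ freqDot k c = 0 := by
  rw [leraySymbol]
  split_ifs with h
  · simp [h, freqDot]
  · have hne : ((freqSq k : ℝ) : ℂ) ≠ 0 := by
      rw [Ne, Complex.ofReal_eq_zero, freqSq_eq_zero_iff]; exact h
    constructor
    · intro he
      obtain ⟨i, hi⟩ := Function.ne_iff.mp h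
      have h1 := congrFun he i
      have hi' : (k i : ℂ) ≠ 0 := by exact_mod_cast hi
      have h2 : (k i : ℂ) * freqDot k c / (freqSq k : ℂ) = 0 := by
        simpa [freqDot] using h1
      rw [div_eq_zero_iff, mul_eq_zero] at h2
      rcases h2 with (h2 | h2) | h2
      · exact absurd h2 hi'
      · exact h2
      · exact absurd h2 hne
    · intro h0
      funext i
      have h1 : ∑ j, (k j : ℂ) * c j = 0 := h0
      simp [h1]

lemma mem_HsolSub_iff {s : ℝ} {f : H s} :
    f ∈ HsolSub s ↔ H.coeff 0 f = 0 ∧ ∀ k, freqDot k (H.coeff k f) = 0 := by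
  rw [mem_HsolSub]
  refine and_congr Iff.rfl (forall_congr' fun k => ?_)
  exact leraySymbol_eq_self_iff k (H.coeff k f)

lemma freqDot_smul (k : Fin 3 → ℤ) (r : ℝ) (c : CVec) : freqDot k (r • c) = r * freqDot k c := by
  simp only [freqDot, Fin.sum_univ_three, PiLp.smul_apply, Complex.real_smul]
  ring

lemma freqDot_curlSymbol (k : Fin 3 → ℤ) (c : CVec) : freqDot k (curlSymbol k c) = 0 := by
  simp [freqDot, curlSymbol, Fin.sum_univ_three]
  ring

lemma curlSymbol_zero (c : CVec) : curlSymbol 0 c = 0 := by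
  ext i; fin_cases i <;> simp [curlSymbol]

section SolOperators

variable {s : ℝ} (hs : 0 ≤ s)

/-- The Laplacian on mean zero solenoidal fields. -/
def lapSolL : Hsol (s + 2) →L[ℝ] Hsol s :=
  ((lapL hs).comp (HsolSub (s + 2)).subtypeL).codRestrict (HsolSub s) fun f => by
    have hf := mem_HsolSub_iff.mp f.2
    rw [mem_HsolSub_iff]
    simp only [ContinuousLinearMap.comp_apply, Submodule.subtypeL_apply, coeff_lapL,
      lapSymbol_apply, freqDot_smul, hf.1, hf.2]
    simp

/-- The curl, with values in mean zero solenoidal fields. -/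
def curlSolL : H (s + 2) →L[ℝ] Hsol s :=
  (curlL hs).codRestrict (HsolSub s) fun f => by
    rw [mem_HsolSub_iff]
    simp only [coeff_curlL, freqDot_curlSymbol, curlSymbol_zero]
    simp

lemma coe_Hsol_incl {a b : ℝ} (h : b ≤ a) (f : Hsol a) :
    (Hsol.incl h f : H b) = H.incl h (f : H a) := rfl

lemma bessel_mem_HsolSub {a b : ℝ} (ha : 0 ≤ a) (hb : 0 ≤ b) (f : Hsol a) :
    bessel ha hb (f : H a) ∈ HsolSub b := by
  have hf := mem_HsolSub_iff.mp f.2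
  rw [mem_HsolSub_iff]
  simp only [coeff_bessel, freqDot_smul, hf.1, hf.2]
  simp

/-- The restriction of `bessel` to mean zero solenoidal fields. -/
def besselSol {a b : ℝ} (ha : 0 ≤ a) (hb : 0 ≤ b) : Hsol a ≃L[ℝ] Hsol b :=
  ContinuousLinearEquiv.equivOfInverse
    (((bessel ha hb).toContinuousLinearMap.comp (HsolSub a).subtypeL).codRestrict (HsolSub b)
      (bessel_mem_HsolSub ha hb))
    (((bessel hb ha).toContinuousLinearMap.comp (HsolSub b).subtypeL).codRestrict (HsolSub a)
      (bessel_mem_HsolSub hb ha))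
    (fun f => Subtype.ext ((bessel ha hb).symm_apply_apply (f : H a)))
    (fun f => Subtype.ext ((bessel ha hb).apply_symm_apply (f : H b)))

end SolOperators

/-! ### Coercivity -/

/-- An affine function of `y` on `[0, x]` is smallest at an endpoint, with values `a x` and `(a + b)
x`. -/
lemma norm_sq_freqDot_combination {a b x y : ℝ} (hy : 0 ≤ y) (hxy : y ≤ x) :
    min a (a + b) * x ≤ a * x + b * y := by
  rcases le_total 0 b with h | h
  · rw [min_eq_left (by linarith)]; nlinarith
  · rw [min_eq_right (by linarith)]; nlinarith

/-- The quadratic form is `4π² (a |k|²|c|² + b |k · c|²) + d |c|²`, and `|k · c|² ≤ |k|²|c|²`. -/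
lemma elliptic_symbol_lower_bound (a b d : ℝ) (k : Fin 3 → ℤ) (c : CVec) :
    4 * Real.pi ^ 2 * (min a (a + b) * (freqSq k * ‖c‖ ^ 2)) + d * ‖c‖ ^ 2 ≤
      inner ℝ (-(a • lapSymbol k c) - b • gradDivSymbol k c + d • c) c := by
  rw [inner_add_left, inner_sub_left, inner_neg_left, inner_smul_left, inner_smul_left,
    inner_smul_left, inner_lapSymbol, inner_gradDivSymbol, real_inner_self_eq_norm_sq]
  simp only [conj_trivial]
  have h := norm_sq_freqDot_combination (a := a) (b := b) (sq_nonneg ‖freqDot k c‖)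
    (norm_sq_freqDot_le k c)
  have hp : 0 ≤ 4 * Real.pi ^ 2 := by positivity
  nlinarith [mul_le_mul_of_nonneg_left h hp]

/-- No sign is imposed on `b`: transverse modes see `a`, longitudinal ones `a + b`. The damping `d`
supplies the part of the weight `1 + |k|²` that the derivatives miss. -/
lemma exists_elliptic_coercive {a b d : ℝ} (ha : 0 < a) (hab : 0 < a + b) (hd : 0 < d) :
    ∃ c₀, 0 < c₀ ∧ ∀ (k : Fin 3 → ℤ) (c : CVec), c₀ * (wt k * ‖c‖ ^ 2) ≤
      inner ℝ (-(a • lapSymbol k c) - b • gradDivSymbol k c + d • c) c := by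
  have hm : 0 < min a (a + b) := lt_min ha hab
  refine ⟨min (4 * Real.pi ^ 2 * min a (a + b)) d, lt_min (by positivity) hd, fun k c => ?_⟩
  refine le_trans ?_ (elliptic_symbol_lower_bound a b d k c)
  have h1 := min_le_left (4 * Real.pi ^ 2 * min a (a + b)) d
  have h2 := min_le_right (4 * Real.pi ^ 2 * min a (a + b)) d
  have h3 : 0 ≤ freqSq k * ‖c‖ ^ 2 := mul_nonneg (freqSq_nonneg k) (sq_nonneg _)
  have h4 := mul_le_mul_of_nonneg_right h1 h3
  have h5 := mul_le_mul_of_nonneg_right h2 (sq_nonneg ‖c‖)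
  rw [wt]
  linarith

/-- The coupling totals `-2κ⟨curl u, w⟩`, at most `(κ/2)|curl u|² + 2κ|w|²` in size. Since `|curl
u|² ≤ 4π²|k|²|u|²`, this uses up exactly the `κ/2` part of the viscosity and all of the damping,
leaving the forms with coefficients `e` and `min a (a + b)`. These vanish only at `k = 0`, where the
coupling vanishes too, `u = 0` by assumption, and the full damping of `w` is available. -/
lemma exists_coupled_coercive {e κ a b : ℝ} (he : 0 < e) (hκ : 0 < κ) (ha : 0 < a)
    (hab : 0 < a + b) :
    ∃ c₀, 0 < c₀ ∧ ∀ (k : Fin 3 → ℤ) (u w : CVec), (k = 0 → u = 0) →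
      c₀ * (wt k * (‖u‖ ^ 2 + ‖w‖ ^ 2)) ≤
      inner ℝ (-((e + κ / 2) • lapSymbol k u) - κ • curlSymbol k w) u +
      inner ℝ (-(a • lapSymbol k w) - b • gradDivSymbol k w + (2 * κ) • w - κ • curlSymbol k u)
        w := by
  have hm : 0 < min a (a + b) := lt_min ha hab
  set μ := min e (min a (a + b)) with hμ
  have hμ0 : 0 < μ := lt_min he hm
  have hμ1 : μ ≤ e := min_le_left _ _
  have hμ2 : μ ≤ min a (a + b) := min_le_right _ _
  refine ⟨min (2 * Real.pi ^ 2 * μ) (2 * κ), lt_min (by positivity) (by positivity),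
    fun k u w hk => ?_⟩
  have h1 := min_le_left (2 * Real.pi ^ 2 * μ) (2 * κ)
  have h2 := min_le_right (2 * Real.pi ^ 2 * μ) (2 * κ)
  have e1 := elliptic_symbol_lower_bound a b (2 * κ) k w
  have e2 : inner ℝ (-((e + κ / 2) • lapSymbol k u) - κ • curlSymbol k w) u =
      (e + κ / 2) * (4 * Real.pi ^ 2 * (freqSq k * ‖u‖ ^ 2)) - κ * inner ℝ (curlSymbol k u) w := by
    rw [inner_sub_left, inner_neg_left, inner_smul_left, inner_smul_left, inner_lapSymbol,
      inner_curlSymbol, real_inner_comm]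
    simp only [conj_trivial]
    ring
  have e3 : inner ℝ (-(a • lapSymbol k w) - b • gradDivSymbol k w + (2 * κ) • w -
      κ • curlSymbol k u) w = inner ℝ (-(a • lapSymbol k w) - b • gradDivSymbol k w +
        (2 * κ) • w) w - κ * inner ℝ (curlSymbol k u) w := by
    rw [inner_sub_left, inner_smul_left (curlSymbol k u)]
    simp only [conj_trivial]
  have e4 : inner ℝ (curlSymbol k u) w ≤ ‖curlSymbol k u‖ * ‖w‖ := real_inner_le_norm _ _
  have e5 : ‖curlSymbol k u‖ ^ 2 ≤ 4 * Real.pi ^ 2 * (freqSq k * ‖u‖ ^ 2) := by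
    rw [norm_sq_curlSymbol]
    gcongr
    linarith [sq_nonneg ‖freqDot k u‖]
  have e6 : 2 * κ * inner ℝ (curlSymbol k u) w ≤
      κ / 2 * (4 * Real.pi ^ 2 * (freqSq k * ‖u‖ ^ 2)) + 2 * κ * ‖w‖ ^ 2 := by
    calc 2 * κ * inner ℝ (curlSymbol k u) w ≤ 2 * κ * (‖curlSymbol k u‖ * ‖w‖) := by gcongr
      -- The square `(‖curl u‖ - 2‖w‖)²` encodes the split matched to the two available terms.
      _ ≤ κ / 2 * ‖curlSymbol k u‖ ^ 2 + 2 * κ * ‖w‖ ^ 2 := by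
          nlinarith [mul_nonneg hκ.le (sq_nonneg (‖curlSymbol k u‖ - 2 * ‖w‖))]
      _ ≤ _ := by gcongr
  by_cases h0 : k = 0
  · have hu := hk h0
    subst h0
    have hf : freqSq 0 = 0 := freqSq_eq_zero_iff.mpr rfl
    rw [e2, e3, hu, map_zero]
    rw [hf] at e1
    simp only [wt, hf, norm_zero, inner_zero_left]
    nlinarith [sq_nonneg ‖w‖]
  · have hf := one_le_freqSq h0
    -- This factor `2` is why the constant contains `2π²` rather than `4π²`.
    have hw : wt k ≤ 2 * freqSq k := by rw [wt]; linarith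
    have hU : 0 ≤ freqSq k * ‖u‖ ^ 2 := mul_nonneg (freqSq_nonneg k) (sq_nonneg _)
    have hW : 0 ≤ freqSq k * ‖w‖ ^ 2 := mul_nonneg (freqSq_nonneg k) (sq_nonneg _)
    have hp : 0 ≤ 4 * Real.pi ^ 2 := by positivity
    have f1 : min (2 * Real.pi ^ 2 * μ) (2 * κ) * (wt k * (‖u‖ ^ 2 + ‖w‖ ^ 2)) ≤
        2 * Real.pi ^ 2 * μ * (2 * freqSq k * (‖u‖ ^ 2 + ‖w‖ ^ 2)) := by
      have : 0 < wt k := wt_pos k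
      gcongr
    have f2 : μ * (freqSq k * ‖u‖ ^ 2) ≤ e * (freqSq k * ‖u‖ ^ 2) := by gcongr
    have f3 : μ * (freqSq k * ‖w‖ ^ 2) ≤ min a (a + b) * (freqSq k * ‖w‖ ^ 2) := by gcongr
    have f4 := mul_le_mul_of_nonneg_left f2 hp
    have f5 := mul_le_mul_of_nonneg_left f3 hp
    rw [e2, e3]
    linarith

/-! ### Traces at time zero -/

section General

variable {E F : Type} [NormedAddCommGroup E] [NormedSpace ℝ E]
  [NormedAddCommGroup F] [NormedSpace ℝ F]

lemma isWeakTimeDeriv_congr {u u' v : ℝ → F} (h : u =ᵐ[timeMeasure] u')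
    (hu : IsWeakTimeDeriv u v) : IsWeakTimeDeriv u' v := by
  intro ψ h1 h2 h3
  rw [← hu ψ h1 h2 h3]
  refine integral_congr_ae ?_
  filter_upwards [h] with t ht using by rw [ht]

lemma Parabolic.ae_eq_primitive [CompleteSpace F] {ι : E →L[ℝ] F} (u : Parabolic ι) :
    ∃ a, ∀ᵐ t ∂timeMeasure, ι (u.fn t) = a + ∫ r in (0 : ℝ)..t, u.dt r := by
  have h0 : IsWeakTimeDeriv (fun t => ι (u.fn t)) u.dt := u.2
  have hc := ι.coeFn_compLp u.fn
  obtain ⟨a, ha⟩ := (isWeakTimeDeriv_congr (EventuallyEq.symm hc) h0).ae_eq_primitive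
  refine ⟨a, ?_⟩
  filter_upwards [hc, ha] with t h1 h2
  rw [← h2, h1]

lemma isWeakTimeDeriv_of_ae_eq_primitive [CompleteSpace F] {u : ℝ → F} {v : L2Time F} {a : F}
    (h : ∀ᵐ t ∂timeMeasure, u t = a + ∫ r in (0 : ℝ)..t, v r) : IsWeakTimeDeriv u v := by
  intro ψ h1 h2 h3
  have e := integral_deriv_smul_primitive h1 h2 v a
  rw [image_eq_zero_of_notMem_tsupport (fun h0 => lt_irrefl (0 : ℝ) (h3 h0)), zero_smul, neg_zero,
    zero_sub] at e
  rw [← e]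
  refine integral_congr_ae ?_
  filter_upwards [h] with t ht using by rw [ht]

/-- Two representatives continuous on the open half-line and equal almost everywhere are equal
everywhere, hence have the same limit at zero. -/
lemma HasInitialValue.unique {ι : E →L[ℝ] F} {u : ℝ → E} {a b : F} (ha : HasInitialValue ι u a)
    (hb : HasInitialValue ι u b) : a = b := by
  obtain ⟨v, hv, hv1, hv2⟩ := ha
  obtain ⟨w, hw, hw1, hw2⟩ := hb
  have he : EqOn v w (Ioi 0) := by
    refine Measure.eqOn_open_of_ae_eq (μ := volume) ?_ isOpen_Ioi hv hw
    filter_upwards [hv1, hw1] with t h1 h2 using h1.trans h2.symm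
  refine tendsto_nhds_unique hv2 (hw2.congr' ?_)
  filter_upwards [self_mem_nhdsWithin] with t ht using (he ht).symm

end General

/-- Only one half of Parseval in space-time is needed, so finite partial sums suffice and no
infinite sum is exchanged with an integral. -/
lemma tsum_norm_sq_coeff_le {a : ℝ} (u : L2Time (H a)) :
    (Summable fun k => wt k ^ a * ‖(H.coeffL a k).compLp u‖ ^ 2) ∧
      ∑' k, wt k ^ a * ‖(H.coeffL a k).compLp u‖ ^ 2 ≤ ‖u‖ ^ 2 := by
  have hn : ∀ k, 0 ≤ wt k ^ a * ‖(H.coeffL a k).compLp u‖ ^ 2 := fun k =>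
    mul_nonneg (wt_rpow_pos k a).le (sq_nonneg _)
  have hb : ∀ S : Finset (Fin 3 → ℤ),
      ∑ k ∈ S, wt k ^ a * ‖(H.coeffL a k).compLp u‖ ^ 2 ≤ ‖u‖ ^ 2 := by
    intro S
    have e : ∀ k, wt k ^ a * ‖(H.coeffL a k).compLp u‖ ^ 2 =
        ∫ t, wt k ^ a * ‖H.coeff k (u t)‖ ^ 2 ∂timeMeasure := by
      intro k
      rw [norm_sq_L2Time, ← integral_const_mul]
      refine integral_congr_ae ?_
      filter_upwards [(H.coeffL a k).coeFn_compLp u] with t ht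
      rw [ht]; rfl
    have i : ∀ k, Integrable (fun t => wt k ^ a * ‖H.coeff k (u t)‖ ^ 2) timeMeasure := by
      intro k
      refine ((integrable_norm_sq ((H.coeffL a k).compLp u)).const_mul (wt k ^ a)).congr ?_
      filter_upwards [(H.coeffL a k).coeFn_compLp u] with t ht
      rw [ht]; rfl
    simp only [e]
    rw [← integral_finsetSum _ fun k _ => i k, norm_sq_L2Time]
    refine integral_mono (integrable_finsetSum _ fun k _ => i k) (integrable_norm_sq u) fun t => ?_
    exact sum_le_hasSum S (fun k _ => mul_nonneg (wt_rpow_pos k a).le (sq_nonneg _))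
      (H.hasSum_norm_sq (u t))
  exact ⟨summable_of_sum_le hn hb, Real.tsum_le_of_sum_le hn hb⟩

/-- The order `s + 1` is the midpoint between `s` and `s + 2`. At each frequency the uniform bound
contains `(1 + |k|²) ‖uₖ‖‖vₖ‖`, split by `2pq ≤ p² + q²` into the summable contributions of `u` in
`H^{s+2}` and of `∂ₜu` in `H^s`. The resulting majorant is independent of time, which places all
values in `H^r` and gives continuity by dominated convergence. -/
theorem exists_trace {s r : ℝ} (hs : 0 ≤ s) (hr : r = s + 1) (h : r ≤ s + 2) (h' : s ≤ r)
    (u : X s) : ∃ a : H r, HasInitialValue (H.incl h) u.fn a ∧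
      ‖a‖ ^ 2 ≤ 2 * ‖u.fn‖ ^ 2 + ‖u.dt‖ ^ 2 ∧
      ∀ᵐ t ∂timeMeasure, H.incl (le_add_two' s) (u.fn t) =
        H.incl h' a + ∫ x in (0 : ℝ)..t, u.dt x := by
  have := completeSpace_H hs
  obtain ⟨α, hα⟩ := Parabolic.ae_eq_primitive u
  set x : ℝ → H s := fun t => α + ∫ y in (0 : ℝ)..t, u.dt y with hx
  let uk : (Fin 3 → ℤ) → L2Time CVec := fun k => (H.coeffL (s + 2) k).compLp u.fn
  let vk : (Fin 3 → ℤ) → L2Time CVec := fun k => (H.coeffL s k).compLp u.dt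
  have hxk : ∀ k t, 0 ≤ t → H.coeff k (x t) = H.coeff k α + ∫ y in (0 : ℝ)..t, vk k y := by
    intro k t ht
    simp only [hx, map_add]
    congr 1
    rw [← H.coeffL_apply, ← ContinuousLinearMap.intervalIntegral_comp_comm _
      (intervalIntegrable_L2Time u.dt ht)]
    refine intervalIntegral.integral_congr_ae ?_
    have := (ae_restrict_iff' measurableSet_Ioi).mp ((H.coeffL s k).coeFn_compLp u.dt)
    filter_upwards [this] with y hy hy'
    rw [uIoc_of_le ht] at hy'
    exact (hy hy'.1).symm
  -- The majorant used both for membership in `H^r` and for domination.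
  let M : (Fin 3 → ℤ) → ℝ := fun k =>
    2 * (wt k ^ (s + 2) * ‖uk k‖ ^ 2) + wt k ^ s * ‖vk k‖ ^ 2
  obtain ⟨su, tu⟩ := tsum_norm_sq_coeff_le u.fn
  obtain ⟨sv, tv⟩ := tsum_norm_sq_coeff_le u.dt
  have hM : Summable M := (su.mul_left 2).add sv
  have hMle : ∑' k, M k ≤ 2 * ‖u.fn‖ ^ 2 + ‖u.dt‖ ^ 2 := by
    have : ∑' k, M k = 2 * ∑' k, wt k ^ (s + 2) * ‖uk k‖ ^ 2 + ∑' k, wt k ^ s * ‖vk k‖ ^ 2 := by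
      rw [← tsum_mul_left]
      exact (su.mul_left 2).tsum_add sv
    rw [this]
    linarith
  have hbound : ∀ k t, 0 ≤ t → wt k ^ r * ‖H.coeff k (x t)‖ ^ 2 ≤ M k := by
    intro k t ht
    have h1 : ∀ᵐ t ∂timeMeasure, uk k t = H.coeff k α + ∫ y in (0 : ℝ)..t, vk k y := by
      filter_upwards [hα, (H.coeffL (s + 2) k).coeFn_compLp u.fn,
        ae_restrict_mem measurableSet_Ioi] with t k1 k2 k3
      rw [← hxk k t (le_of_lt k3), k2, hx, H.coeffL_apply]
      simp only
      rw [← k1, H.coeff_incl]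
    rw [hxk k t ht]
    have h2 := norm_sq_primitive_le h1 ht
    have w0 := wt_pos k
    calc wt k ^ r * ‖H.coeff k α + ∫ y in (0 : ℝ)..t, vk k y‖ ^ 2
        ≤ wt k ^ r * ∫ y, (‖uk k y‖ ^ 2 + 2 * (‖uk k y‖ * ‖vk k y‖)) ∂timeMeasure := by
          gcongr
      _ = ∫ y, wt k ^ r * (‖uk k y‖ ^ 2 + 2 * (‖uk k y‖ * ‖vk k y‖)) ∂timeMeasure :=
          (integral_const_mul _ _).symm
      _ ≤ ∫ y, (2 * (wt k ^ (s + 2) * ‖uk k y‖ ^ 2) + wt k ^ s * ‖vk k y‖ ^ 2) ∂timeMeasure := by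
          have iu := integrable_norm_sq (uk k)
          have iv := integrable_norm_sq (vk k)
          refine integral_mono
            ((iu.add ((integrable_norm_mul_norm (uk k) (vk k)).const_mul 2)).const_mul _)
            (((iu.const_mul _).const_mul 2).add (iv.const_mul _)) fun y => ?_
          have e1 : wt k ^ r = wt k ^ s * wt k := by
            rw [hr, Real.rpow_add w0, Real.rpow_one]
          have e2 : wt k ^ (s + 2) = wt k ^ s * wt k ^ 2 := by
            rw [Real.rpow_add w0]; norm_num
          have w1 := wt_rpow_pos k s
          have w2 := one_le_wt k
          simp only [e1, e2]
          set p := ‖uk k y‖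
          set q := ‖vk k y‖
          have k1 : wt k * p ^ 2 ≤ wt k ^ 2 * p ^ 2 := by
            gcongr; nlinarith
          -- The interpolation between `H^{s+2}` and `H^s`.
          have k2 : 2 * (wt k * p * q) ≤ wt k ^ 2 * p ^ 2 + q ^ 2 := by
            nlinarith [sq_nonneg (wt k * p - q)]
          have k3 : wt k * (p ^ 2 + 2 * (p * q)) ≤ 2 * (wt k ^ 2 * p ^ 2) + q ^ 2 := by
            linarith
          calc wt k ^ s * wt k * (p ^ 2 + 2 * (p * q))
              = wt k ^ s * (wt k * (p ^ 2 + 2 * (p * q))) := by ring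
            _ ≤ wt k ^ s * (2 * (wt k ^ 2 * p ^ 2) + q ^ 2) := by gcongr
            _ = _ := by ring
      _ = M k := by
          have iu := integrable_norm_sq (uk k)
          have iv := integrable_norm_sq (vk k)
          rw [integral_add ((iu.const_mul _).const_mul 2) (iv.const_mul _), integral_const_mul,
            integral_const_mul, integral_const_mul, ← norm_sq_L2Time, ← norm_sq_L2Time]
  have hex : ∀ t, 0 ≤ t → ∃ f : H r, H.incl h' f = x t := by
    intro t ht
    obtain ⟨f, hf⟩ := H.exists_coeff_eq (s := r) (hs.trans h') (fun k => H.coeff k (x t))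
      (hM.of_nonneg_of_le (fun k => mul_nonneg (wt_rpow_pos k r).le (sq_nonneg _))
        fun k => hbound k t ht) fun k => vecCoeff_neg _ k
    exact ⟨f, H.ext_coeff fun k => by rw [H.coeff_incl, hf]⟩
  choose! v hv using hex
  have hvk : ∀ k t, 0 ≤ t → H.coeff k (v t) = H.coeff k (x t) := fun k t ht => by
    rw [← hv t ht, H.coeff_incl]
  have hcont : ContinuousOn v (Ici 0) := by
    intro t₀ ht₀
    rw [ContinuousWithinAt, tendsto_iff_norm_sub_tendsto_zero]
    have hsq : Tendsto (fun t => ‖v t - v t₀‖ ^ 2) (𝓝[Ici 0] t₀) (𝓝 0) := by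
      have e : ∀ t, ‖v t - v t₀‖ ^ 2 = ∑' k, wt k ^ r * ‖H.coeff k (v t - v t₀)‖ ^ 2 := fun t =>
        (H.hasSum_norm_sq _).tsum_eq.symm
      simp only [e]
      suffices e0 : Tendsto (fun t => ∑' k, wt k ^ r * ‖H.coeff k (v t - v t₀)‖ ^ 2) (𝓝[Ici 0] t₀)
          (𝓝 (∑' _ : Fin 3 → ℤ, (0 : ℝ))) by
        rwa [tsum_zero] at e0
      -- Each coefficient is continuous in time because the primitive is continuous in `H^s`. The
      -- factor `4` comes from `|x - y|² ≤ 2|x|² + 2|y|²`, with both terms bounded by the majorant.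
      refine tendsto_tsum_of_dominated_convergence (bound := fun k => 4 * M k) (hM.mul_left 4)
        (fun k => ?_) ?_
      · have hc : Tendsto (fun t => H.coeff k (x t)) (𝓝[Ici 0] t₀) (𝓝 (H.coeff k (x t₀))) :=
          ((H.coeffL s k).continuous.tendsto _).comp
            (continuousOn_primitive_L2Time u.dt α t₀ ht₀)
        have hz : Tendsto (fun t => wt k ^ r * ‖H.coeff k (x t) - H.coeff k (x t₀)‖ ^ 2)
            (𝓝[Ici 0] t₀) (𝓝 0) := by
          have := ((hc.sub_const (H.coeff k (x t₀))).norm.pow 2).const_mul (wt k ^ r)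
          simpa using this
        refine hz.congr' ?_
        filter_upwards [self_mem_nhdsWithin] with t ht
        rw [map_sub, hvk k t ht, hvk k t₀ ht₀]
      · filter_upwards [self_mem_nhdsWithin] with t ht k
        have w := (wt_rpow_pos k r).le
        rw [Real.norm_of_nonneg (mul_nonneg w (sq_nonneg _)), map_sub, hvk k t ht, hvk k t₀ ht₀]
        have b1 := hbound k t ht
        have b2 := hbound k t₀ ht₀
        have tri := norm_sub_le (H.coeff k (x t)) (H.coeff k (x t₀))
        have tri2 : ‖H.coeff k (x t) - H.coeff k (x t₀)‖ ^ 2 ≤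
            2 * ‖H.coeff k (x t)‖ ^ 2 + 2 * ‖H.coeff k (x t₀)‖ ^ 2 := by
          nlinarith [norm_nonneg (H.coeff k (x t) - H.coeff k (x t₀)),
            sq_nonneg (‖H.coeff k (x t)‖ - ‖H.coeff k (x t₀)‖)]
        have := mul_le_mul_of_nonneg_left tri2 w
        linarith
    have := hsq.sqrt
    simpa using this
  refine ⟨v 0, ⟨v, hcont.mono Ioi_subset_Ici_self, ?_, ?_⟩, ?_, ?_⟩
  · filter_upwards [hα, ae_restrict_mem measurableSet_Ioi] with t k1 k2
    refine H.ext_coeff fun k => ?_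
    rw [hvk k t (le_of_lt k2), H.coeff_incl, hx]
    simp only
    rw [← k1, H.coeff_incl]
  · exact (hcont 0 (by simp)).mono_left (nhdsWithin_mono _ Ioi_subset_Ici_self)
  · rw [← (H.hasSum_norm_sq (v 0)).tsum_eq]
    refine le_trans ?_ hMle
    refine (H.hasSum_norm_sq (v 0)).summable.tsum_le_tsum (fun k => ?_) hM
    rw [hvk k 0 le_rfl]
    exact hbound k 0 le_rfl
  · have : H.incl h' (v 0) = α := by
      rw [hv 0 le_rfl, hx]; simp
    rw [this]
    exact hα

/-- A convergence statement in `H^{s+1}` becomes an identity in `H^s`, the form in which the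
abstract existence and uniqueness results handle initial data. The trace exists, so both sides
merely identify it, and `H^{s+1} ⊆ H^s` is injective. -/
lemma hasInitialValue_iff {s r : ℝ} (hs : 0 ≤ s) (hr : r = s + 1) (h : r ≤ s + 2) (h' : s ≤ r)
    (u : X s) (a : H r) : HasInitialValue (H.incl h) u.fn a ↔
      ∀ᵐ t ∂timeMeasure, H.incl (le_add_two' s) (u.fn t) =
        H.incl h' a + ∫ x in (0 : ℝ)..t, u.dt x := by
  obtain ⟨b, h1, -, h2⟩ := exists_trace hs hr h h' u
  constructor
  · intro ha
    rw [ha.unique h1]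
    exact h2
  · intro ha
    have e : H.incl h' a = H.incl h' b := primitive_const_unique ha h2
    have : a = b := H.ext_coeff fun k => by
      rw [← H.coeff_incl h' a, e, H.coeff_incl]
    rw [this]
    exact h1

/-- A solenoidal element of the parabolic space as an element of the full space. -/
def Xsol.toX {s : ℝ} (hs : 0 ≤ s) (u : Xsol s) : X s :=
  ⟨((HsolSub (s + 2)).subtypeL.compLp u.fn, (HsolSub s).subtypeL.compLp u.dt), by
    have := completeSpace_Hsol hs
    have := completeSpace_H hs
    obtain ⟨a, ha⟩ := Parabolic.ae_eq_primitive u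
    refine isWeakTimeDeriv_of_ae_eq_primitive (a := (a : H s)) ?_
    filter_upwards [ha, (HsolSub (s + 2)).subtypeL.coeFn_compLp u.fn,
      ae_restrict_mem measurableSet_Ioi] with t h1 h2 h3
    rw [h2, Submodule.subtypeL_apply, ← coe_Hsol_incl, h1, Submodule.coe_add]
    congr 1
    rw [← Submodule.subtypeL_apply, ← ContinuousLinearMap.intervalIntegral_comp_comm _
      (intervalIntegrable_L2Time u.dt (le_of_lt h3))]
    refine intervalIntegral.integral_congr_ae ?_
    have := (ae_restrict_iff' measurableSet_Ioi).mp ((HsolSub s).subtypeL.coeFn_compLp u.dt)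
    filter_upwards [this] with y hy hy'
    rw [uIoc_of_le (le_of_lt h3)] at hy'
    exact (hy hy'.1).symm⟩

lemma Xsol.toX_fn {s : ℝ} (hs : 0 ≤ s) (u : Xsol s) :
    ∀ᵐ t ∂timeMeasure, (u.toX hs).fn t = (u.fn t : H (s + 2)) :=
  (HsolSub (s + 2)).subtypeL.coeFn_compLp u.fn

lemma integral_coe_dt {s : ℝ} (hs : 0 ≤ s) (u : Xsol s) {t : ℝ} (ht : 0 ≤ t) :
    ∫ x in (0 : ℝ)..t, (u.toX hs).dt x = ((∫ x in (0 : ℝ)..t, u.dt x : Hsol s) : H s) := by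
  have := completeSpace_Hsol hs
  have := completeSpace_H hs
  rw [← Submodule.subtypeL_apply, ← ContinuousLinearMap.intervalIntegral_comp_comm _
      (intervalIntegrable_L2Time u.dt ht)]
  refine intervalIntegral.integral_congr_ae ?_
  have := (ae_restrict_iff' measurableSet_Ioi).mp ((HsolSub s).subtypeL.coeFn_compLp u.dt)
  filter_upwards [this] with y hy hy'
  rw [uIoc_of_le ht] at hy'
  exact hy hy'.1

lemma norm_compLp_subtypeL_le {E : Type} [NormedAddCommGroup E] [NormedSpace ℝ E]
    (K : Submodule ℝ E) (u : L2Time K) : ‖K.subtypeL.compLp u‖ ≤ ‖u‖ := by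
  refine (K.subtypeL.norm_compLp_le u).trans ?_
  exact mul_le_of_le_one_left (norm_nonneg u) (Submodule.norm_subtypeL_le _)

/-- The trace in the full space is projected orthogonally onto the solenoidal subspace. The
projection fixes the values of `u` at almost every time and does not increase norms, so the
projected representative serves for the solenoidal trace. -/
theorem exists_trace_sol {s r : ℝ} (hs : 0 ≤ s) (hr : r = s + 1) (h : r ≤ s + 2) (h' : s ≤ r)
    (u : Xsol s) : ∃ a : Hsol r, HasInitialValue (Hsol.incl h) u.fn a ∧
      ‖a‖ ^ 2 ≤ 2 * ‖u.fn‖ ^ 2 + ‖u.dt‖ ^ 2 ∧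
      ∀ᵐ t ∂timeMeasure, Hsol.incl (le_add_two' s) (u.fn t) =
        Hsol.incl h' a + ∫ x in (0 : ℝ)..t, u.dt x := by
  have := completeSpace_Hsol (hs.trans h')
  obtain ⟨a, ⟨v, hv1, hv2, hv3⟩, ha2, ha3⟩ := exists_trace hs hr h h' (u.toX hs)
  let π := (HsolSub r).orthogonalProjectionOnto
  have hπ : Continuous π := π.continuous
  have hiv : HasInitialValue (Hsol.incl h) u.fn (π a) := by
    refine ⟨fun t => π (v t), hπ.comp_continuousOn hv1, ?_, (hπ.tendsto a).comp hv3⟩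
    filter_upwards [hv2, u.toX_fn hs] with t h1 h2
    rw [h1, h2, ← coe_Hsol_incl]
    exact Submodule.orthogonalProjectionOnto_mem_subspace_eq_self _
  have hiv' : HasInitialValue (H.incl h) (u.toX hs).fn (π a : H r) := by
    obtain ⟨w, hw1, hw2, hw3⟩ := hiv
    refine ⟨fun t => (w t : H r), continuous_subtype_val.comp_continuousOn hw1, ?_,
      (continuous_subtype_val.tendsto _).comp hw3⟩
    filter_upwards [hw2, u.toX_fn hs] with t h1 h2
    rw [h1, h2, coe_Hsol_incl]
  refine ⟨π a, hiv, ?_, ?_⟩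
  · have h1 : ‖π a‖ ≤ ‖a‖ := (HsolSub r).norm_orthogonalProjectionOnto_apply_le a
    have h2 := norm_compLp_subtypeL_le (HsolSub (s + 2)) u.fn
    have h3 := norm_compLp_subtypeL_le (HsolSub s) u.dt
    calc ‖π a‖ ^ 2 ≤ ‖a‖ ^ 2 := by gcongr
      _ ≤ 2 * ‖(u.toX hs).fn‖ ^ 2 + ‖(u.toX hs).dt‖ ^ 2 := ha2
      _ ≤ 2 * ‖u.fn‖ ^ 2 + ‖u.dt‖ ^ 2 :=
        add_le_add (mul_le_mul_of_nonneg_left (pow_le_pow_left₀ (norm_nonneg _) h2 2) zero_le_two)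
          (pow_le_pow_left₀ (norm_nonneg _) h3 2)
  · filter_upwards [(hasInitialValue_iff hs hr h h' (u.toX hs) (π a : H r)).mp hiv', u.toX_fn hs,
      ae_restrict_mem measurableSet_Ioi] with t h1 h2 h3
    have e : (Hsol.incl (le_add_two' s) (u.fn t) : H s) =
        ((Hsol.incl h' (π a) + ∫ x in (0 : ℝ)..t, u.dt x : Hsol s) : H s) := by
      rw [coe_Hsol_incl, ← h2, h1, integral_coe_dt hs u (le_of_lt h3)]
      rfl
    exact Subtype.ext e

lemma hasInitialValue_sol_iff {s r : ℝ} (hs : 0 ≤ s) (hr : r = s + 1) (h : r ≤ s + 2)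
    (h' : s ≤ r) (u : Xsol s) (a : Hsol r) : HasInitialValue (Hsol.incl h) u.fn a ↔
      ∀ᵐ t ∂timeMeasure, Hsol.incl (le_add_two' s) (u.fn t) =
        Hsol.incl h' a + ∫ x in (0 : ℝ)..t, u.dt x := by
  obtain ⟨b, h1, -, h2⟩ := exists_trace_sol hs hr h h' u
  constructor
  · intro ha
    rw [ha.unique h1]
    exact h2
  · intro ha
    have e : Hsol.incl h' a = Hsol.incl h' b := primitive_const_unique ha h2
    have : a = b := Subtype.ext <| H.ext_coeff fun k => by
      rw [← H.coeff_incl h' (a : H r), ← coe_Hsol_incl, e, coe_Hsol_incl, H.coeff_incl]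
    rw [this]
    exact h1

/-! ### Volterra operators -/

lemma intervalIntegrable_mul_primitive_pow {μ : ℝ → ℝ} {t : ℝ}
    (hμ : IntervalIntegrable μ volume 0 t) (n : ℕ) :
    IntervalIntegrable (fun r => μ r * (∫ x in (0 : ℝ)..r, μ x) ^ n) volume 0 t :=
  hμ.mul_continuousOn ((absolutelyContinuousOnInterval_primitive hμ).continuousOn.pow n)

/-- The density `μ` is only integrable, so the power rule is obtained by induction from the product
rule for primitives rather than from pointwise differentiation. -/
lemma primitive_pow_succ {μ : ℝ → ℝ} (n : ℕ) : ∀ {t : ℝ}, IntervalIntegrable μ volume 0 t →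
    (∫ r in (0 : ℝ)..t, μ r) ^ (n + 1) =
      (n + 1) * ∫ r in (0 : ℝ)..t, μ r * (∫ x in (0 : ℝ)..r, μ x) ^ n := by
  induction n with
  | zero => intro t _; simp
  | succ n ih =>
    intro t hμ
    have i := (intervalIntegrable_mul_primitive_pow hμ n).const_mul ((n : ℝ) + 1)
    -- By the induction hypothesis the second primitive is the power `n + 1`, so this is the product
    -- of the first power with it.
    have h := (bilin_primitive (ContinuousLinearMap.mul ℝ ℝ) hμ i 0 0).2
    simp only [zero_add, ContinuousLinearMap.mul_apply', intervalIntegral.integral_const_mul] at h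
    rw [← ih hμ] at h
    have e : ∫ r in (0 : ℝ)..t, (μ r * (((n : ℝ) + 1) *
          ∫ y in (0 : ℝ)..r, μ y * (∫ x in (0 : ℝ)..y, μ x) ^ n) +
        (∫ y in (0 : ℝ)..r, μ y) * (((n : ℝ) + 1) * (μ r * (∫ x in (0 : ℝ)..r, μ x) ^ n))) =
        ∫ r in (0 : ℝ)..t, ((n : ℝ) + 2) * (μ r * (∫ x in (0 : ℝ)..r, μ x) ^ (n + 1)) := by
      refine intervalIntegral.integral_congr fun r hr => ?_
      rw [← ih (hμ.mono_set (uIcc_subset_uIcc_left hr))]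
      ring
    rw [e, intervalIntegral.integral_const_mul] at h
    simp only [mul_zero, zero_add] at h
    rw [pow_succ', h]
    push_cast
    ring

section Volterra

variable {E : Type} [NormedAddCommGroup E] [NormedSpace ℝ E]

omit [NormedSpace ℝ E] in
lemma intervalIntegrable_norm_sq (f : L2Time E) {t : ℝ} (ht : 0 ≤ t) :
    IntervalIntegrable (fun r => ‖f r‖ ^ 2) volume 0 t := by
  rw [intervalIntegrable_iff_integrableOn_Ioc_of_le ht]
  exact (integrable_norm_sq f).mono_measure (Measure.restrict_mono Ioc_subset_Ioi_self le_rfl)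

-- Passing to the scalar function `‖f‖` avoids any inner product on `E`.
omit [NormedSpace ℝ E] in
lemma norm_sq_eq_integral_norm_sq (f : L2Time E) : ‖f‖ ^ 2 = ∫ t, ‖f t‖ ^ 2 ∂timeMeasure := by
  have h1 : MemLp (fun t => ‖f t‖) 2 timeMeasure := (Lp.memLp f).norm
  have h2 : ‖h1.toLp‖ = ‖f‖ := by
    rw [Lp.norm_toLp, eLpNorm_norm, Lp.norm_def]
  rw [← h2, norm_sq_L2Time]
  refine integral_congr_ae ?_
  filter_upwards [h1.coeFn_toLp] with t ht
  rw [ht, norm_norm]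

/-- `T` is causal with an `L²` Volterra kernel: `‖T f (t)‖² ≤ μ(t) ∫₀ᵗ ‖f‖²`. -/
def IsVolterra (μ : ℝ → ℝ) (T : L2Time E →L[ℝ] L2Time E) : Prop :=
  ∀ f, ∀ᵐ t ∂timeMeasure, ‖T f t‖ ^ 2 ≤ μ t * ∫ r in (0 : ℝ)..t, ‖f r‖ ^ 2

/-- Iterating the causal bound integrates `μ` over ordered times `r₁ < … < rₙ < t`, which produces
the factorial. -/
lemma IsVolterra.integral_pow_le {μ : ℝ → ℝ} (hμ0 : ∀ t, 0 ≤ μ t)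
    (hμ : Integrable μ timeMeasure) {T : L2Time E →L[ℝ] L2Time E} (hT : IsVolterra μ T)
    (f : L2Time E) (n : ℕ) {t : ℝ} (ht : 0 ≤ t) :
    ∫ r in (0 : ℝ)..t, ‖(T ^ n) f r‖ ^ 2 ≤
      (∫ r in (0 : ℝ)..t, μ r) ^ n / n.factorial * ‖f‖ ^ 2 := by
  have hint : ∀ {t}, 0 ≤ t → IntervalIntegrable μ volume 0 t := fun {t} ht => by
    rw [intervalIntegrable_iff_integrableOn_Ioc_of_le ht]
    exact hμ.mono_measure (Measure.restrict_mono Ioc_subset_Ioi_self le_rfl)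
  induction n generalizing t with
  | zero =>
    simp only [pow_zero, Nat.factorial_zero, Nat.cast_one, div_one, one_mul,
      one_apply_eq_self]
    rw [norm_sq_eq_integral_norm_sq, intervalIntegral.integral_of_le ht]
    exact setIntegral_mono_set (integrable_norm_sq f) (.of_forall fun _ => by positivity)
      (.of_forall fun y hy => hy.1)
  | succ n ih =>
    have e1 : ∀ᵐ r, r ∈ Ioi (0 : ℝ) → ‖(T ^ (n + 1)) f r‖ ^ 2 ≤
        μ r * ∫ x in (0 : ℝ)..r, ‖(T ^ n) f x‖ ^ 2 := by
      rw [pow_succ']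
      exact (ae_restrict_iff' measurableSet_Ioi).mp (hT ((T ^ n) f))
    have i := (intervalIntegrable_mul_primitive_pow (hint ht) n).const_mul
      (‖f‖ ^ 2 / (n.factorial : ℝ))
    calc ∫ r in (0 : ℝ)..t, ‖(T ^ (n + 1)) f r‖ ^ 2
        ≤ ∫ r in (0 : ℝ)..t, ‖f‖ ^ 2 / (n.factorial : ℝ) *
            (μ r * (∫ x in (0 : ℝ)..r, μ x) ^ n) := by
          refine intervalIntegral.integral_mono_ae_restrict ht
            (intervalIntegrable_norm_sq _ ht) i ?_
          rw [EventuallyLE, ← Measure.restrict_congr_set Ioc_ae_eq_Icc,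
            ae_restrict_iff' measurableSet_Ioc]
          filter_upwards [e1] with r hr hr'
          refine (hr hr'.1).trans ?_
          calc μ r * ∫ x in (0 : ℝ)..r, ‖(T ^ n) f x‖ ^ 2
              ≤ μ r * ((∫ x in (0 : ℝ)..r, μ x) ^ n / n.factorial * ‖f‖ ^ 2) := by
                gcongr
                · exact hμ0 r
                · exact ih hr'.1.le
            _ = _ := by ring
      _ = ‖f‖ ^ 2 / (n.factorial : ℝ) * ((∫ r in (0 : ℝ)..t, μ r) ^ (n + 1) / (n + 1)) := by
          rw [intervalIntegral.integral_const_mul, primitive_pow_succ n (hint ht)]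
          field_simp
      _ = _ := by
          rw [Nat.factorial_succ]
          push_cast
          field_simp

/-- The factorial beats the powers of `∫ μ`, so some power of `T` has norm below one, whatever the
size of `T`; then `1 - Tⁿ` is invertible, and `1 - T` divides it. -/
theorem IsVolterra.isUnit_one_sub [CompleteSpace E] {μ : ℝ → ℝ} (hμ0 : ∀ t, 0 ≤ μ t)
    (hμ : Integrable μ timeMeasure) {T : L2Time E →L[ℝ] L2Time E} (hT : IsVolterra μ T) :
    IsUnit (1 - T) := by
  set I := ∫ t, μ t ∂timeMeasure with hI
  have hI0 : 0 ≤ I := integral_nonneg hμ0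
  have hbound : ∀ n f, ‖(T ^ n) f‖ ^ 2 ≤ I ^ n / n.factorial * ‖f‖ ^ 2 := by
    intro n f
    rw [norm_sq_eq_integral_norm_sq ((T ^ n) f)]
    have hlim : Tendsto (fun t => ∫ r in (0 : ℝ)..t, ‖(T ^ n) f r‖ ^ 2) atTop
        (𝓝 (∫ t, ‖(T ^ n) f t‖ ^ 2 ∂timeMeasure)) :=
      intervalIntegral_tendsto_integral_Ioi 0 (integrable_norm_sq ((T ^ n) f)) tendsto_id
    refine le_of_tendsto hlim ?_
    filter_upwards [eventually_ge_atTop (0 : ℝ)] with t ht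
    refine (hT.integral_pow_le hμ0 hμ f n ht).trans ?_
    have h1 : ∫ r in (0 : ℝ)..t, μ r ≤ I := by
      rw [intervalIntegral.integral_of_le ht]
      exact setIntegral_mono_set hμ (.of_forall hμ0) (.of_forall fun y hy => hy.1)
    have h2 : 0 ≤ ∫ r in (0 : ℝ)..t, μ r := intervalIntegral.integral_nonneg ht fun r _ => hμ0 r
    gcongr
  -- The bound concerns squared norms, so `1/4` gives norm at most `1/2`.
  obtain ⟨n, hn⟩ := ((FloorSemiring.tendsto_pow_div_factorial_atTop I).eventually
    (gt_mem_nhds (show (0 : ℝ) < 1 / 4 by norm_num))).exists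
  have hnorm : ‖T ^ n‖ < 1 := by
    refine lt_of_le_of_lt (ContinuousLinearMap.opNorm_le_bound _ (M := 1 / 2) (by norm_num)
      fun f => ?_) (by norm_num)
    refine le_of_sq_le_sq ?_ (by positivity)
    refine (hbound n f).trans ?_
    rw [mul_pow]
    gcongr
    linarith
  have hu := isUnit_one_sub_of_norm_lt_one hnorm
  -- The factors `1 - T` and the geometric sum commute, so a unit product makes each of them a unit.
  rw [← mul_neg_geom_sum T n] at hu
  have hcomm : Commute (1 - T) (∑ i ∈ Finset.range n, T ^ i) :=
    Commute.sum_right _ _ _ fun i _ =>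
      ((Commute.one_left T).sub_left (Commute.refl T)).pow_right i
  exact (hcomm.isUnit_mul_iff.mp hu).1

/-- Volterra perturbations of the identity are bijective. -/
theorem IsVolterra.bijective_id_add [CompleteSpace E] {μ : ℝ → ℝ} (hμ0 : ∀ t, 0 ≤ μ t)
    (hμ : Integrable μ timeMeasure) {T : L2Time E →L[ℝ] L2Time E} (hT : IsVolterra μ T) :
    Function.Bijective fun f => f + T f := by
  have hT' : IsVolterra μ (-T) := by
    intro f
    filter_upwards [hT f, Lp.coeFn_neg (T f)] with t h1 h2
    rw [neg_apply, h2, Pi.neg_apply, norm_neg]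
    exact h1
  have h := hT'.isUnit_one_sub hμ0 hμ
  rw [ContinuousLinearMap.isUnit_iff_bijective] at h
  convert h using 1
  funext f
  simp

end Volterra

/-! ### Convolution estimates for Fourier coefficients -/

/-- Comparison with `|n|^(-2p)`, which can fail only at `n = 0`. -/
lemma summable_one_add_sq_rpow {p : ℝ} (hp : 1 / 2 < p) :
    Summable fun n : ℤ => (1 + (n : ℝ) ^ 2) ^ (-p) := by
  refine Summable.of_norm_bounded_eventually
    (Real.summable_abs_int_rpow (b := 2 * p) (by linarith)) ?_
  have h : {n : ℤ | ¬ ‖(1 + (n : ℝ) ^ 2) ^ (-p)‖ ≤ |(n : ℝ)| ^ (-(2 * p))} ⊆ {0} := by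
    intro n hn
    by_contra h0
    apply hn
    have h1 : (0 : ℝ) < |(n : ℝ)| := abs_pos.mpr (Int.cast_ne_zero.mpr h0)
    have h2 : |(n : ℝ)| ^ (-(2 * p)) = ((n : ℝ) ^ 2) ^ (-p) := by
      rw [← sq_abs, ← Real.rpow_natCast, ← Real.rpow_mul h1.le]
      congr 1
      push_cast
      ring
    rw [h2, Real.norm_of_nonneg (by positivity)]
    refine Real.rpow_le_rpow_of_nonpos ?_ (by linarith) (by linarith)
    rw [← sq_abs]; positivity
  exact (Set.finite_singleton (0 : ℤ)).subset h

/-- Since `(1 + |k|²)³ ≥ ∏ᵢ (1 + kᵢ²)`, the sum is dominated by a product of three one-dimensional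
sums of exponent `r/3 > 1/2`. -/
lemma summable_wt_rpow {r : ℝ} (hr : 3 / 2 < r) : Summable fun k => wt k ^ (-r) := by
  have h1 := summable_one_add_sq_rpow (p := r / 3) (by linarith)
  have h0 : ∀ n : ℤ, 0 ≤ (1 + (n : ℝ) ^ 2) ^ (-(r / 3)) := fun n => by positivity
  have h2 := h1.mul_of_nonneg (h1.mul_of_nonneg h1 h0 h0) h0 fun x => mul_nonneg (h0 _) (h0 _)
  have hinj : Function.Injective fun k : Fin 3 → ℤ => (k 0, k 1, k 2) := by
    intro k l h
    simp only [Prod.mk.injEq] at h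
    funext i
    fin_cases i
    exacts [h.1, h.2.1, h.2.2]
  refine (h2.comp_injective hinj).of_nonneg_of_le (fun k => (wt_rpow_pos k _).le) fun k => ?_
  simp only [Function.comp_apply]
  have e : wt k = 1 + ((k 0 : ℝ) ^ 2 + (k 1 : ℝ) ^ 2 + (k 2 : ℝ) ^ 2) := by
    rw [wt, freqSq, Fin.sum_univ_three]
  set x := (k 0 : ℝ) ^ 2 with hx
  set y := (k 1 : ℝ) ^ 2 with hy
  set z := (k 2 : ℝ) ^ 2 with hz
  have px : 0 ≤ x := sq_nonneg _
  have py : 0 ≤ y := sq_nonneg _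
  have pz : 0 ≤ z := sq_nonneg _
  rw [← Real.mul_rpow (by positivity) (by positivity), ← Real.mul_rpow (by positivity)
    (by positivity)]
  have e2 : wt k ^ (-r) = (wt k ^ 3) ^ (-(r / 3)) := by
    rw [← Real.rpow_natCast, ← Real.rpow_mul (wt_pos k).le]
    congr 1
    push_cast
    ring
  rw [e2]
  refine Real.rpow_le_rpow_of_nonpos (by positivity) ?_ (by linarith)
  rw [e]
  have a1 : 1 + x ≤ 1 + (x + y + z) := by linarith
  have a2 : 1 + y ≤ 1 + (x + y + z) := by linarith
  have a3 : 1 + z ≤ 1 + (x + y + z) := by linarith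
  calc (1 + x) * ((1 + y) * (1 + z)) ≤ (1 + (x + y + z)) * ((1 + (x + y + z)) *
        (1 + (x + y + z))) := by gcongr
    _ = _ := by ring

/-- The weight `(1 + |k|²)^r` in the extended nonnegative reals. -/
def ewt (r : ℝ) (k : Fin 3 → ℤ) : ℝ≥0∞ := ENNReal.ofReal (wt k ^ r)

lemma ewt_mul (r r' : ℝ) (k : Fin 3 → ℤ) : ewt r k * ewt r' k = ewt (r + r') k := by
  rw [ewt, ewt, ewt, ← ENNReal.ofReal_mul (wt_rpow_pos k r).le, ← Real.rpow_add (wt_pos k)]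

lemma ewt_zero (k : Fin 3 → ℤ) : ewt 0 k = 1 := by simp [ewt]

lemma ewt_half_sq (r : ℝ) (k : Fin 3 → ℤ) : ewt (r / 2) k ^ 2 = ewt r k := by
  rw [pow_two, ewt_mul]; ring_nf

lemma ewt_mono {r r' : ℝ} (h : r ≤ r') (k : Fin 3 → ℤ) : ewt r k ≤ ewt r' k :=
  ENNReal.ofReal_le_ofReal (Real.rpow_le_rpow_of_exponent_le (one_le_wt k) h)

/-- Comparing with the larger factor avoids subtraction, which is unsuitable for extended
nonnegative numbers; the lost factor `1/2` only affects constants. -/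
lemma ennreal_mul_le_sq_add_sq (a b : ℝ≥0∞) : a * b ≤ a ^ 2 + b ^ 2 := by
  rcases le_total a b with h | h
  · calc a * b ≤ b * b := by gcongr
      _ = b ^ 2 := (pow_two b).symm
      _ ≤ _ := le_add_self
  · calc a * b ≤ a * a := by gcongr
      _ = a ^ 2 := (pow_two a).symm
      _ ≤ _ := le_self_add

lemma ennreal_add_sq_le (a b : ℝ≥0∞) : (a + b) ^ 2 ≤ 3 * (a ^ 2 + b ^ 2) := by
  have h := ennreal_mul_le_sq_add_sq a b
  calc (a + b) ^ 2 = a ^ 2 + b ^ 2 + 2 * (a * b) := by ring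
    _ ≤ a ^ 2 + b ^ 2 + 2 * (a ^ 2 + b ^ 2) := by gcongr
    _ = _ := by ring

lemma ennreal_tsum_mul_tsum {ι κ : Type*} (f : ι → ℝ≥0∞) (g : κ → ℝ≥0∞) :
    (∑' i, f i) * ∑' j, g j = ∑' i, ∑' j, f i * g j := by
  rw [← ENNReal.tsum_mul_right]
  exact tsum_congr fun i => ENNReal.tsum_mul_left.symm

/-- A form of the Cauchy-Schwarz inequality. -/
lemma ennreal_tsum_mul_sq_le {ι : Type*} (x y : ι → ℝ≥0∞) :
    (∑' i, x i * y i) ^ 2 ≤ 2 * ((∑' i, x i ^ 2) * ∑' i, y i ^ 2) := by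
  rw [pow_two, ennreal_tsum_mul_tsum]
  calc ∑' i, ∑' j, x i * y i * (x j * y j)
      ≤ ∑' i, ∑' j, (x i ^ 2 * y j ^ 2 + y i ^ 2 * x j ^ 2) := by
        refine ENNReal.tsum_le_tsum fun i => ENNReal.tsum_le_tsum fun j => ?_
        calc x i * y i * (x j * y j) = (x i * y j) * (y i * x j) := by ring
          _ ≤ (x i * y j) ^ 2 + (y i * x j) ^ 2 := ennreal_mul_le_sq_add_sq _ _
          _ = _ := by ring
    _ = (∑' i, ∑' j, x i ^ 2 * y j ^ 2) + ∑' i, ∑' j, y i ^ 2 * x j ^ 2 := by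
        rw [← ENNReal.tsum_add]
        exact tsum_congr fun i => ENNReal.tsum_add
    _ = _ := by
        rw [← ennreal_tsum_mul_tsum, ← ennreal_tsum_mul_tsum]; ring

/-- A form of Young's inequality `ℓ² * ℓ¹ ⊆ ℓ²`. -/
lemma tsum_conv_sq_le (p r : (Fin 3 → ℤ) → ℝ≥0∞) :
    ∑' k, (∑' l, p (k - l) * r l) ^ 2 ≤ 2 * ((∑' l, r l) ^ 2 * ∑' k, p k ^ 2) := by
  have hshift : ∀ l, ∑' k, p (k - l) ^ 2 = ∑' k, p k ^ 2 := fun l =>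
    (Equiv.subRight l).tsum_eq fun k => p k ^ 2
  calc ∑' k, (∑' l, p (k - l) * r l) ^ 2
      ≤ ∑' k, ∑' l, ∑' m, (r l * r m) * (p (k - l) ^ 2 + p (k - m) ^ 2) := by
        refine ENNReal.tsum_le_tsum fun k => ?_
        rw [pow_two, ennreal_tsum_mul_tsum]
        refine ENNReal.tsum_le_tsum fun l => ENNReal.tsum_le_tsum fun m => ?_
        calc p (k - l) * r l * (p (k - m) * r m) = (r l * r m) * (p (k - l) * p (k - m)) := by ring
          _ ≤ _ := by gcongr; exact ennreal_mul_le_sq_add_sq _ _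
    _ = ∑' l, ∑' m, (r l * r m) * (2 * ∑' k, p k ^ 2) := by
        rw [ENNReal.tsum_comm]
        refine tsum_congr fun l => ?_
        rw [ENNReal.tsum_comm]
        refine tsum_congr fun m => ?_
        rw [ENNReal.tsum_mul_left, ENNReal.tsum_add, hshift, hshift, two_mul]
    _ = _ := by
        simp only [ENNReal.tsum_mul_right, ENNReal.tsum_mul_left]
        ring

lemma tsum_conv_comm (p r : (Fin 3 → ℤ) → ℝ≥0∞) (k : Fin 3 → ℤ) :
    ∑' l, p (k - l) * r l = ∑' l, r (k - l) * p l := by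
  rw [← (Equiv.subLeft k).tsum_eq]
  refine tsum_congr fun l => ?_
  simp [mul_comm]

/-- Cauchy-Schwarz against the summable weight `(1 + |k|²)^(-r)`: above the Sobolev threshold `3/2`
the coefficients are absolutely summable. -/
lemma tsum_sq_le_weighted {r : ℝ} (hr : 3 / 2 < r) : ∃ C : ℝ≥0∞, C ≠ ∞ ∧
    ∀ b : (Fin 3 → ℤ) → ℝ≥0∞, (∑' k, b k) ^ 2 ≤ C * ∑' k, ewt r k * b k ^ 2 := by
  refine ⟨2 * ∑' k, ewt (-r) k, ?_, fun b => ?_⟩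
  · refine ENNReal.mul_ne_top (by norm_num) ?_
    exact (summable_wt_rpow hr).tsum_ofReal_ne_top
  · have h := ennreal_tsum_mul_sq_le (fun k => ewt (-r / 2) k) fun k => ewt (r / 2) k * b k
    have e : ∀ k, ewt (-r / 2) k * (ewt (r / 2) k * b k) = b k := by
      intro k
      rw [← mul_assoc, ewt_mul]
      have : -r / 2 + r / 2 = 0 := by ring
      rw [this, ewt_zero, one_mul]
    simp only [e, mul_pow, ewt_half_sq] at h
    rw [mul_assoc]
    exact h

lemma freqSq_add_le (a b : Fin 3 → ℤ) : freqSq (a + b) ≤ 2 * freqSq a + 2 * freqSq b := by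
  simp only [freqSq, Fin.sum_univ_three, Pi.add_apply, Int.cast_add]
  nlinarith [sq_nonneg ((a 0 : ℝ) - b 0), sq_nonneg ((a 1 : ℝ) - b 1),
    sq_nonneg ((a 2 : ℝ) - b 2)]

/-- Peetre's inequality. -/
lemma wt_le_mul (k l : Fin 3 → ℤ) : wt k ≤ 2 * (wt (k - l) * wt l) := by
  have h := freqSq_add_le (k - l) l
  rw [sub_add_cancel] at h
  simp only [wt]
  nlinarith [freqSq_nonneg (k - l), freqSq_nonneg l,
    mul_nonneg (freqSq_nonneg (k - l)) (freqSq_nonneg l)]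

lemma wt_le_add (k l : Fin 3 → ℤ) : wt k ≤ 2 * wt (k - l) + 2 * wt l := by
  have h := freqSq_add_le (k - l) l
  rw [sub_add_cancel] at h
  simp only [wt]
  linarith

lemma ewt_le_mul {r : ℝ} (hr : 0 ≤ r) (k l : Fin 3 → ℤ) :
    ewt r k ≤ ENNReal.ofReal (2 ^ r) * (ewt r (k - l) * ewt r l) := by
  rw [ewt, ewt, ewt, ← ENNReal.ofReal_mul (wt_rpow_pos _ r).le,
    ← ENNReal.ofReal_mul (by positivity), ← Real.mul_rpow (wt_pos _).le (wt_pos _).le, ← Real.mul_rpow (by norm_num)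
      (mul_pos (wt_pos _) (wt_pos _)).le]
  exact ENNReal.ofReal_le_ofReal (Real.rpow_le_rpow (wt_pos k).le (wt_le_mul k l) hr)

/-- The weight at `k` is carried by the larger of the two frequencies. When that is `l`, an
additional factor `(wt l / wt (k - l))^(1/2) ≥ 1` is inserted. It moves one derivative from the
first factor of a product to the second. -/
lemma ewt_le_add {r : ℝ} (hr : 0 ≤ r) (k l : Fin 3 → ℤ) :
    ewt r k ≤ ENNReal.ofReal (4 ^ r) *
      (ewt r (k - l) + ewt (-(1 / 2)) (k - l) * ewt (r + 1 / 2) l) := by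
  have w := wt_pos (k - l)
  have w' := wt_pos l
  have e : ENNReal.ofReal (4 ^ r) * (ewt r (k - l) + ewt (-(1 / 2)) (k - l) * ewt (r + 1 / 2) l) =
      ENNReal.ofReal (4 ^ r * (wt (k - l) ^ r + wt (k - l) ^ (-(1 / 2) : ℝ) *
        wt l ^ (r + 1 / 2))) := by
    rw [ewt, ewt, ewt, ← ENNReal.ofReal_mul (by positivity), ← ENNReal.ofReal_add (by positivity)
      (by positivity), ← ENNReal.ofReal_mul (by positivity)]
  rw [e]
  refine ENNReal.ofReal_le_ofReal ?_
  have hadd := wt_le_add k l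
  rcases le_total (wt l) (wt (k - l)) with h | h
  · calc wt k ^ r ≤ (4 * wt (k - l)) ^ r := Real.rpow_le_rpow (wt_pos k).le (by linarith) hr
      _ = 4 ^ r * wt (k - l) ^ r := Real.mul_rpow (by norm_num) w.le
      _ ≤ _ := by
          gcongr
          exact le_add_of_nonneg_right (by positivity)
  · calc wt k ^ r ≤ (4 * wt l) ^ r := Real.rpow_le_rpow (wt_pos k).le (by linarith) hr
      _ = 4 ^ r * wt l ^ r := Real.mul_rpow (by norm_num) w'.le
      _ ≤ 4 ^ r * (wt (k - l) ^ (-(1 / 2) : ℝ) * wt l ^ (r + 1 / 2)) := by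
          gcongr
          rw [Real.rpow_add w', mul_left_comm]
          refine le_mul_of_one_le_right (by positivity) ?_
          rw [Real.rpow_neg w.le, ← div_eq_inv_mul, one_le_div (by positivity)]
          exact Real.rpow_le_rpow w.le h (by norm_num)
      _ ≤ _ := by
          gcongr
          exact le_add_of_nonneg_left (by positivity)

/-- The product estimate `H^s · H^q ⊆ H^s` in terms of Fourier coefficients. -/
theorem exists_conv_bound {s q : ℝ} (hs : 0 ≤ s) (hq : 5 / 2 < q) (hsq : s + 1 ≤ q) :
    ∃ C : ℝ≥0∞, C ≠ ∞ ∧ ∀ a b : (Fin 3 → ℤ) → ℝ≥0∞,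
      ∑' k, ewt s k * (∑' l, a (k - l) * b l) ^ 2 ≤
        C * ((∑' k, ewt s k * a k ^ 2) * ∑' k, ewt q k * b k ^ 2) := by
  have hsq2 : ∀ (a : (Fin 3 → ℤ) → ℝ≥0∞) (r : ℝ),
      ∑' k, (ewt (r / 2) k * a k) ^ 2 = ∑' k, ewt r k * a k ^ 2 := fun a r =>
    tsum_congr fun k => by rw [mul_pow, ewt_half_sq]
  -- For small `s` Peetre's inequality weights both factors by `s/2`, and the second is then
  -- absolutely summable because `q - s ≥ 2 > 3/2`.
  rcases le_or_gt s (1 / 2) with h | h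
  · obtain ⟨C, hC, hb⟩ := tsum_sq_le_weighted (r := q - s) (by linarith)
    refine ⟨ENNReal.ofReal (2 ^ (s / 2)) ^ 2 * (2 * C), by finiteness, fun a b => ?_⟩
    have h1 : ∀ k, ewt s k * (∑' l, a (k - l) * b l) ^ 2 ≤ ENNReal.ofReal (2 ^ (s / 2)) ^ 2 *
        (∑' l, (ewt (s / 2) (k - l) * a (k - l)) * (ewt (s / 2) l * b l)) ^ 2 := by
      intro k
      rw [← ewt_half_sq, ← mul_pow, ← mul_pow, ← ENNReal.tsum_mul_left, ← ENNReal.tsum_mul_left]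
      refine pow_le_pow_left₀ zero_le (ENNReal.tsum_le_tsum fun l => ?_) 2
      calc ewt (s / 2) k * (a (k - l) * b l)
          ≤ (ENNReal.ofReal (2 ^ (s / 2)) * (ewt (s / 2) (k - l) * ewt (s / 2) l)) *
            (a (k - l) * b l) := by gcongr; exact ewt_le_mul (by linarith) k l
        _ = _ := by ring
    have h2 := hb fun l => ewt (s / 2) l * b l
    have h3 : ∑' k, ewt (q - s) k * (ewt (s / 2) k * b k) ^ 2 = ∑' k, ewt q k * b k ^ 2 := by
      refine tsum_congr fun k => ?_
      rw [mul_pow, ewt_half_sq, ← mul_assoc, ewt_mul, sub_add_cancel]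
    rw [h3] at h2
    calc _ ≤ ∑' k, ENNReal.ofReal (2 ^ (s / 2)) ^ 2 *
        (∑' l, (ewt (s / 2) (k - l) * a (k - l)) * (ewt (s / 2) l * b l)) ^ 2 :=
          ENNReal.tsum_le_tsum h1
      _ = ENNReal.ofReal (2 ^ (s / 2)) ^ 2 * ∑' k,
        (∑' l, (ewt (s / 2) (k - l) * a (k - l)) * (ewt (s / 2) l * b l)) ^ 2 :=
          ENNReal.tsum_mul_left
      _ ≤ ENNReal.ofReal (2 ^ (s / 2)) ^ 2 * (2 * ((∑' l, ewt (s / 2) l * b l) ^ 2 *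
          ∑' k, (ewt (s / 2) k * a k) ^ 2)) := by
          gcongr
          exact tsum_conv_sq_le (fun k => ewt (s / 2) k * a k) fun l => ewt (s / 2) l * b l
      _ ≤ ENNReal.ofReal (2 ^ (s / 2)) ^ 2 * (2 * ((C * ∑' k, ewt q k * b k ^ 2) *
          ∑' k, ewt s k * a k ^ 2)) := by
          rw [hsq2]; gcongr
      _ = _ := by ring
  -- For `s > 1/2` the additive splitting is used. In its first part `b` is absolutely summable,
  -- since `q > 3/2`. In its second part `(1 + |k|²)^(-1/2) a` is absolutely summable, since `s + 1
  -- > 3/2`, and `b` carries `s + 1 ≤ q` derivatives.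
  · obtain ⟨C₁, hC₁, hb₁⟩ := tsum_sq_le_weighted (r := q) (by linarith)
    obtain ⟨C₂, hC₂, hb₂⟩ := tsum_sq_le_weighted (r := s + 1) (by linarith)
    set D := ENNReal.ofReal (4 ^ (s / 2)) with hD
    refine ⟨D ^ 2 * (3 * (2 * C₁ + 2 * C₂)), by finiteness, fun a b => ?_⟩
    set α := ∑' k, ewt s k * a k ^ 2 with hα
    set β := ∑' k, ewt q k * b k ^ 2 with hβ
    have h1 : ∀ k, ewt s k * (∑' l, a (k - l) * b l) ^ 2 ≤ D ^ 2 *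
        (3 * ((∑' l, (ewt (s / 2) (k - l) * a (k - l)) * b l) ^ 2 +
          (∑' l, (ewt (-(1 / 2)) (k - l) * a (k - l)) * (ewt ((s + 1) / 2) l * b l)) ^ 2)) := by
      intro k
      refine le_trans ?_ (mul_le_mul_right (ennreal_add_sq_le _ _) (D ^ 2))
      rw [← ewt_half_sq, ← mul_pow, ← mul_pow, ← ENNReal.tsum_mul_left, ← ENNReal.tsum_add,
        ← ENNReal.tsum_mul_left]
      refine pow_le_pow_left₀ zero_le (ENNReal.tsum_le_tsum fun l => ?_) 2
      have e : (s + 1) / 2 = s / 2 + 1 / 2 := by ring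
      rw [e]
      calc ewt (s / 2) k * (a (k - l) * b l)
          ≤ (D * (ewt (s / 2) (k - l) + ewt (-(1 / 2)) (k - l) * ewt (s / 2 + 1 / 2) l)) *
            (a (k - l) * b l) := by gcongr; exact ewt_le_add (by linarith) k l
        _ = _ := by ring
    have h2 : ∑' k, (∑' l, (ewt (s / 2) (k - l) * a (k - l)) * b l) ^ 2 ≤
        2 * ((C₁ * β) * α) := by
      refine (tsum_conv_sq_le (fun k => ewt (s / 2) k * a k) b).trans ?_
      rw [hsq2]
      gcongr
      exact hb₁ b
    have h3 : ∑' k, (∑' l, (ewt (-(1 / 2)) (k - l) * a (k - l)) *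
        (ewt ((s + 1) / 2) l * b l)) ^ 2 ≤ 2 * ((C₂ * α) * β) := by
      -- The roles are exchanged: here the summable factor is the one built from `a`.
      simp only [tsum_conv_comm (fun k => ewt (-(1 / 2)) k * a k)
        fun l => ewt ((s + 1) / 2) l * b l]
      refine (tsum_conv_sq_le (fun l => ewt ((s + 1) / 2) l * b l)
        fun k => ewt (-(1 / 2)) k * a k).trans ?_
      rw [hsq2]
      gcongr
      · refine (hb₂ fun k => ewt (-(1 / 2)) k * a k).trans_eq ?_
        congr 1
        refine tsum_congr fun k => ?_
        have e : (-(1 / 2) : ℝ) = (-1) / 2 := by norm_num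
        rw [e, mul_pow, ewt_half_sq, ← mul_assoc, ewt_mul, add_neg_cancel_right]
      · exact ENNReal.tsum_le_tsum fun k => by gcongr; exact ewt_mono hsq k
    calc _ ≤ ∑' k, D ^ 2 *
        (3 * ((∑' l, (ewt (s / 2) (k - l) * a (k - l)) * b l) ^ 2 +
          (∑' l, (ewt (-(1 / 2)) (k - l) * a (k - l)) * (ewt ((s + 1) / 2) l * b l)) ^ 2)) :=
          ENNReal.tsum_le_tsum h1
      _ = D ^ 2 * (3 * (∑' k, (∑' l, (ewt (s / 2) (k - l) * a (k - l)) * b l) ^ 2 +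
          ∑' k, (∑' l, (ewt (-(1 / 2)) (k - l) * a (k - l)) *
            (ewt ((s + 1) / 2) l * b l)) ^ 2)) := by
          rw [ENNReal.tsum_mul_left, ENNReal.tsum_mul_left, ENNReal.tsum_add]
      _ ≤ D ^ 2 * (3 * (2 * ((C₁ * β) * α) + 2 * ((C₂ * α) * β))) := by gcongr
      _ = _ := by ring

/-! ### Products of functions on the torus -/

lemma mFourierCoeff_complexify (f : L2Fun) (k : Fin 3 → ℤ) :
    UnitAddTorus.mFourierCoeff (complexify f) k = fourierCoeff f k := by
  rw [← mFourierBasis_repr_complexify]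
  exact (UnitAddTorus.mFourierBasis_repr (complexify f) k).symm

/-- Functions with absolutely summable Fourier coefficients are bounded. -/
lemma exists_ae_bound {g : L2Fun} (h : Summable fun l => ‖fourierCoeff g l‖) :
    ∃ B, ∀ᵐ x ∂torusMeasure, ‖g x‖ ≤ B := by
  have h1 : Summable fun l => fourierCoeff g l • UnitAddTorus.mFourier (d := Fin 3) l := by
    refine .of_norm ?_
    simpa only [norm_smul, UnitAddTorus.mFourier_norm, mul_one] using h
  set G : C(T3, ℂ) := ∑' l, fourierCoeff g l • UnitAddTorus.mFourier (d := Fin 3) l with hG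
  have h2 := (ContinuousMap.toLp (E := ℂ) 2 (torusMeasure) ℂ).hasSum h1.hasSum
  have h3 : HasSum (fun l => ContinuousMap.toLp (E := ℂ) 2 torusMeasure ℂ
      (fourierCoeff g l • UnitAddTorus.mFourier (d := Fin 3) l)) (complexify g) := by
    have h4 := UnitAddTorus.hasSum_mFourier_series_L2 (complexify g)
    refine h4.congr_fun fun l => ?_
    rw [map_smul, mFourierCoeff_complexify]
    rfl
  have h5 := h3.unique h2
  refine ⟨‖G‖, ?_⟩
  filter_upwards [complexify_ae g, ContinuousMap.coeFn_toLp (p := 2) (𝕜 := ℂ) torusMeasure G]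
    with x hx hx2
  rw [← Complex.norm_real, ← hx, h5, hx2]
  exact ContinuousMap.norm_coe_le_norm G x

lemma memLp_mul_of_summable (f : L2Fun) {g : L2Fun} (h : Summable fun l => ‖fourierCoeff g l‖) :
    MemLp (fun x => f x * g x) 2 torusMeasure := by
  obtain ⟨B, hB⟩ := exists_ae_bound h
  refine MemLp.of_le_mul (c := B) (Lp.memLp f)
    ((Lp.aestronglyMeasurable f).mul (Lp.aestronglyMeasurable g)) ?_
  filter_upwards [hB] with x hx
  rw [norm_mul, mul_comm]
  gcongr

/-- The Fourier coefficients of a product are given by convolution. -/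
lemma hasSum_fourierCoeff_mul (f g : L2Fun) (k : Fin 3 → ℤ) :
    HasSum (fun l => fourierCoeff f (k - l) * fourierCoeff g l)
      (fourierCoeff (fun x => f x * g x) k) := by
  have hm : MemLp (fun x => UnitAddTorus.mFourier k x * (f x : ℂ)) 2 torusMeasure := by
    refine MemLp.of_le (Lp.memLp f) ?_ (.of_forall fun x => ?_)
    · exact (UnitAddTorus.mFourier k).continuous.aestronglyMeasurable.mul
        (Complex.continuous_ofReal.comp_aestronglyMeasurable (Lp.aestronglyMeasurable f))
    · rw [norm_mul, Complex.norm_real]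
      refine mul_le_of_le_one_left (norm_nonneg _) ?_
      exact (ContinuousMap.norm_coe_le_norm _ x).trans_eq UnitAddTorus.mFourier_norm
  -- Parseval for the pair `exp(2πi k·x) f` and `g`. Since `f` is real, conjugating the first
  -- function gives the integrand of the coefficient at `k`, and the shift by `k` gives the
  -- convolution.
  have h := UnitAddTorus.hasSum_prod_mFourierCoeff (hm.toLp _) (complexify g)
  have e : (∫ t, conj (hm.toLp _ t) * complexify g t ∂torusMeasure) =
      fourierCoeff (fun x => f x * g x) k := by
    refine integral_congr_ae ?_
    filter_upwards [hm.coeFn_toLp, complexify_ae g] with x h1 h2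
    rw [h1, h2, UnitAddTorus.mFourier_neg, map_mul, Complex.conj_ofReal, Complex.ofReal_mul,
      mul_assoc]
  rw [← e]
  refine h.congr_fun fun l => ?_
  rw [mFourierCoeff_complexify]
  congr 1
  rw [← neg_sub, fourierCoeff_neg]
  congr 1
  rw [UnitAddTorus.mFourierCoeff, fourierCoeff]
  refine integral_congr_ae ?_
  filter_upwards [hm.coeFn_toLp] with x h1
  rw [h1, smul_eq_mul, ← mul_assoc, ← UnitAddTorus.mFourier_add]
  congr 3
  abel

/-! ### The advection term -/

lemma tsum_ewt_mul_enorm_sq {s : ℝ} (f : H s) :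
    ∑' k, ewt s k * ‖H.coeff k f‖ₑ ^ 2 = ‖f‖ₑ ^ 2 := by
  have h := H.hasSum_norm_sq f
  rw [← ofReal_norm, ← ENNReal.ofReal_pow (norm_nonneg _), ← h.tsum_eq,
    ENNReal.ofReal_tsum_of_nonneg (fun k => mul_nonneg (wt_rpow_pos k s).le (sq_nonneg _))
      h.summable]
  refine tsum_congr fun k => ?_
  rw [ENNReal.ofReal_mul (wt_rpow_pos k s).le, ENNReal.ofReal_pow (norm_nonneg _),
    ofReal_norm, ewt]

lemma exists_field_eq {s : ℝ} (hs : 0 ≤ s) (f : VField) {B : ℝ≥0∞} (hB : B ≠ ∞)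
    (h : ∑' k, ewt s k * ‖vecCoeff f k‖ₑ ^ 2 ≤ B) :
    ∃ g : H s, g.field = f ∧ ‖g‖ₑ ^ 2 ≤ B := by
  have hsum : Summable fun k => wt k ^ s * ‖vecCoeff f k‖ ^ 2 := by
    have h1 : ∑' k, ENNReal.ofReal (wt k ^ s * ‖vecCoeff f k‖ ^ 2) ≠ ∞ := by
      refine (lt_of_le_of_lt ?_ hB.lt_top).ne
      refine le_trans (le_of_eq (tsum_congr fun k => ?_)) h
      rw [ENNReal.ofReal_mul (wt_rpow_pos k s).le, ENNReal.ofReal_pow (norm_nonneg _),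
        ofReal_norm, ewt]
    refine (ENNReal.summable_toReal h1).congr fun k => ?_
    exact ENNReal.toReal_ofReal (mul_nonneg (wt_rpow_pos k s).le (sq_nonneg _))
  obtain ⟨g, hg⟩ := H.exists_coeff_eq hs (vecCoeff f) hsum (vecCoeff_neg f)
  refine ⟨g, vecCoeff_injective hg, ?_⟩
  rw [← tsum_ewt_mul_enorm_sq]
  simpa only [hg] using h

section Advection

variable {s q : ℝ}

lemma norm_fourierCoeff_partialD_le {a : ℝ} (ha : 1 ≤ a) (z : H a) (i j : Fin 3)
    (l : Fin 3 → ℤ) : ‖fourierCoeff (partialD j (z.field i)) l‖ ≤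
      (2 * Real.pi) * (wt l ^ (1 / 2 : ℝ) * ‖H.coeff l z‖) := by
  rw [fourierCoeff_partialD ha, mul_assoc, norm_mul]
  have e : ‖2 * (Real.pi : ℂ) * Complex.I‖ = 2 * Real.pi := by
    simp [abs_of_pos Real.pi_pos]
  rw [e, norm_mul]
  have h1 := abs_freq_le l j
  have h2 := norm_fourierCoeff_le z i l
  have h3 := Real.pi_pos
  have h4 := wt_rpow_pos l (1 / 2)
  gcongr

/-- The derivatives lie in `H^q` with `q > 3/2`: writing `wt^(1/2) |c|` as the product of
`wt^(-q/2)` and `wt^((q+1)/2) |c|`, both factors are square summable. Hence `∇z` is bounded and the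
pointwise product with an `L²` field is again in `L²`. -/
lemma summable_fourierCoeff_partialD (hq : 5 / 2 < q) (z : H (q - 1 + 2)) (i j : Fin 3) :
    Summable fun l => ‖fourierCoeff (partialD j (z.field i)) l‖ := by
  have h1 := (summable_wt_rpow (r := q) (by linarith)).add (H.hasSum_norm_sq z).summable
  refine (h1.mul_left (2 * Real.pi)).of_nonneg_of_le (fun _ => norm_nonneg _) fun l => ?_
  refine (norm_fourierCoeff_partialD_le (by linarith) z i j l).trans ?_
  have h3 := Real.pi_pos
  gcongr
  have w := wt_pos l
  have e1 : wt l ^ (1 / 2 : ℝ) = wt l ^ (-q / 2) * wt l ^ ((q - 1 + 2) / 2) := by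
    rw [← Real.rpow_add w]; congr 1; ring
  have e2 : wt l ^ (-q) = (wt l ^ (-q / 2)) ^ 2 := (wt_rpow_half_sq l _).symm
  have e3 : wt l ^ (q - 1 + 2) = (wt l ^ ((q - 1 + 2) / 2)) ^ 2 := (wt_rpow_half_sq l _).symm
  rw [e1, e2, e3]
  have p1 := wt_rpow_pos l (-q / 2)
  nlinarith [sq_nonneg (wt l ^ (-q / 2) - wt l ^ ((q - 1 + 2) / 2) * ‖H.coeff l z‖),
    sq_nonneg (wt l ^ (-q / 2)), sq_nonneg (wt l ^ ((q - 1 + 2) / 2) * ‖H.coeff l z‖)]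

lemma memLp_advect (hq : 5 / 2 < q) (u : VField) (z : H (q - 1 + 2)) (i : Fin 3) :
    MemLp (advect u z.field i) 2 torusMeasure :=
  memLp_finsetSum _ fun j _ =>
    memLp_mul_of_summable (u j) (summable_fourierCoeff_partialD hq z i j)

/-- Each of the three products contributes a convolution with factor `2π` from the derivative, so
`6π` in total. -/
lemma enorm_fourierCoeff_advect_le (hq : 5 / 2 < q) (u : H s) (z : H (q - 1 + 2)) (i : Fin 3)
    (k : Fin 3 → ℤ) : ‖fourierCoeff (advect u.field z.field i) k‖ₑ ≤
      ENNReal.ofReal (6 * Real.pi) *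
        ∑' l, ‖H.coeff (k - l) u‖ₑ * (ewt (1 / 2) l * ‖H.coeff l z‖ₑ) := by
  have hint : ∀ j, Integrable (fun x => UnitAddTorus.mFourier (-k) x *
      ((u.field j x * partialD j (z.field i) x : ℝ) : ℂ)) torusMeasure := by
    intro j
    have h1 : Integrable (fun x => u.field j x * partialD j (z.field i) x) torusMeasure :=
      (memLp_mul_of_summable (u.field j) (summable_fourierCoeff_partialD hq z i j)).integrable
        (by norm_num)
    refine h1.ofReal.bdd_mul (c := 1) ?_ (.of_forall fun x => ?_)
    · exact (UnitAddTorus.mFourier (-k)).continuous.aestronglyMeasurable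
    · exact (ContinuousMap.norm_coe_le_norm _ x).trans_eq UnitAddTorus.mFourier_norm
  have e : fourierCoeff (advect u.field z.field i) k =
      ∑ j, fourierCoeff (fun x => u.field j x * partialD j (z.field i) x) k := by
    simp only [fourierCoeff, advect, Complex.ofReal_sum, Finset.mul_sum]
    exact integral_finsetSum _ fun j _ => hint j
  have hj : ∀ j, ‖fourierCoeff (fun x => u.field j x * partialD j (z.field i) x) k‖ₑ ≤
      ENNReal.ofReal (2 * Real.pi) *
        ∑' l, ‖H.coeff (k - l) u‖ₑ * (ewt (1 / 2) l * ‖H.coeff l z‖ₑ) := by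
    intro j
    rw [← (hasSum_fourierCoeff_mul (u.field j) (partialD j (z.field i)) k).tsum_eq,
      ← ENNReal.tsum_mul_left]
    refine enorm_tsum_le_tsum_enorm.trans (ENNReal.tsum_le_tsum fun l => ?_)
    rw [enorm_mul, mul_left_comm]
    gcongr
    · exact enorm_le_iff_norm_le.mpr (norm_fourierCoeff_le u j (k - l))
    · rw [← ofReal_norm, ← ofReal_norm, ewt,
        ← ENNReal.ofReal_mul (wt_rpow_pos l _).le, ← ENNReal.ofReal_mul (by positivity)]
      exact ENNReal.ofReal_le_ofReal (norm_fourierCoeff_partialD_le (by linarith) z i j l)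
  rw [e, Fin.sum_univ_three]
  have e6 : ENNReal.ofReal (6 * Real.pi) = 3 * ENNReal.ofReal (2 * Real.pi) := by
    rw [show (3 : ℝ≥0∞) = ENNReal.ofReal 3 by simp, ← ENNReal.ofReal_mul (by norm_num)]
    congr 1; ring
  refine (enorm_add_le _ _).trans ((add_le_add (enorm_add_le _ _) le_rfl).trans ?_)
  refine (add_le_add (add_le_add (hj 0) (hj 1)) (hj 2)).trans_eq ?_
  rw [e6]; ring

lemma enorm_cvec_le {x : CVec} {B : ℝ≥0∞} (h : ∀ i, ‖x i‖ₑ ≤ B) : ‖x‖ₑ ≤ 2 * B := by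
  rcases eq_or_ne B ∞ with rfl | hB
  · simp
  lift B to NNReal using hB
  have h1 := norm_cvec_le B.2 fun i => by
    have := h i
    rw [← ofReal_norm] at this
    exact (ENNReal.ofReal_le_coe).mp this
  rw [← ofReal_norm, ENNReal.ofReal_le_iff_le_toReal (by finiteness)]
  simpa using h1

/-- The estimate `‖u · ∇z‖_{H^s} ≤ C ‖u‖_{H^s} ‖z‖_{H^{q+1}}`. -/
theorem exists_advect_bound (hs : 0 ≤ s) (hq : 5 / 2 < q) (hsq : s + 1 ≤ q) :
    ∃ C : ℝ, 0 ≤ C ∧ ∀ (u : H s) (z : H (q - 1 + 2)), ∃ h : H s,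
      (∀ i, h.field i =ᵐ[torusMeasure] advect u.field z.field i) ∧ ‖h‖ ≤ C * ‖u‖ * ‖z‖ := by
  obtain ⟨C, hC, hb⟩ := exists_conv_bound hs hq hsq
  set D : ℝ≥0∞ := (2 * ENNReal.ofReal (6 * Real.pi)) ^ 2 * C with hD
  have hDt : D ≠ ∞ := by finiteness
  refine ⟨Real.sqrt D.toReal, Real.sqrt_nonneg _, fun u z => ?_⟩
  let f : VField := fun i => (memLp_advect hq u.field z i).toLp
  have hf : ∀ i, f i =ᵐ[torusMeasure] advect u.field z.field i := fun i =>
    (memLp_advect hq u.field z i).coeFn_toLp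
  have hfc : ∀ i k, fourierCoeff (f i) k = fourierCoeff (advect u.field z.field i) k := by
    intro i k
    refine integral_congr_ae ?_
    filter_upwards [hf i] with x hx
    rw [hx]
  have h1 : ∀ k, ‖vecCoeff f k‖ₑ ≤ 2 * (ENNReal.ofReal (6 * Real.pi) *
      ∑' l, ‖H.coeff (k - l) u‖ₑ * (ewt (1 / 2) l * ‖H.coeff l z‖ₑ)) := fun k =>
    enorm_cvec_le fun i => (congrArg enorm (hfc i k)).trans_le
      (enorm_fourierCoeff_advect_le hq u z i k)
  have h2 : ∑' k, ewt q k * (ewt (1 / 2) k * ‖H.coeff k z‖ₑ) ^ 2 = ‖z‖ₑ ^ 2 := by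
    rw [← tsum_ewt_mul_enorm_sq]
    refine tsum_congr fun k => ?_
    rw [mul_pow, ewt_half_sq, ← mul_assoc, ewt_mul]
    congr 2; ring
  have h3 : ∑' k, ewt s k * ‖vecCoeff f k‖ₑ ^ 2 ≤ D * (‖u‖ₑ ^ 2 * ‖z‖ₑ ^ 2) := by
    calc ∑' k, ewt s k * ‖vecCoeff f k‖ₑ ^ 2
        ≤ ∑' k, (2 * ENNReal.ofReal (6 * Real.pi)) ^ 2 * (ewt s k *
          (∑' l, ‖H.coeff (k - l) u‖ₑ * (ewt (1 / 2) l * ‖H.coeff l z‖ₑ)) ^ 2) := by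
          refine ENNReal.tsum_le_tsum fun k => ?_
          rw [mul_left_comm, ← mul_pow, mul_assoc]
          gcongr
          exact h1 k
      _ = (2 * ENNReal.ofReal (6 * Real.pi)) ^ 2 * ∑' k, (ewt s k *
          (∑' l, ‖H.coeff (k - l) u‖ₑ * (ewt (1 / 2) l * ‖H.coeff l z‖ₑ)) ^ 2) :=
          ENNReal.tsum_mul_left
      _ ≤ (2 * ENNReal.ofReal (6 * Real.pi)) ^ 2 * (C * (‖u‖ₑ ^ 2 * ‖z‖ₑ ^ 2)) := by
          gcongr
          refine (hb (fun k => ‖H.coeff k u‖ₑ)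
            fun l => ewt (1 / 2) l * ‖H.coeff l z‖ₑ).trans_eq ?_
          rw [h2, tsum_ewt_mul_enorm_sq]
      _ = _ := by rw [hD]; ring
  obtain ⟨h, hh, hn⟩ := exists_field_eq hs f (by finiteness) h3
  refine ⟨h, fun i => by rw [hh]; exact hf i, ?_⟩
  refine le_of_sq_le_sq ?_ (by positivity)
  have h4 := ENNReal.toReal_mono (by finiteness) hn
  simp only [ENNReal.toReal_mul, ENNReal.toReal_pow, toReal_enorm] at h4
  rw [mul_pow, mul_pow, Real.sq_sqrt ENNReal.toReal_nonneg, mul_assoc]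
  exact h4

/-- Defined by choice with a default, `partialD` is additive only where the derivatives exist; there
its coefficients determine it. -/
lemma partialD_add {a : ℝ} (ha : 1 ≤ a) (z z' : H a) (i j : Fin 3) :
    partialD j ((z + z').field i) = partialD j (z.field i) + partialD j (z'.field i) := by
  rw [← sub_eq_zero]
  refine eq_zero_of_fourierCoeff _ fun k => ?_
  rw [fourierCoeff_sub, fourierCoeff_add, fourierCoeff_partialD ha, fourierCoeff_partialD ha,
    fourierCoeff_partialD ha, map_add, Pi.add_apply, fourierCoeff_add]
  ring

lemma partialD_smul {a : ℝ} (ha : 1 ≤ a) (c : ℝ) (z : H a) (i j : Fin 3) :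
    partialD j ((c • z).field i) = c • partialD j (z.field i) := by
  rw [← sub_eq_zero]
  refine eq_zero_of_fourierCoeff _ fun k => ?_
  rw [fourierCoeff_sub, fourierCoeff_smul, fourierCoeff_partialD ha, fourierCoeff_partialD ha,
    map_smul, Pi.smul_apply, fourierCoeff_smul, Complex.real_smul, Complex.real_smul]
  ring

lemma ext_field_ae {f g : H s} (h : ∀ i, f.field i =ᵐ[torusMeasure] g.field i) : f = g :=
  H.field_injective (funext fun i => Lp.ext (h i))

lemma field_add_ae (f g : H s) (i : Fin 3) :
    (f + g).field i =ᵐ[torusMeasure] fun x => f.field i x + g.field i x := by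
  rw [map_add]; exact Lp.coeFn_add (f.field i) (g.field i)

lemma field_smul_ae (c : ℝ) (f : H s) (i : Fin 3) :
    (c • f).field i =ᵐ[torusMeasure] fun x => c * f.field i x := by
  rw [map_smul]; exact Lp.coeFn_smul c (f.field i)

/-- The bilinear map `(u, z) ↦ u · ∇z` from `H^s × H^{q+1}` to `H^s`. -/
theorem exists_advectL (hs : 0 ≤ s) (hq : 5 / 2 < q) (hsq : s + 1 ≤ q) :
    ∃ B : H s →L[ℝ] H (q - 1 + 2) →L[ℝ] H s, ∀ u z i,
      (B u z).field i =ᵐ[torusMeasure] advect u.field z.field i := by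
  obtain ⟨C, hC, hb⟩ := exists_advect_bound hs hq hsq
  choose b hb1 hb2 using hb
  have ha : 1 ≤ q - 1 + 2 := by linarith
  refine ⟨LinearMap.mkContinuous₂ (LinearMap.mk₂ ℝ b ?_ ?_ ?_ ?_) C hb2, hb1⟩
  · intro u u' z
    refine ext_field_ae fun i => ?_
    filter_upwards [hb1 (u + u') z i, field_add_ae (b u z) (b u' z) i, hb1 u z i, hb1 u' z i,
      ae_all_iff.mpr fun j => field_add_ae u u' j] with x h1 h2 h3 h4 h5
    rw [h1, h2, h3, h4]
    simp only [advect, h5, add_mul, Finset.sum_add_distrib]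
  · intro c u z
    refine ext_field_ae fun i => ?_
    filter_upwards [hb1 (c • u) z i, field_smul_ae c (b u z) i, hb1 u z i,
      ae_all_iff.mpr fun j => field_smul_ae c u j] with x h1 h2 h3 h5
    rw [h1, h2, h3]
    simp only [advect, h5, mul_assoc, Finset.mul_sum]
  · intro u z z'
    refine ext_field_ae fun i => ?_
    filter_upwards [hb1 u (z + z') i, field_add_ae (b u z) (b u z') i, hb1 u z i, hb1 u z' i,
      ae_all_iff.mpr fun j => Lp.coeFn_add (partialD j (z.field i)) (partialD j (z'.field i))]
      with x h1 h2 h3 h4 h5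
    rw [h1, h2, h3, h4]
    simp only [advect, partialD_add ha, h5, Pi.add_apply, mul_add, Finset.sum_add_distrib]
  · intro c u z
    refine ext_field_ae fun i => ?_
    filter_upwards [hb1 u (c • z) i, field_smul_ae c (b u z) i, hb1 u z i,
      ae_all_iff.mpr fun j => Lp.coeFn_smul c (partialD j (z.field i))] with x h1 h2 h3 h5
    rw [h1, h2, h3]
    simp only [advect, partialD_smul ha, h5, Pi.smul_apply, smul_eq_mul, mul_left_comm _ c,
      Finset.mul_sum]

end Advection

/-! ### The spaces `L²(E) ∩ H¹(F)` -/

section ParabolicSpace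

variable {E F E' F' : Type} [NormedAddCommGroup E] [NormedSpace ℝ E]
  [NormedAddCommGroup F] [NormedSpace ℝ F] [NormedAddCommGroup E'] [NormedSpace ℝ E']
  [NormedAddCommGroup F'] [NormedSpace ℝ F']

/-- For each test function the weak derivative condition equates two continuous functions of the
pair. Completeness, which follows, is what the open mapping theorem needs. -/
lemma isClosed_parabolicSub [CompleteSpace F] (ι : E →L[ℝ] F) :
    IsClosed (ParabolicSub ι : Set (L2Time E × L2Time F)) := by
  let pair (f : L2Time ℝ) : L2Time F →L[ℝ] F :=
    (ContinuousLinearMap.lsmul ℝ ℝ (E := F)).lpPairing timeMeasure 2 2 f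
  have hpair : ∀ (ψ : ℝ → ℝ) (hψ : MemLp ψ 2 timeMeasure) (v : L2Time F) (w : ℝ → F)
      (_ : v =ᵐ[timeMeasure] w), pair hψ.toLp v = ∫ t, ψ t • w t ∂timeMeasure := by
    intro ψ hψ v w hw
    rw [ContinuousLinearMap.lpPairing_eq_integral]
    refine integral_congr_ae ?_
    filter_upwards [hψ.coeFn_toLp, hw] with t h1 h2
    rw [h1, h2, ContinuousLinearMap.lsmul_apply]
  have hmem : ∀ {ψ : ℝ → ℝ}, Continuous ψ → HasCompactSupport ψ → MemLp ψ 2 timeMeasure :=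
    fun h hc => (h.memLp_of_hasCompactSupport hc (μ := volume)).restrict _
  have e : (ParabolicSub ι : Set (L2Time E × L2Time F)) =
      ⋂ (ψ : ℝ → ℝ) (h : ContDiff ℝ (⊤ : ℕ∞) ψ) (hc : HasCompactSupport ψ)
        (_ : tsupport ψ ⊆ Ioi 0),
        {p | pair (hmem (h.continuous_deriv (by simp)) hc.deriv).toLp (ι.compLp p.1) =
          -pair (hmem h.continuous hc).toLp p.2} := by
    ext p
    simp only [mem_iInter, mem_ofPred_eq]
    refine forall_congr' fun ψ => forall_congr' fun h => forall_congr' fun hc =>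
      forall_congr' fun _ => ?_
    rw [hpair _ _ _ _ (ι.coeFn_compLp p.1), hpair _ _ _ _ (EventuallyEq.refl _ _)]
  rw [e]
  refine isClosed_iInter fun ψ => isClosed_iInter fun h => isClosed_iInter fun hc =>
    isClosed_iInter fun _ => ?_
  refine isClosed_eq ?_ ?_
  · exact (ContinuousLinearMap.continuous _).comp
      ((ι.compLpL 2 timeMeasure).continuous.comp continuous_fst)
  · exact ((ContinuousLinearMap.continuous _).comp continuous_snd).neg

lemma completeSpace_parabolic [CompleteSpace E] [CompleteSpace F] (ι : E →L[ℝ] F) :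
    CompleteSpace (Parabolic ι) :=
  (isClosed_parabolicSub ι).completeSpace_coe

/-- The function underlying an element of `L²(E) ∩ H¹(F)`, as a continuous linear map. -/
def fnL (ι : E →L[ℝ] F) : Parabolic ι →L[ℝ] L2Time E :=
  (ContinuousLinearMap.fst ℝ _ _).comp (ParabolicSub ι).subtypeL

/-- The time derivative as a continuous linear map. -/
def dtL (ι : E →L[ℝ] F) : Parabolic ι →L[ℝ] L2Time F :=
  (ContinuousLinearMap.snd ℝ _ _).comp (ParabolicSub ι).subtypeL

lemma Parabolic.norm_fn_le {ι : E →L[ℝ] F} (u : Parabolic ι) : ‖u.fn‖ ≤ ‖u‖ := norm_fst_le u.1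

lemma Parabolic.norm_dt_le {ι : E →L[ℝ] F} (u : Parabolic ι) : ‖u.dt‖ ≤ ‖u‖ := norm_snd_le u.1

lemma Parabolic.ext_ae {ι : E →L[ℝ] F} {u v : Parabolic ι} (h : u.fn =ᵐ[timeMeasure] v.fn)
    (h' : u.dt =ᵐ[timeMeasure] v.dt) : u = v :=
  Subtype.ext (Prod.ext (Lp.ext h) (Lp.ext h'))

/-- Functoriality of `L²(E) ∩ H¹(F)`. -/
def Parabolic.map [CompleteSpace F] [CompleteSpace F'] {ι : E →L[ℝ] F} {ι' : E' →L[ℝ] F'}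
    (S : E →L[ℝ] E') (T : F →L[ℝ] F') (h : ∀ x, ι' (S x) = T (ι x)) (u : Parabolic ι) :
    Parabolic ι' :=
  ⟨(S.compLp u.fn, T.compLp u.dt), by
    obtain ⟨a, ha⟩ := u.ae_eq_primitive
    refine isWeakTimeDeriv_of_ae_eq_primitive (a := T a) ?_
    filter_upwards [ha, S.coeFn_compLp u.fn, ae_restrict_mem measurableSet_Ioi] with t h1 h2 h3
    rw [h2, h, h1, map_add, ← ContinuousLinearMap.intervalIntegral_comp_comm _
      (intervalIntegrable_L2Time u.dt (mem_Ioi.mp h3).le)]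
    congr 1
    refine intervalIntegral.integral_congr_ae ?_
    filter_upwards [(ae_restrict_iff' measurableSet_Ioi).mp (T.coeFn_compLp u.dt)] with y hy hy'
    rw [uIoc_of_le (mem_Ioi.mp h3).le] at hy'
    exact (hy hy'.1).symm⟩

section

variable [CompleteSpace F] [CompleteSpace F'] {ι : E →L[ℝ] F} {ι' : E' →L[ℝ] F'}
  (S : E →L[ℝ] E') (T : F →L[ℝ] F') (h : ∀ x, ι' (S x) = T (ι x)) (u : Parabolic ι)

lemma Parabolic.map_fn : ∀ᵐ t ∂timeMeasure, (u.map S T h).fn t = S (u.fn t) :=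
  S.coeFn_compLp u.fn

lemma Parabolic.map_dt : ∀ᵐ t ∂timeMeasure, (u.map S T h).dt t = T (u.dt t) :=
  T.coeFn_compLp u.dt

lemma Parabolic.map_ae_eq_primitive {a : F}
    (ha : ∀ᵐ t ∂timeMeasure, ι (u.fn t) = a + ∫ r in (0 : ℝ)..t, u.dt r) :
    ∀ᵐ t ∂timeMeasure, ι' ((u.map S T h).fn t) =
      T a + ∫ r in (0 : ℝ)..t, (u.map S T h).dt r := by
  filter_upwards [ha, u.map_fn S T h, ae_restrict_mem measurableSet_Ioi] with t h1 h2 h3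
  rw [h2, h, h1, map_add, ← ContinuousLinearMap.intervalIntegral_comp_comm _
    (intervalIntegrable_L2Time u.dt (mem_Ioi.mp h3).le)]
  congr 1
  refine intervalIntegral.integral_congr_ae ?_
  filter_upwards [(ae_restrict_iff' measurableSet_Ioi).mp (u.map_dt S T h)] with y hy hy'
  rw [uIoc_of_le (mem_Ioi.mp h3).le] at hy'
  exact (hy hy'.1).symm

end

end ParabolicSpace

/-! ### The energy estimate -/

section Energy

variable {V F : Type} [NormedAddCommGroup V] [InnerProductSpace ℝ V]
  [NormedAddCommGroup F] [InnerProductSpace ℝ F] [CompleteSpace F]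
  {ι A : V →L[ℝ] F} {m : F →L[ℝ] F}

/-- The energy estimate for `m u' + A u = h`, `u(0) = 0`. -/
theorem norm_sq_le_of_equation {c₀ c₁ : ℝ} (hc₀ : 0 < c₀) (hc₁ : 0 < c₁)
    (hm : ∀ x y, inner ℝ (m x) y = inner ℝ x (m y)) (hmc : ∀ y, c₀ * ‖y‖ ^ 2 ≤ inner ℝ (m y) y)
    (hA : ∀ x, c₁ * ‖ι x‖ ^ 2 ≤ inner ℝ (A x) (ι x)) {u : L2Time V} {v h : L2Time F}
    (hp : ∀ᵐ t ∂timeMeasure, ι (u t) = ∫ r in (0 : ℝ)..t, v r)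
    (he : ∀ᵐ t ∂timeMeasure, m (v t) + A (u t) = h t) :
    ∀ᵐ t ∂timeMeasure, ‖ι (u t)‖ ^ 2 ≤
      (2 * c₀ * c₁)⁻¹ * ∫ r in (0 : ℝ)..t, ‖h r‖ ^ 2 := by
  filter_upwards [hp, ae_restrict_mem measurableSet_Ioi] with t h1 h2
  have ht : 0 ≤ t := (mem_Ioi.mp h2).le
  obtain ⟨i1, e1⟩ := bilin_primitive ((innerSL ℝ (E := F)).comp m)
    (intervalIntegrable_L2Time v ht) (intervalIntegrable_L2Time v ht) 0 0
  simp only [zero_add, ContinuousLinearMap.comp_apply, innerSL_apply_apply, map_zero] at i1 e1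
  have i2 := (intervalIntegrable_norm_sq h ht).const_mul (2 * c₁)⁻¹
  have e2 : inner ℝ (m (ι (u t))) (ι (u t)) ≤
      ∫ r in (0 : ℝ)..t, (2 * c₁)⁻¹ * ‖h r‖ ^ 2 := by
    rw [h1, e1]
    refine intervalIntegral.integral_mono_ae_restrict ht i1 i2 ?_
    have hle : volume.restrict (Icc 0 t) ≤ (volume.restrict (Ici (0 : ℝ))) :=
      Measure.restrict_mono Icc_subset_Ici_self le_rfl
    refine ae_mono hle ?_
    rw [← restrict_Ioi_eq_restrict_Ici]
    filter_upwards [hp, he] with r h3 h4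
    rw [← h3, hm (ι (u r)), real_inner_comm (m (v r)) (ι (u r)), eq_sub_iff_add_eq.mpr h4,
      inner_sub_left]
    have h5 := hA (u r)
    have h6 := real_inner_le_norm (h r) (ι (u r))
    -- Young's inequality with the weight chosen so that the last term is absorbed exactly by the
    -- coercivity of `A`.
    have h7 : 2 * (‖h r‖ * ‖ι (u r)‖) ≤ (2 * c₁)⁻¹ * ‖h r‖ ^ 2 + 2 * (c₁ * ‖ι (u r)‖ ^ 2) := by
      have h8 : 0 ≤ (2 * c₁)⁻¹ * (‖h r‖ - 2 * c₁ * ‖ι (u r)‖) ^ 2 := by positivity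
      have h9 : (2 * c₁)⁻¹ * (‖h r‖ - 2 * c₁ * ‖ι (u r)‖) ^ 2 = (2 * c₁)⁻¹ * ‖h r‖ ^ 2 +
          2 * (c₁ * ‖ι (u r)‖ ^ 2) - 2 * (‖h r‖ * ‖ι (u r)‖) := by
        field_simp
        ring
      linarith
    linarith
  rw [intervalIntegral.integral_const_mul] at e2
  have e3 := (hmc (ι (u t))).trans e2
  have e4 : (2 * c₀ * c₁)⁻¹ * ∫ r in (0 : ℝ)..t, ‖h r‖ ^ 2 =
      c₀⁻¹ * ((2 * c₁)⁻¹ * ∫ r in (0 : ℝ)..t, ‖h r‖ ^ 2) := by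
    rw [mul_comm 2 c₀, mul_assoc, mul_inv, mul_assoc]
  rw [e4, ← div_eq_inv_mul, le_div_iff₀ hc₀, mul_comm]
  exact e3

/-- Uniqueness for `m u' + A u = h`, `u(0) = a`. -/
theorem eq_zero_of_equation {c₀ c₁ : ℝ} (hc₀ : 0 < c₀) (hc₁ : 0 < c₁)
    (hι : Function.Injective ι)
    (hm : ∀ x y, inner ℝ (m x) y = inner ℝ x (m y)) (hmc : ∀ y, c₀ * ‖y‖ ^ 2 ≤ inner ℝ (m y) y)
    (hA : ∀ x, c₁ * ‖ι x‖ ^ 2 ≤ inner ℝ (A x) (ι x)) {u : L2Time V} {v : L2Time F}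
    (hp : ∀ᵐ t ∂timeMeasure, ι (u t) = ∫ r in (0 : ℝ)..t, v r)
    (he : ∀ᵐ t ∂timeMeasure, m (v t) + A (u t) = 0) : u = 0 ∧ v = 0 := by
  have h0 := Lp.coeFn_zero F 2 timeMeasure
  have h1 := norm_sq_le_of_equation hc₀ hc₁ hm hmc hA (h := 0) hp (by
    filter_upwards [he, h0] with t h1 h2
    rw [h1, h2, Pi.zero_apply])
  have h2 : ∀ᵐ t ∂timeMeasure, u t = 0 := by
    filter_upwards [h1, ae_restrict_mem measurableSet_Ioi] with t h2 h3
    have e : ∫ r in (0 : ℝ)..t, ‖(0 : L2Time F) r‖ ^ 2 = 0 := by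
      refine intervalIntegral.integral_zero_ae ?_
      filter_upwards [(ae_restrict_iff' measurableSet_Ioi).mp h0] with y hy hy'
      rw [uIoc_of_le (mem_Ioi.mp h3).le] at hy'
      rw [hy hy'.1]
      simp
    rw [e, mul_zero] at h2
    have h4 : ι (u t) = 0 := by
      rw [← norm_eq_zero]
      exact pow_eq_zero_iff two_ne_zero |>.mp (le_antisymm h2 (sq_nonneg _))
    exact hι (h4.trans (map_zero ι).symm)
  have h3 : ∀ᵐ t ∂timeMeasure, v t = 0 := by
    filter_upwards [he, h2] with t h4 h5
    rw [h5, map_zero, add_zero] at h4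
    have h6 := hmc (v t)
    rw [h4, inner_zero_left] at h6
    have h7 : ‖v t‖ ^ 2 ≤ 0 := by
      by_contra hlt
      exact absurd h6 (not_le.mpr (mul_pos hc₀ (not_le.mp hlt)))
    rw [← norm_eq_zero]
    exact pow_eq_zero_iff two_ne_zero |>.mp (le_antisymm h7 (sq_nonneg _))
  refine ⟨Lp.ext ?_, Lp.ext ?_⟩
  · filter_upwards [h2, Lp.coeFn_zero V 2 timeMeasure] with t h4 h5
    rw [h4]; exact h5.symm
  · filter_upwards [h3, h0] with t h4 h5
    rw [h4]; exact h5.symm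

end Energy

/-! ### The operators of the system -/

section Elliptic

variable {s : ℝ} (hs : 0 ≤ s)

/-- The operator `-a Δ - b ∇ div + d`. -/
def ellL (a b d : ℝ) : H (s + 2) →L[ℝ] H s :=
  -(a • lapL hs) - b • gradDivL hs + d • H.incl (le_add_two' s)

lemma ellL_apply (a b d : ℝ) (f : H (s + 2)) : ellL hs a b d f =
    -(a • lapL hs f) - b • gradDivL hs f + d • H.incl (le_add_two' s) f := rfl

lemma coeff_ellL (a b d : ℝ) (f : H (s + 2)) (k : Fin 3 → ℤ) :
    H.coeff k (ellL hs a b d f) = -(a • lapSymbol k (H.coeff k f)) -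
      b • gradDivSymbol k (H.coeff k f) + d • H.coeff k f := by
  rw [ellL_apply, map_add, map_sub, map_neg, map_smul, map_smul, map_smul, coeff_lapL,
    coeff_gradDivL, H.coeff_incl]

lemma incl_injective {a b : ℝ} (h : b ≤ a) : Function.Injective (H.incl h) := by
  intro f g hfg
  refine H.ext_coeff fun k => ?_
  rw [← H.coeff_incl h, hfg, H.coeff_incl]

/-- `⟨f, (1 - Δ) v⟩_{H^s} = ⟨f, v⟩_{H^{s+1}}` in terms of coefficients. -/
lemma hasSum_inner_bessel (f : H s) (v : H (s + 2)) :
    HasSum (fun k => wt k ^ (s + 1) * inner ℝ (H.coeff k f) (H.coeff k v))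
      (inner ℝ f (bessel (b := s) (by linarith) hs v)) := by
  refine (H.hasSum_inner f _).congr_fun fun k => ?_
  rw [coeff_bessel, inner_smul_right, ← mul_assoc, ← Real.rpow_add (wt_pos k)]
  congr 3
  ring

/-- With `1 - Δ` normalised to the multiplier `1 + |k|²`, testing in `H^s` becomes the `H^{s+1}`
inner product. This gives the symmetry and positivity required by Lions' method, and turns its
condition on initial data into membership in `H^{s+1}`. -/
lemma inner_incl_bessel {r : ℝ} (hr : r = s + 1) (h : s ≤ r) (h' : r ≤ s + 2) (f : H r)
    (v : H (s + 2)) : inner ℝ (H.incl h f) (bessel (b := s) (by linarith) hs v) =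
      inner ℝ f (H.incl h' v) := by
  subst hr
  refine (hasSum_inner_bessel hs _ v).unique ?_
  simpa only [H.coeff_incl] using H.hasSum_inner f (H.incl h' v)

lemma hasSum_norm_sq_mul {s r : ℝ} (hr : r = s + 1) (f : H r) :
    HasSum (fun k => wt k ^ s * (wt k * ‖H.coeff k f‖ ^ 2)) (‖f‖ ^ 2) := by
  subst hr
  refine (H.hasSum_norm_sq f).congr_fun fun k => ?_
  rw [← mul_assoc, Real.rpow_add_one (wt_pos k).ne']

lemma le_wt_mul_norm_sq (k : Fin 3 → ℤ) (c : CVec) : ‖c‖ ^ 2 ≤ wt k * ‖c‖ ^ 2 :=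
  le_mul_of_one_le_left (sq_nonneg _) (one_le_wt k)

/-- The frequency estimate is summed with two weights: `s + 1` gives control of `H^{s+2}`, used for
existence, and `s` gives the energy inequality in `H^s`, used for uniqueness. -/
theorem exists_ellL_coercive {a b d : ℝ} (ha : 0 < a) (hab : 0 < a + b) (hd : 0 < d) :
    ∃ c₀, 0 < c₀ ∧
      (∀ v, c₀ * ‖v‖ ^ 2 ≤ inner ℝ (ellL hs a b d v) (bessel (b := s) (by linarith) hs v)) ∧
      ∀ v, c₀ * ‖H.incl (le_add_two' s) v‖ ^ 2 ≤
        inner ℝ (ellL hs a b d v) (H.incl (le_add_two' s) v) := by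
  obtain ⟨c₀, hc₀, h⟩ := exists_elliptic_coercive ha hab hd
  refine ⟨c₀, hc₀, fun v => ?_, fun v => ?_⟩
  · refine hasSum_le (fun k => ?_) ((hasSum_norm_sq_mul (s := s + 1) (by ring) v).mul_left c₀)
      (hasSum_inner_bessel hs _ v)
    rw [coeff_ellL, mul_left_comm]
    exact mul_le_mul_of_nonneg_left (h k _) (wt_rpow_pos k _).le
  · refine hasSum_le (fun k => ?_) ((H.hasSum_norm_sq _).mul_left c₀) (H.hasSum_inner _ _)
    rw [coeff_ellL, mul_left_comm, H.coeff_incl]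
    refine mul_le_mul_of_nonneg_left (le_trans ?_ (h k _)) (wt_rpow_pos k _).le
    exact mul_le_mul_of_nonneg_left (le_wt_mul_norm_sq k _) hc₀.le

end Elliptic

/-! ### Potential microflows -/

/-- The potential microflow equation as an evolution equation in `H^{q-1}`. -/
lemma isPotentialMicroflow_iff (P : Params) {q : ℝ} (hq : 1 ≤ q) (z₀ : H q) (z : X (q - 1)) :
    IsPotentialMicroflow P z₀ z ↔
      (∀ᵐ t ∂timeMeasure, H.incl (le_add_two' (q - 1)) (z.fn t) =
        H.incl (by linarith) z₀ + ∫ x in (0 : ℝ)..t, z.dt x) ∧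
      ∀ᵐ t ∂timeMeasure, z.dt t + ellL (s := q - 1) (by linarith) (P.alpha / P.j + P.gamma / P.j)
        ((P.alpha + 3 * P.beta) / (3 * P.j) - P.gamma / P.j) (2 * P.kappa / P.j) (z.fn t) = 0 := by
  rw [IsPotentialMicroflow, hasInitialValue_iff (s := q - 1) (by linarith) (by ring) _
    (by linarith)]
  refine and_congr Iff.rfl (eventually_congr (.of_forall fun t => ?_))
  rw [← H.field_injective.eq_iff (b := (0 : H (q - 1))), map_zero, ellL_apply, map_add, map_add,
    map_sub, map_neg, map_smul, map_smul, map_smul, field_lapL, field_gradDivL, H.field_incl]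
  refine Eq.congr ?_ rfl
  abel

/-- Existence and uniqueness of the potential microflow. -/
theorem existsUnique_isPotentialMicroflow (P : Params) {q : ℝ} (hq : 1 ≤ q) (z₀ : H q) :
    ∃! z : X (q - 1), IsPotentialMicroflow P z₀ z := by
  have hs : 0 ≤ q - 1 := by linarith
  have hj := P.j_pos
  have hα := P.alpha_pos
  have hβ := P.beta_pos
  have hγ := P.gamma_pos
  have hκ := P.kappa_pos
  have := completeSpace_H hs
  have := completeSpace_H (show 0 ≤ q - 1 + 2 by linarith)
  obtain ⟨c₀, hc₀, h1, h2⟩ := exists_ellL_coercive hs (a := P.alpha / P.j + P.gamma / P.j)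
    (b := (P.alpha + 3 * P.beta) / (3 * P.j) - P.gamma / P.j) (d := 2 * P.kappa / P.j)
    (by positivity) (by
      -- The contribution of `γ` cancels, so the sum is positive even when the coefficient of `∇
      -- div` is negative.
      rw [add_add_sub_cancel]
      positivity) (by positivity)
  simp only [isPotentialMicroflow_iff P hq z₀]
  set A := ellL hs (P.alpha / P.j + P.gamma / P.j)
    ((P.alpha + 3 * P.beta) / (3 * P.j) - P.gamma / P.j) (2 * P.kappa / P.j) with hA
  have hinner : ∀ (f : H q) (v : H (q - 1 + 2)),
      inner ℝ (H.incl (show q - 1 ≤ q by linarith) f) (bessel (b := q - 1) (by linarith) hs v) =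
        inner ℝ f (H.incl (le_sub_one_add_two q) v) := fun f v =>
    inner_incl_bessel hs (by ring) _ _ f v
  have hincl : ∀ v : H (q - 1 + 2), H.incl (le_add_two' (q - 1)) v =
      H.incl (show q - 1 ≤ q by linarith) (H.incl (le_sub_one_add_two q) v) := fun v =>
    H.ext_coeff fun k => by simp only [H.coeff_incl]
  -- The energy at time zero is the squared `H^q` norm, so the condition on the initial datum is
  -- Cauchy-Schwarz in `H^q` with constant `‖z₀‖`.
  obtain ⟨z, hz1, hz2⟩ := exists_parabolic_solution (H.incl (le_add_two' (q - 1))) A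
    (bessel (b := q - 1) (by linarith) hs) (ContinuousLinearEquiv.refl ℝ _) (K := ‖z₀‖) hc₀
    (fun v w => by
      simp only [ContinuousLinearEquiv.refl_apply]
      rw [hincl, hincl, hinner, hinner, real_inner_comm])
    (fun v => by
      simp only [ContinuousLinearEquiv.refl_apply]
      rw [hincl, hinner]
      exact real_inner_self_nonneg)
    h1 0 (H.incl (by linarith) z₀) (fun v => by
      simp only [ContinuousLinearEquiv.refl_apply]
      rw [hincl, hinner, hinner, ← norm_eq_sqrt_real_inner]
      exact abs_real_inner_le_norm _ _)
  refine ⟨z, ⟨hz2, ?_⟩, ?_⟩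
  · filter_upwards [hz1, Lp.coeFn_zero (H (q - 1)) 2 timeMeasure] with t h3 h4
    rw [h4] at h3
    exact h3
  · rintro z' ⟨h3, h4⟩
    rw [← sub_eq_zero]
    have e1 := Lp.coeFn_sub z'.fn z.fn
    have e2 := Lp.coeFn_sub z'.dt z.dt
    have h0 : z'.fn - z.fn = 0 ∧ z'.dt - z.dt = 0 := by
      refine eq_zero_of_equation (A := A) (m := ContinuousLinearMap.id ℝ _) one_pos hc₀
        (incl_injective _) (fun x y => rfl) (fun y => ?_) h2 ?_ ?_
      · rw [one_mul, ContinuousLinearMap.id_apply, real_inner_self_eq_norm_sq]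
      · filter_upwards [h3, hz2, e1, ae_restrict_mem measurableSet_Ioi] with t h5 h6 h7 h8
        have ht := (mem_Ioi.mp h8).le
        rw [h7, Pi.sub_apply, map_sub, h5, h6, add_sub_add_left_eq_sub,
          ← intervalIntegral.integral_sub (intervalIntegrable_L2Time z'.dt ht)
            (intervalIntegrable_L2Time z.dt ht)]
        refine intervalIntegral.integral_congr_ae ?_
        filter_upwards [(ae_restrict_iff' measurableSet_Ioi).mp e2] with y hy hy'
        rw [uIoc_of_le ht] at hy'
        exact (hy hy'.1).symm
      · filter_upwards [h4, hz1, e1, e2, Lp.coeFn_zero (H (q - 1)) 2 timeMeasure]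
          with t h5 h6 h7 h8 h9
        rw [h9] at h6
        have h6' : z.dt t + A (z.fn t) = 0 := h6
        rw [h7, h8, Pi.sub_apply, Pi.sub_apply, map_sub A, ContinuousLinearMap.id_apply,
          sub_add_sub_comm, h5, h6', sub_zero]
    exact Subtype.ext (Prod.ext h0.1 h0.2)

/-! ### Products of spaces -/

section Prod

variable {E F E' F' : Type} [NormedAddCommGroup E] [NormedSpace ℝ E]
  [NormedAddCommGroup F] [NormedSpace ℝ F] [NormedAddCommGroup E'] [NormedSpace ℝ E']
  [NormedAddCommGroup F'] [NormedSpace ℝ F']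

lemma Parabolic.add_ae_eq_primitive {ι : E →L[ℝ] F} {u v : Parabolic ι} {a b : F}
    (hu : ∀ᵐ t ∂timeMeasure, ι (u.fn t) = a + ∫ r in (0 : ℝ)..t, u.dt r)
    (hv : ∀ᵐ t ∂timeMeasure, ι (v.fn t) = b + ∫ r in (0 : ℝ)..t, v.dt r) :
    ∀ᵐ t ∂timeMeasure, ι ((u + v).fn t) = (a + b) + ∫ r in (0 : ℝ)..t, (u + v).dt r := by
  have e1 : ∀ᵐ t ∂timeMeasure, (u + v).fn t = u.fn t + v.fn t := Lp.coeFn_add u.fn v.fn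
  have e2 : ∀ᵐ t ∂timeMeasure, (u + v).dt t = u.dt t + v.dt t := Lp.coeFn_add u.dt v.dt
  filter_upwards [hu, hv, e1, ae_restrict_mem measurableSet_Ioi] with t h5 h6 h7 h8
  have ht := (mem_Ioi.mp h8).le
  rw [h7, map_add, h5, h6, add_add_add_comm,
    ← intervalIntegral.integral_add (intervalIntegrable_L2Time u.dt ht)
      (intervalIntegrable_L2Time v.dt ht)]
  congr 1
  refine intervalIntegral.integral_congr_ae ?_
  filter_upwards [(ae_restrict_iff' measurableSet_Ioi).mp e2] with y hy hy'
  rw [uIoc_of_le ht] at hy'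
  exact (hy hy'.1).symm

/-- The product of two continuous linear maps, on products with the Euclidean norm. -/
def euclProd (S : E →L[ℝ] E') (T : F →L[ℝ] F') : WithLp 2 (E × F) →L[ℝ] WithLp 2 (E' × F') :=
  (WithLp.prodContinuousLinearEquiv 2 ℝ E' F').symm.toContinuousLinearMap.comp
    ((S.comp (WithLp.fstL 2 ℝ E F)).prod (T.comp (WithLp.sndL 2 ℝ E F)))

lemma euclProd_apply (S : E →L[ℝ] E') (T : F →L[ℝ] F') (x : WithLp 2 (E × F)) :
    euclProd S T x = WithLp.toLp 2 (S x.fst, T x.snd) := rfl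

/-- The product of two isomorphisms, on products with the Euclidean norm. -/
def euclProdEquiv (S : E ≃L[ℝ] E') (T : F ≃L[ℝ] F') :
    WithLp 2 (E × F) ≃L[ℝ] WithLp 2 (E' × F') :=
  (WithLp.prodContinuousLinearEquiv 2 ℝ E F).trans
    ((S.prodCongr T).trans (WithLp.prodContinuousLinearEquiv 2 ℝ E' F').symm)

/-- The first inclusion in a product. -/
def euclInl (E F : Type) [NormedAddCommGroup E] [NormedSpace ℝ E] [NormedAddCommGroup F]
    [NormedSpace ℝ F] : E →L[ℝ] WithLp 2 (E × F) :=
  (WithLp.prodContinuousLinearEquiv 2 ℝ E F).symm.toContinuousLinearMap.comp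
    (ContinuousLinearMap.inl ℝ E F)

/-- The second inclusion in a product. -/
def euclInr (E F : Type) [NormedAddCommGroup E] [NormedSpace ℝ E] [NormedAddCommGroup F]
    [NormedSpace ℝ F] : F →L[ℝ] WithLp 2 (E × F) :=
  (WithLp.prodContinuousLinearEquiv 2 ℝ E F).symm.toContinuousLinearMap.comp
    (ContinuousLinearMap.inr ℝ E F)

lemma euclInl_add_euclInr (x : E) (y : F) :
    euclInl E F x + euclInr E F y = WithLp.toLp 2 (x, y) := by
  change WithLp.toLp 2 ((x, (0 : F)) + ((0 : E), y)) = _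
  simp

/-- Two evolutions become one in the product with the Euclidean norm, which is again a Hilbert
space, so the energy estimate for a single equation covers the system. -/
lemma exists_parabolic_pair [CompleteSpace F] [CompleteSpace F'] {ι : E →L[ℝ] F}
    {ι' : E' →L[ℝ] F'} {u : Parabolic ι} {w : Parabolic ι'} {a : F} {b : F'}
    (hu : ∀ᵐ t ∂timeMeasure, ι (u.fn t) = a + ∫ r in (0 : ℝ)..t, u.dt r)
    (hw : ∀ᵐ t ∂timeMeasure, ι' (w.fn t) = b + ∫ r in (0 : ℝ)..t, w.dt r) :
    ∃ p : Parabolic (euclProd ι ι'),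
      (∀ᵐ t ∂timeMeasure, p.fn t = WithLp.toLp 2 (u.fn t, w.fn t)) ∧
      (∀ᵐ t ∂timeMeasure, p.dt t = WithLp.toLp 2 (u.dt t, w.dt t)) ∧
      ∀ᵐ t ∂timeMeasure, euclProd ι ι' (p.fn t) =
        WithLp.toLp 2 (a, b) + ∫ r in (0 : ℝ)..t, p.dt r := by
  have h1 : ∀ x, euclProd ι ι' (euclInl E E' x) = euclInl F F' (ι x) := fun x => by
    rw [euclProd_apply]
    change WithLp.toLp 2 (ι x, ι' 0) = WithLp.toLp 2 (ι x, 0)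
    rw [map_zero]
  have h2 : ∀ x, euclProd ι ι' (euclInr E E' x) = euclInr F F' (ι' x) := fun x => by
    rw [euclProd_apply]
    change WithLp.toLp 2 (ι 0, ι' x) = WithLp.toLp 2 (0, ι' x)
    rw [map_zero]
  refine ⟨u.map _ _ h1 + w.map _ _ h2, ?_, ?_, ?_⟩
  · filter_upwards [u.map_fn _ _ h1, w.map_fn _ _ h2,
      Lp.coeFn_add (u.map _ _ h1).fn (w.map _ _ h2).fn] with t e1 e2 e3
    rw [← euclInl_add_euclInr, ← e1, ← e2]
    exact e3
  · filter_upwards [u.map_dt _ _ h1, w.map_dt _ _ h2,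
      Lp.coeFn_add (u.map _ _ h1).dt (w.map _ _ h2).dt] with t e1 e2 e3
    rw [← euclInl_add_euclInr, ← e1, ← e2]
    exact e3
  · rw [← euclInl_add_euclInr]
    exact Parabolic.add_ae_eq_primitive (u.map_ae_eq_primitive _ _ h1 hu)
      (w.map_ae_eq_primitive _ _ h2 hw)

end Prod

/-! ### Coupled parabolic systems -/

section CoupledAbstract

variable {V₁ V₂ F₁ F₂ : Type} [NormedAddCommGroup V₁] [InnerProductSpace ℝ V₁]
  [NormedAddCommGroup V₂] [InnerProductSpace ℝ V₂] [NormedAddCommGroup F₁]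
  [InnerProductSpace ℝ F₁] [CompleteSpace F₁] [NormedAddCommGroup F₂] [InnerProductSpace ℝ F₂]
  [CompleteSpace F₂] {ι₁ : V₁ →L[ℝ] F₁} {ι₂ : V₂ →L[ℝ] F₂} {A₁ : V₁ × V₂ →L[ℝ] F₁}
  {A₂ : V₁ × V₂ →L[ℝ] F₂} {m₁ m₂ : ℝ}

/-- The operator with components `A₁` and `A₂`. -/
def euclPair (A₁ : V₁ × V₂ →L[ℝ] F₁) (A₂ : V₁ × V₂ →L[ℝ] F₂) :
    WithLp 2 (V₁ × V₂) →L[ℝ] WithLp 2 (F₁ × F₂) :=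
  (WithLp.prodContinuousLinearEquiv 2 ℝ F₁ F₂).symm.toContinuousLinearMap.comp
    ((A₁.prod A₂).comp (WithLp.prodContinuousLinearEquiv 2 ℝ V₁ V₂).toContinuousLinearMap)

/-- Multiplication of the components by positive constants. -/
def massL (hm₁ : 0 < m₁) (hm₂ : 0 < m₂) : WithLp 2 (F₁ × F₂) ≃L[ℝ] WithLp 2 (F₁ × F₂) :=
  euclProdEquiv (ContinuousLinearEquiv.smulLeft (Units.mk0 m₁ hm₁.ne'))
    (ContinuousLinearEquiv.smulLeft (Units.mk0 m₂ hm₂.ne'))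

omit [CompleteSpace F₁] [CompleteSpace F₂] in
lemma massL_apply (hm₁ : 0 < m₁) (hm₂ : 0 < m₂) (x : WithLp 2 (F₁ × F₂)) :
    massL hm₁ hm₂ x = WithLp.toLp 2 (m₁ • x.fst, m₂ • x.snd) := rfl

omit [CompleteSpace F₁] [CompleteSpace F₂] in
lemma inner_massL (hm₁ : 0 < m₁) (hm₂ : 0 < m₂) (x y : WithLp 2 (F₁ × F₂)) :
    inner ℝ (massL hm₁ hm₂ x) y = m₁ * inner ℝ x.fst y.fst + m₂ * inner ℝ x.snd y.snd := by
  rw [massL_apply, WithLp.prod_inner_apply]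
  change inner ℝ (m₁ • x.fst) y.fst + inner ℝ (m₂ • x.snd) y.snd = _
  rw [real_inner_smul_left, real_inner_smul_left]

variable [CompleteSpace V₁] [CompleteSpace V₂]

/-- Solvability of coupled systems `mᵢ uᵢ' + Aᵢ (u₁, u₂) = fᵢ`, `uᵢ(0) = yᵢ`. -/
theorem exists_coupled_parabolic_solution {L₁ : V₁ ≃L[ℝ] F₁} {L₂ : V₂ ≃L[ℝ] F₂}
    {c K₁ K₂ : ℝ} (hc : 0 < c) (hm₁ : 0 < m₁) (hm₂ : 0 < m₂) (hK₁ : 0 ≤ K₁) (hK₂ : 0 ≤ K₂)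
    (hsymm₁ : ∀ v w, inner ℝ (ι₁ v) (L₁ w) = inner ℝ (ι₁ w) (L₁ v))
    (hsymm₂ : ∀ v w, inner ℝ (ι₂ v) (L₂ w) = inner ℝ (ι₂ w) (L₂ v))
    (hpos₁ : ∀ v, 0 ≤ inner ℝ (ι₁ v) (L₁ v)) (hpos₂ : ∀ v, 0 ≤ inner ℝ (ι₂ v) (L₂ v))
    (hcoer : ∀ v₁ v₂, c * (‖v₁‖ ^ 2 + ‖v₂‖ ^ 2) ≤
      inner ℝ (A₁ (v₁, v₂)) (L₁ v₁) + inner ℝ (A₂ (v₁, v₂)) (L₂ v₂))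
    (f₁ : L2Time F₁) (f₂ : L2Time F₂) (y₁ : F₁) (y₂ : F₂)
    (hy₁ : ∀ v, |inner ℝ y₁ (L₁ v)| ≤ K₁ * Real.sqrt (inner ℝ (ι₁ v) (L₁ v)))
    (hy₂ : ∀ v, |inner ℝ y₂ (L₂ v)| ≤ K₂ * Real.sqrt (inner ℝ (ι₂ v) (L₂ v))) :
    ∃ (u : Parabolic ι₁) (w : Parabolic ι₂),
      (∀ᵐ t ∂timeMeasure, m₁ • u.dt t + A₁ (u.fn t, w.fn t) = f₁ t) ∧
      (∀ᵐ t ∂timeMeasure, m₂ • w.dt t + A₂ (u.fn t, w.fn t) = f₂ t) ∧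
      (∀ᵐ t ∂timeMeasure, ι₁ (u.fn t) = y₁ + ∫ r in (0 : ℝ)..t, u.dt r) ∧
      ∀ᵐ t ∂timeMeasure, ι₂ (w.fn t) = y₂ + ∫ r in (0 : ℝ)..t, w.dt r := by
  let F : L2Time (WithLp 2 (F₁ × F₂)) := (euclInl _ _).compLp f₁ + (euclInr _ _).compLp f₂
  have hF : ∀ᵐ t ∂timeMeasure, F t = WithLp.toLp 2 (f₁ t, f₂ t) := by
    filter_upwards [Lp.coeFn_add ((euclInl F₁ F₂).compLp f₁) ((euclInr F₁ F₂).compLp f₂),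
      (euclInl F₁ F₂).coeFn_compLp f₁, (euclInr F₁ F₂).coeFn_compLp f₂] with t e1 e2 e3
    rw [← euclInl_add_euclInr, ← e2, ← e3]
    exact e1
  have hq : ∀ v : WithLp 2 (V₁ × V₂),
      inner ℝ (massL hm₁ hm₂ (euclProd ι₁ ι₂ v)) (euclProdEquiv L₁ L₂ v) =
        m₁ * inner ℝ (ι₁ v.fst) (L₁ v.fst) + m₂ * inner ℝ (ι₂ v.snd) (L₂ v.snd) := fun v =>
    inner_massL hm₁ hm₂ _ _
  obtain ⟨p, hp1, hp2⟩ := exists_parabolic_solution (euclProd ι₁ ι₂) (euclPair A₁ A₂)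
    (euclProdEquiv L₁ L₂) (massL hm₁ hm₂) (K := Real.sqrt m₁ * K₁ + Real.sqrt m₂ * K₂) hc
    (fun v w => by
      rw [inner_massL, inner_massL]
      change m₁ * inner ℝ (ι₁ v.fst) (L₁ w.fst) + m₂ * inner ℝ (ι₂ v.snd) (L₂ w.snd) =
        m₁ * inner ℝ (ι₁ w.fst) (L₁ v.fst) + m₂ * inner ℝ (ι₂ w.snd) (L₂ v.snd)
      rw [hsymm₁, hsymm₂])
    (fun v => by
      rw [hq]
      exact add_nonneg (mul_nonneg hm₁.le (hpos₁ _)) (mul_nonneg hm₂.le (hpos₂ _)))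
    (fun v => by
      rw [WithLp.prod_norm_sq_eq_of_L2, WithLp.prod_inner_apply]
      exact hcoer v.fst v.snd)
    F (WithLp.toLp 2 (y₁, y₂)) (fun v => by
      rw [hq, inner_massL]
      change |m₁ * inner ℝ y₁ (L₁ v.fst) + m₂ * inner ℝ y₂ (L₂ v.snd)| ≤ _
      have p₁ := mul_nonneg hm₁.le (hpos₁ v.fst)
      have p₂ := mul_nonneg hm₂.le (hpos₂ v.snd)
      set Q := m₁ * inner ℝ (ι₁ v.fst) (L₁ v.fst) + m₂ * inner ℝ (ι₂ v.snd) (L₂ v.snd) with hQ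
      -- The energy of each component enters multiplied by its mass, so half of the mass factor
      -- stays in the constant and half goes under the root.
      have key : ∀ {m K q x : ℝ}, 0 < m → 0 ≤ K → m * q ≤ Q → |x| ≤ K * Real.sqrt q →
          |m * x| ≤ Real.sqrt m * K * Real.sqrt Q := by
        intro m K q x hm hK hqQ hx
        rw [abs_mul, abs_of_pos hm]
        calc m * |x| ≤ m * (K * Real.sqrt q) := by gcongr
          _ = Real.sqrt m * K * (Real.sqrt m * Real.sqrt q) := by
              nth_rewrite 1 [← Real.mul_self_sqrt hm.le]; ring
          _ ≤ _ := by
              rw [← Real.sqrt_mul hm.le]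
              gcongr
      rw [add_mul]
      exact (abs_add_le _ _).trans (add_le_add
        (key hm₁ hK₁ (le_add_of_nonneg_right p₂) (hy₁ _))
        (key hm₂ hK₂ (le_add_of_nonneg_left p₁) (hy₂ _))))
  have i1 : ∀ x, ι₁ (WithLp.fstL 2 ℝ _ _ x) = WithLp.fstL 2 ℝ _ _ (euclProd ι₁ ι₂ x) :=
    fun x => rfl
  have i2 : ∀ x, ι₂ (WithLp.sndL 2 ℝ _ _ x) = WithLp.sndL 2 ℝ _ _ (euclProd ι₁ ι₂ x) :=
    fun x => rfl
  refine ⟨p.map _ _ i1, p.map _ _ i2, ?_, ?_, ?_, ?_⟩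
  · filter_upwards [hp1, hF, p.map_fn _ _ i1, p.map_fn _ _ i2, p.map_dt _ _ i1]
      with t e1 e2 e3 e4 e5
    rw [e3, e4, e5]
    rw [e2] at e1
    exact congrArg WithLp.fst e1
  · filter_upwards [hp1, hF, p.map_fn _ _ i1, p.map_fn _ _ i2, p.map_dt _ _ i2]
      with t e1 e2 e3 e4 e5
    rw [e3, e4, e5]
    rw [e2] at e1
    exact congrArg WithLp.snd e1
  · exact p.map_ae_eq_primitive _ _ i1 hp2
  · exact p.map_ae_eq_primitive _ _ i2 hp2

omit [CompleteSpace V₁] [CompleteSpace V₂] in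
/-- The energy estimate for coupled systems with vanishing initial data. -/
theorem exists_coupled_parabolic_estimate {c : ℝ} (hc : 0 < c) (hm₁ : 0 < m₁) (hm₂ : 0 < m₂)
    (hι₁ : Function.Injective ι₁) (hι₂ : Function.Injective ι₂)
    (hA : ∀ v₁ v₂, c * (‖ι₁ v₁‖ ^ 2 + ‖ι₂ v₂‖ ^ 2) ≤
      inner ℝ (A₁ (v₁, v₂)) (ι₁ v₁) + inner ℝ (A₂ (v₁, v₂)) (ι₂ v₂)) :
    ∃ C : ℝ, 0 ≤ C ∧ ∀ (u : Parabolic ι₁) (w : Parabolic ι₂) (g : L2Time F₂),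
      (∀ᵐ t ∂timeMeasure, ι₁ (u.fn t) = 0 + ∫ r in (0 : ℝ)..t, u.dt r) →
      (∀ᵐ t ∂timeMeasure, ι₂ (w.fn t) = 0 + ∫ r in (0 : ℝ)..t, w.dt r) →
      (∀ᵐ t ∂timeMeasure, m₁ • u.dt t + A₁ (u.fn t, w.fn t) = 0) →
      (∀ᵐ t ∂timeMeasure, m₂ • w.dt t + A₂ (u.fn t, w.fn t) = g t) →
      (∀ᵐ t ∂timeMeasure, ‖ι₁ (u.fn t)‖ ^ 2 ≤ C * ∫ r in (0 : ℝ)..t, ‖g r‖ ^ 2) ∧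
        (g = 0 → u = 0 ∧ w = 0) := by
  have hm : 0 < min m₁ m₂ := lt_min hm₁ hm₂
  have hmm : ∀ x y : WithLp 2 (F₁ × F₂), inner ℝ (massL hm₁ hm₂ x) y =
      inner ℝ x (massL hm₁ hm₂ y) := by
    intro x y
    rw [real_inner_comm (massL hm₁ hm₂ y), inner_massL, inner_massL, real_inner_comm x.fst,
      real_inner_comm x.snd]
  have hmc : ∀ y : WithLp 2 (F₁ × F₂), min m₁ m₂ * ‖y‖ ^ 2 ≤ inner ℝ (massL hm₁ hm₂ y) y := by
    intro y
    rw [inner_massL, real_inner_self_eq_norm_sq, real_inner_self_eq_norm_sq,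
      WithLp.prod_norm_sq_eq_of_L2, mul_add]
    gcongr
    exacts [min_le_left _ _, min_le_right _ _]
  have hA' : ∀ v, c * ‖euclProd ι₁ ι₂ v‖ ^ 2 ≤
      inner ℝ (euclPair A₁ A₂ v) (euclProd ι₁ ι₂ v) := by
    intro v
    rw [WithLp.prod_norm_sq_eq_of_L2, WithLp.prod_inner_apply]
    exact hA v.fst v.snd
  have hinj : Function.Injective (euclProd ι₁ ι₂) := by
    intro x y hxy
    have i1 : ι₁ x.fst = ι₁ y.fst := congrArg WithLp.fst hxy
    have i2 : ι₂ x.snd = ι₂ y.snd := congrArg WithLp.snd hxy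
    exact WithLp.ofLp_injective 2 (Prod.ext (hι₁ i1) (hι₂ i2))
  refine ⟨(2 * min m₁ m₂ * c)⁻¹, by positivity, fun u w g hu hw h1 h2 => ?_⟩
  obtain ⟨p, hp1, hp2, hp3⟩ := exists_parabolic_pair hu hw
  have hp3' : ∀ᵐ t ∂timeMeasure, euclProd ι₁ ι₂ (p.fn t) = ∫ r in (0 : ℝ)..t, p.dt r := by
    filter_upwards [hp3] with t ht
    exact ht.trans (zero_add _)
  have hG : ∀ᵐ t ∂timeMeasure, (euclInr F₁ F₂).compLp g t = euclInr _ _ (g t) :=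
    (euclInr F₁ F₂).coeFn_compLp g
  have he : ∀ᵐ t ∂timeMeasure, massL hm₁ hm₂ (p.dt t) + euclPair A₁ A₂ (p.fn t) =
      (euclInr F₁ F₂).compLp g t := by
    filter_upwards [hp1, hp2, h1, h2, hG] with t e1 e2 e3 e4 e5
    rw [e5, e1, e2, ← e4]
    exact congrArg (fun x => WithLp.toLp 2 (x, _)) e3
  constructor
  · have e0 := norm_sq_le_of_equation (ι := euclProd ι₁ ι₂) (A := euclPair A₁ A₂)
      (m := (massL hm₁ hm₂).toContinuousLinearMap) hm hc hmm hmc hA' hp3' he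
    filter_upwards [e0, hp1, ae_restrict_mem measurableSet_Ioi] with t e1 e2 e3
    rw [e2] at e1
    have e4 : ∫ r in (0 : ℝ)..t, ‖(euclInr F₁ F₂).compLp g r‖ ^ 2 =
        ∫ r in (0 : ℝ)..t, ‖g r‖ ^ 2 := by
      refine intervalIntegral.integral_congr_ae ?_
      filter_upwards [(ae_restrict_iff' measurableSet_Ioi).mp hG] with y hy hy'
      rw [uIoc_of_le (mem_Ioi.mp e3).le] at hy'
      rw [hy hy'.1, WithLp.prod_norm_sq_eq_of_L2]
      change ‖(0 : F₁)‖ ^ 2 + ‖g y‖ ^ 2 = _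
      simp
    rw [e4, WithLp.prod_norm_sq_eq_of_L2] at e1
    refine le_trans ?_ e1
    exact le_add_of_nonneg_right (sq_nonneg _)
  · rintro rfl
    obtain ⟨z1, z2⟩ : p.fn = 0 ∧ p.dt = 0 := by
      refine eq_zero_of_equation (ι := euclProd ι₁ ι₂) (A := euclPair A₁ A₂)
        (m := (massL hm₁ hm₂).toContinuousLinearMap) hm hc hinj hmm
        hmc hA' hp3' ?_
      filter_upwards [he, hG, Lp.coeFn_zero F₂ 2 timeMeasure] with t e1 e2 e3
      rw [e2, e3, Pi.zero_apply, map_zero] at e1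
      exact e1
    replace z1 := Lp.eq_zero_iff_ae_eq_zero.mp z1
    replace z2 := Lp.eq_zero_iff_ae_eq_zero.mp z2
    constructor
    · refine Parabolic.ext_ae ?_ ?_
      · filter_upwards [hp1, z1, Lp.coeFn_zero V₁ 2 timeMeasure] with t e1 e2 e3
        exact (congrArg WithLp.fst (e1.symm.trans e2)).trans e3.symm
      · filter_upwards [hp2, z2, Lp.coeFn_zero F₁ 2 timeMeasure] with t e1 e2 e3
        exact (congrArg WithLp.fst (e1.symm.trans e2)).trans e3.symm
    · refine Parabolic.ext_ae ?_ ?_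
      · filter_upwards [hp1, z1, Lp.coeFn_zero V₂ 2 timeMeasure] with t e1 e2 e3
        exact (congrArg WithLp.snd (e1.symm.trans e2)).trans e3.symm
      · filter_upwards [hp2, z2, Lp.coeFn_zero F₂ 2 timeMeasure] with t e1 e2 e3
        exact (congrArg WithLp.snd (e1.symm.trans e2)).trans e3.symm

end CoupledAbstract

/-! ### The unperturbed system -/

section Coupled

variable (P : Params) {s : ℝ} (hs : 0 ≤ s)

/-- `-(ε + κ/2) Δu - κ curl ω`. -/
def momentumL : Hsol (s + 2) × H (s + 2) →L[ℝ] Hsol s :=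
  -((P.eps + P.kappa / 2) • (lapSolL hs).comp
      (ContinuousLinearMap.fst ℝ (Hsol (s + 2)) (H (s + 2)))) -
    P.kappa • (curlSolL hs).comp (ContinuousLinearMap.snd ℝ (Hsol (s + 2)) (H (s + 2)))

/-- `-(α + γ) Δω - (α/3 + β - γ) ∇ div ω + 2κ ω - κ curl u`. -/
def microL : Hsol (s + 2) × H (s + 2) →L[ℝ] H s :=
  (ellL hs (P.alpha + P.gamma) (P.alpha / 3 + P.beta - P.gamma) (2 * P.kappa)).comp
      (ContinuousLinearMap.snd ℝ (Hsol (s + 2)) (H (s + 2))) -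
    P.kappa • ((curlL hs).comp (HsolSub (s + 2)).subtypeL).comp
      (ContinuousLinearMap.fst ℝ (Hsol (s + 2)) (H (s + 2)))

lemma coe_momentumL (u : Hsol (s + 2)) (w : H (s + 2)) : (momentumL P hs (u, w) : H s) =
    -((P.eps + P.kappa / 2) • lapL hs (u : H (s + 2))) - P.kappa • curlL hs w := rfl

lemma coeff_momentumL (u : Hsol (s + 2)) (w : H (s + 2)) (k : Fin 3 → ℤ) :
    H.coeff k (momentumL P hs (u, w) : H s) =
      -((P.eps + P.kappa / 2) • lapSymbol k (H.coeff k (u : H (s + 2)))) -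
        P.kappa • curlSymbol k (H.coeff k w) := by
  rw [coe_momentumL, map_sub, map_neg, map_smul, map_smul, coeff_lapL, coeff_curlL]

lemma microL_apply (u : Hsol (s + 2)) (w : H (s + 2)) : microL P hs (u, w) =
    ellL hs (P.alpha + P.gamma) (P.alpha / 3 + P.beta - P.gamma) (2 * P.kappa) w -
      P.kappa • curlL hs (u : H (s + 2)) := rfl

lemma coeff_microL (u : Hsol (s + 2)) (w : H (s + 2)) (k : Fin 3 → ℤ) :
    H.coeff k (microL P hs (u, w)) = -((P.alpha + P.gamma) • lapSymbol k (H.coeff k w)) -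
      (P.alpha / 3 + P.beta - P.gamma) • gradDivSymbol k (H.coeff k w) +
        (2 * P.kappa) • H.coeff k w - P.kappa • curlSymbol k (H.coeff k (u : H (s + 2))) := by
  rw [microL_apply, map_sub, map_smul, coeff_curlL, coeff_ellL]

/-- The coupled estimate holds at every frequency because mean zero fields have vanishing
coefficient at `k = 0`. Summation with weights `s + 1` and `s` gives the forms needed for existence
and for the energy estimate. -/
theorem exists_coupled_coercive_constant : ∃ c, 0 < c ∧
    (∀ (u : Hsol (s + 2)) (w : H (s + 2)), c * (‖u‖ ^ 2 + ‖w‖ ^ 2) ≤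
      inner ℝ (momentumL P hs (u, w)) (besselSol (b := s) (by linarith) hs u) +
        inner ℝ (microL P hs (u, w)) (bessel (b := s) (by linarith) hs w)) ∧
    ∀ (u : Hsol (s + 2)) (w : H (s + 2)),
      c * (‖Hsol.incl (le_add_two' s) u‖ ^ 2 + ‖H.incl (le_add_two' s) w‖ ^ 2) ≤
        inner ℝ (momentumL P hs (u, w)) (Hsol.incl (le_add_two' s) u) +
          inner ℝ (microL P hs (u, w)) (H.incl (le_add_two' s) w) := by
  have hα := P.alpha_pos
  have hβ := P.beta_pos
  have hγ := P.gamma_pos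
  obtain ⟨c₀, hc₀, h⟩ := exists_coupled_coercive P.eps_pos P.kappa_pos
    (show 0 < P.alpha + P.gamma by positivity)
    (show 0 < P.alpha + P.gamma + (P.alpha / 3 + P.beta - P.gamma) by
      rw [add_add_sub_cancel]; positivity)
  have hk : ∀ (u : Hsol (s + 2)) (w : H (s + 2)) (k : Fin 3 → ℤ),
      c₀ * (wt k * (‖H.coeff k (u : H (s + 2))‖ ^ 2 + ‖H.coeff k w‖ ^ 2)) ≤
        inner ℝ (H.coeff k (momentumL P hs (u, w) : H s)) (H.coeff k (u : H (s + 2))) +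
          inner ℝ (H.coeff k (microL P hs (u, w))) (H.coeff k w) := by
    intro u w k
    rw [coeff_momentumL, coeff_microL]
    refine h k _ _ ?_
    rintro rfl
    exact (mem_HsolSub_iff.mp u.2).1
  refine ⟨c₀, hc₀, fun u w => ?_, fun u w => ?_⟩
  · refine hasSum_le (fun k => ?_)
      (((hasSum_norm_sq_mul (s := s + 1) (by ring) (u : H (s + 2))).add
        (hasSum_norm_sq_mul (s := s + 1) (by ring) w)).mul_left c₀)
      ((hasSum_inner_bessel hs (momentumL P hs (u, w) : H s) (u : H (s + 2))).add
        (hasSum_inner_bessel hs (microL P hs (u, w)) w))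
    rw [← mul_add, ← mul_add, ← mul_add, mul_left_comm]
    exact mul_le_mul_of_nonneg_left (hk u w k) (wt_rpow_pos k _).le
  · refine hasSum_le (fun k => ?_)
      (((H.hasSum_norm_sq (H.incl (le_add_two' s) (u : H (s + 2)))).add
        (H.hasSum_norm_sq (H.incl (le_add_two' s) w))).mul_left c₀)
      ((H.hasSum_inner (momentumL P hs (u, w) : H s) (H.incl (le_add_two' s) (u : H (s + 2)))).add
        (H.hasSum_inner (microL P hs (u, w)) (H.incl (le_add_two' s) w)))
    rw [← mul_add, ← mul_add, mul_left_comm, H.coeff_incl, H.coeff_incl]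
    refine mul_le_mul_of_nonneg_left (le_trans ?_ (hk u w k)) (wt_rpow_pos k _).le
    refine mul_le_mul_of_nonneg_left ?_ hc₀.le
    rw [mul_add]
    exact add_le_add (le_wt_mul_norm_sq k _) (le_wt_mul_norm_sq k _)

/-- Solvability of the unperturbed system. -/
theorem exists_coupled_solution (a : Hsol (s + 1)) (b : H (s + 1)) (f : L2Time (Hsol s))
    (g : L2Time (H s)) : ∃ (u : Xsol s) (w : X s),
      HasInitialValue (Hsol.incl (one_le_add_two' s)) u.fn a ∧
      HasInitialValue (H.incl (one_le_add_two' s)) w.fn b ∧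
      (∀ᵐ t ∂timeMeasure, P.rho • u.dt t + momentumL P hs (u.fn t, w.fn t) = f t) ∧
      ∀ᵐ t ∂timeMeasure, P.j • w.dt t + microL P hs (u.fn t, w.fn t) = g t := by
  have := completeSpace_H hs
  have := completeSpace_Hsol hs
  have := completeSpace_H (show 0 ≤ s + 2 by linarith)
  have := completeSpace_Hsol (show 0 ≤ s + 2 by linarith)
  obtain ⟨c, hc, h1, -⟩ := exists_coupled_coercive_constant P hs
  have hle : s ≤ s + 1 := by linarith
  have hincl : ∀ v : H (s + 2), H.incl (le_add_two' s) v =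
      H.incl hle (H.incl (one_le_add_two' s) v) := fun v =>
    H.ext_coeff fun k => by simp only [H.coeff_incl]
  have hb : ∀ (y : H (s + 1)) (v : H (s + 2)),
      inner ℝ (H.incl hle y) (bessel (b := s) (by linarith) hs v) =
        inner ℝ y (H.incl (one_le_add_two' s) v) := fun y v =>
    inner_incl_bessel hs rfl hle (one_le_add_two' s) y v
  have hb' : ∀ (x v : H (s + 2)),
      inner ℝ (H.incl (le_add_two' s) x) (bessel (b := s) (by linarith) hs v) =
        inner ℝ (H.incl (one_le_add_two' s) x) (H.incl (one_le_add_two' s) v) := fun x v => by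
    rw [hincl, hb]
  have hsymm : ∀ (x v : H (s + 2)),
      inner ℝ (H.incl (le_add_two' s) x) (bessel (b := s) (by linarith) hs v) =
        inner ℝ (H.incl (le_add_two' s) v) (bessel (b := s) (by linarith) hs x) := fun x v => by
    rw [hb', hb', real_inner_comm]
  have hpos : ∀ (v : H (s + 2)),
      0 ≤ inner ℝ (H.incl (le_add_two' s) v) (bessel (b := s) (by linarith) hs v) := fun v => by
    rw [hb']; exact real_inner_self_nonneg
  have hy : ∀ (y : H (s + 1)) (v : H (s + 2)),
      |inner ℝ (H.incl hle y) (bessel (b := s) (by linarith) hs v)| ≤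
        ‖y‖ * Real.sqrt (inner ℝ (H.incl (le_add_two' s) v)
          (bessel (b := s) (by linarith) hs v)) := fun y v => by
    rw [hb, hb', ← norm_eq_sqrt_real_inner]
    exact abs_real_inner_le_norm _ _
  obtain ⟨u, w, e1, e2, e3, e4⟩ := exists_coupled_parabolic_solution
    (ι₁ := Hsol.incl (le_add_two' s)) (ι₂ := H.incl (le_add_two' s))
    (L₁ := besselSol (b := s) (by linarith) hs) (L₂ := bessel (b := s) (by linarith) hs)
    (A₁ := momentumL P hs) (A₂ := microL P hs)
    hc P.rho_pos P.j_pos (norm_nonneg (a : H (s + 1))) (norm_nonneg b)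
    (fun v w => hsymm v w) hsymm (fun v => hpos v) hpos h1 f g (Hsol.incl hle a)
    (H.incl hle b) (fun v => hy a v) (hy b)
  refine ⟨u, w, ?_, ?_, e1, e2⟩
  · rw [hasInitialValue_sol_iff hs rfl _ hle]
    exact e3
  · rw [hasInitialValue_iff hs rfl _ hle]
    exact e4

/-- The energy estimate for the unperturbed system. -/
theorem exists_coupled_estimate : ∃ C : ℝ, 0 ≤ C ∧ ∀ (u : Xsol s) (w : X s) (g : L2Time (H s)),
      HasInitialValue (Hsol.incl (one_le_add_two' s)) u.fn 0 →
      HasInitialValue (H.incl (one_le_add_two' s)) w.fn 0 →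
      (∀ᵐ t ∂timeMeasure, P.rho • u.dt t + momentumL P hs (u.fn t, w.fn t) = 0) →
      (∀ᵐ t ∂timeMeasure, P.j • w.dt t + microL P hs (u.fn t, w.fn t) = g t) →
      (∀ᵐ t ∂timeMeasure, ‖Hsol.incl (le_add_two' s) (u.fn t)‖ ^ 2 ≤
        C * ∫ r in (0 : ℝ)..t, ‖g r‖ ^ 2) ∧ (g = 0 → u = 0 ∧ w = 0) := by
  have := completeSpace_H hs
  have := completeSpace_Hsol hs
  obtain ⟨c, hc, -, h1⟩ := exists_coupled_coercive_constant P hs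
  have hle : s ≤ s + 1 := by linarith
  obtain ⟨C, hC, h2⟩ := exists_coupled_parabolic_estimate
    (ι₁ := Hsol.incl (le_add_two' s)) (ι₂ := H.incl (le_add_two' s))
    (A₁ := momentumL P hs) (A₂ := microL P hs) hc P.rho_pos P.j_pos
    (fun x y hxy => Subtype.ext (incl_injective (le_add_two' s)
      (show H.incl _ (x : H (s + 2)) = H.incl _ (y : H (s + 2)) from congrArg Subtype.val hxy)))
    (incl_injective _) h1
  refine ⟨C, hC, fun u w g hu hw e1 e2 => ?_⟩
  rw [hasInitialValue_sol_iff hs rfl _ hle, map_zero] at hu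
  rw [hasInitialValue_iff hs rfl _ hle, map_zero] at hw
  exact h2 u w g hu hw e1 e2

end Coupled

/-! ### Isomorphisms defined by coupled parabolic systems -/

section Trace

variable {E F G : Type} [NormedAddCommGroup E] [NormedSpace ℝ E]
  [NormedAddCommGroup F] [NormedSpace ℝ F] [NormedAddCommGroup G] [NormedSpace ℝ G]
  {ι : E →L[ℝ] F} {κ : E →L[ℝ] G}

lemma HasInitialValue.add {u v : Parabolic ι} {a b : G} (hu : HasInitialValue κ u.fn a)
    (hv : HasInitialValue κ v.fn b) : HasInitialValue κ (u + v).fn (a + b) := by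
  obtain ⟨x, hx, hx1, hx2⟩ := hu
  obtain ⟨y, hy, hy1, hy2⟩ := hv
  refine ⟨fun t => x t + y t, hx.add hy, ?_, hx2.add hy2⟩
  have e1 : ∀ᵐ t ∂timeMeasure, (u + v).fn t = u.fn t + v.fn t := Lp.coeFn_add u.fn v.fn
  filter_upwards [hx1, hy1, e1] with t h1 h2 h3
  rw [h1, h2, h3, map_add]

lemma HasInitialValue.smul {u : Parabolic ι} {a : G} (c : ℝ) (hu : HasInitialValue κ u.fn a) :
    HasInitialValue κ (c • u).fn (c • a) := by
  obtain ⟨x, hx, hx1, hx2⟩ := hu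
  refine ⟨fun t => c • x t, hx.const_smul c, ?_, hx2.const_smul c⟩
  have e1 : ∀ᵐ t ∂timeMeasure, (c • u).fn t = c • u.fn t := Lp.coeFn_smul c u.fn
  filter_upwards [hx1, e1] with t h1 h2
  rw [h1, h2, map_smul]

/-- The trace at time zero as a continuous linear map. -/
lemma exists_traceL (h : ∀ u : Parabolic ι, ∃ a : G, HasInitialValue κ u.fn a ∧
      ‖a‖ ^ 2 ≤ 2 * ‖u.fn‖ ^ 2 + ‖u.dt‖ ^ 2) :
    ∃ T : Parabolic ι →L[ℝ] G, ∀ u, HasInitialValue κ u.fn (T u) := by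
  choose T h1 h2 using h
  let T' : Parabolic ι →ₗ[ℝ] G :=
    { toFun := T
      map_add' := fun u v => (h1 (u + v)).unique ((h1 u).add (h1 v))
      map_smul' := fun c u => (h1 (c • u)).unique ((h1 u).smul c) }
  -- The squared trace is at most three times the squared norm, hence the constant `2`.
  refine ⟨T'.mkContinuous 2 fun u => ?_, h1⟩
  refine le_of_sq_le_sq ((h2 u).trans ?_) (by positivity)
  have e1 := pow_le_pow_left₀ (norm_nonneg _) u.norm_fn_le 2
  have e2 := pow_le_pow_left₀ (norm_nonneg _) u.norm_dt_le 2
  nlinarith [sq_nonneg ‖u‖]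

variable {E' F' : Type} [NormedAddCommGroup E'] [NormedSpace ℝ E'] [NormedAddCommGroup F']
  [NormedSpace ℝ F'] {ι' : E' →L[ℝ] F'}

/-- Differential expressions as continuous linear maps. -/
lemma exists_equationL (C : F × F' →L[ℝ] G) (A : E × E' →L[ℝ] G) :
    ∃ L : Parabolic ι × Parabolic ι' →L[ℝ] L2Time G, ∀ u w, ∀ᵐ t ∂timeMeasure,
      L (u, w) t = C (u.dt t, w.dt t) + A (u.fn t, w.fn t) := by
  let p₁ := ContinuousLinearMap.fst ℝ (Parabolic ι) (Parabolic ι')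
  let p₂ := ContinuousLinearMap.snd ℝ (Parabolic ι) (Parabolic ι')
  let C₁ := C.comp (ContinuousLinearMap.inl ℝ F F')
  let C₂ := C.comp (ContinuousLinearMap.inr ℝ F F')
  let A₁ := A.comp (ContinuousLinearMap.inl ℝ E E')
  let A₂ := A.comp (ContinuousLinearMap.inr ℝ E E')
  refine ⟨((C₁.compLpL 2 timeMeasure).comp ((dtL ι).comp p₁) +
      (C₂.compLpL 2 timeMeasure).comp ((dtL ι').comp p₂)) +
    ((A₁.compLpL 2 timeMeasure).comp ((fnL ι).comp p₁) +
      (A₂.compLpL 2 timeMeasure).comp ((fnL ι').comp p₂)), fun u w => ?_⟩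
  change ∀ᵐ t ∂timeMeasure, ((C₁.compLp u.dt + C₂.compLp w.dt) +
    (A₁.compLp u.fn + A₂.compLp w.fn) : L2Time G) t = _
  filter_upwards [Lp.coeFn_add (C₁.compLp u.dt + C₂.compLp w.dt) (A₁.compLp u.fn + A₂.compLp w.fn),
    Lp.coeFn_add (C₁.compLp u.dt) (C₂.compLp w.dt), Lp.coeFn_add (A₁.compLp u.fn) (A₂.compLp w.fn),
    C₁.coeFn_compLp u.dt, C₂.coeFn_compLp w.dt, A₁.coeFn_compLp u.fn, A₂.coeFn_compLp w.fn]
    with t e1 e2 e3 e4 e5 e6 e7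
  rw [e1, Pi.add_apply, e2, Pi.add_apply, e3, Pi.add_apply, e4, e5, e6, e7]
  change C (u.dt t, 0) + C (0, w.dt t) + (A (u.fn t, 0) + A (0, w.fn t)) = _
  rw [← map_add, ← map_add, Prod.mk_add_mk, Prod.mk_add_mk, add_zero, zero_add, add_zero, zero_add]

end Trace

/-! ### Perturbations with coefficients square integrable in time. -/

section Perturbation

variable {V F K G : Type} [NormedAddCommGroup V] [NormedSpace ℝ V]
  [NormedAddCommGroup F] [InnerProductSpace ℝ F] [CompleteSpace F] [NormedAddCommGroup K]
  [NormedSpace ℝ K] [NormedAddCommGroup G] [NormedSpace ℝ G] {ι : V →L[ℝ] F}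

/-- A bound uniform in time compensates for a coefficient that is only `L²` in time: the product of
the two is then `L²`. -/
lemma Parabolic.exists_sup_bound (ι : V →L[ℝ] F) : ∃ C : ℝ, 0 ≤ C ∧ ∀ u : Parabolic ι,
    ∀ᵐ t ∂timeMeasure, ‖ι (u.fn t)‖ ≤ C * ‖u‖ := by
  refine ⟨Real.sqrt (2 * ‖ι‖ ^ 2 + 1), Real.sqrt_nonneg _, fun u => ?_⟩
  obtain ⟨a, ha⟩ := u.ae_eq_primitive
  have hι := ι.coeFn_compLp u.fn
  have h1 : ∀ᵐ t ∂timeMeasure, (ι.compLp u.fn) t = a + ∫ r in (0 : ℝ)..t, u.dt r := by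
    filter_upwards [ha, hι] with t h1 h2
    rw [h2, h1]
  have i1 := integrable_norm_sq (ι.compLp u.fn)
  have i2 := integrable_norm_sq u.dt
  have i3 := integrable_norm_mul_norm (ι.compLp u.fn) u.dt
  have h2 : ∫ r, (‖(ι.compLp u.fn) r‖ ^ 2 + 2 * (‖(ι.compLp u.fn) r‖ * ‖u.dt r‖)) ∂timeMeasure ≤
      2 * ‖ι.compLp u.fn‖ ^ 2 + ‖u.dt‖ ^ 2 := by
    rw [norm_sq_L2Time, norm_sq_L2Time, ← integral_const_mul, ← integral_add (i1.const_mul 2) i2]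
    refine integral_mono (i1.add (i3.const_mul 2)) ((i1.const_mul 2).add i2) fun r => ?_
    nlinarith [sq_nonneg (‖(ι.compLp u.fn) r‖ - ‖u.dt r‖)]
  have h3 : 2 * ‖ι.compLp u.fn‖ ^ 2 + ‖u.dt‖ ^ 2 ≤ (2 * ‖ι‖ ^ 2 + 1) * ‖u‖ ^ 2 := by
    have e1 : ‖ι.compLp u.fn‖ ≤ ‖ι‖ * ‖u‖ :=
      (ι.norm_compLp_le u.fn).trans (mul_le_mul_of_nonneg_left u.norm_fn_le (norm_nonneg _))
    have e2 := pow_le_pow_left₀ (norm_nonneg _) e1 2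
    have e3 := pow_le_pow_left₀ (norm_nonneg _) u.norm_dt_le 2
    rw [mul_pow] at e2
    linarith
  filter_upwards [ha, ae_restrict_mem measurableSet_Ioi] with t h4 h5
  refine le_of_sq_le_sq ?_ (by positivity)
  rw [mul_pow, Real.sq_sqrt (by positivity), h4]
  exact ((norm_sq_primitive_le h1 (mem_Ioi.mp h5).le).trans h2).trans h3

/-- The perturbation `u ↦ B (u, z)` for `z ∈ L²`. -/
lemma exists_perturbationL (ι : V →L[ℝ] F) (B : F →L[ℝ] K →L[ℝ] G) (z : L2Time K) :
    ∃ N : Parabolic ι →L[ℝ] L2Time G, ∀ u, ∀ᵐ t ∂timeMeasure,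
      N u t = B (ι (u.fn t)) (z t) := by
  obtain ⟨C, hC, hb⟩ := Parabolic.exists_sup_bound ι
  have hle : ∀ u : Parabolic ι, ∀ᵐ t ∂timeMeasure,
      ‖B (ι (u.fn t)) (z t)‖ ≤ ‖B‖ * (C * ‖u‖) * ‖z t‖ := by
    intro u
    filter_upwards [hb u] with t ht
    refine (B.le_opNorm₂ _ _).trans ?_
    gcongr
  have hmem : ∀ u : Parabolic ι, MemLp (fun t => B (ι (u.fn t)) (z t)) 2 timeMeasure := fun u =>
    MemLp.of_le_mul (Lp.memLp z) (B.aestronglyMeasurable_comp₂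
      (ι.continuous.comp_aestronglyMeasurable (Lp.aestronglyMeasurable u.fn))
      (Lp.aestronglyMeasurable z)) (hle u)
  let N : Parabolic ι →ₗ[ℝ] L2Time G :=
    { toFun := fun u => (hmem u).toLp
      map_add' := fun u v => by
        refine Lp.ext ?_
        have e1 : ∀ᵐ t ∂timeMeasure, (u + v).fn t = u.fn t + v.fn t := Lp.coeFn_add u.fn v.fn
        filter_upwards [(hmem (u + v)).coeFn_toLp, (hmem u).coeFn_toLp, (hmem v).coeFn_toLp,
          Lp.coeFn_add (hmem u).toLp (hmem v).toLp, e1] with t h1 h2 h3 h4 h5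
        rw [h1, h4, Pi.add_apply, h2, h3, h5, map_add, map_add, add_apply]
      map_smul' := fun c u => by
        refine Lp.ext ?_
        have e1 : ∀ᵐ t ∂timeMeasure, (c • u).fn t = c • u.fn t := Lp.coeFn_smul c u.fn
        filter_upwards [(hmem (c • u)).coeFn_toLp, (hmem u).coeFn_toLp,
          Lp.coeFn_smul c (hmem u).toLp, e1] with t h1 h2 h3 h4
        rw [h1, RingHom.id_apply, h3, Pi.smul_apply, h2, h4, map_smul, map_smul, smul_apply] }
  refine ⟨N.mkContinuous (‖B‖ * C * ‖z‖) fun u => ?_, fun u => (hmem u).coeFn_toLp⟩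
  have h1 : ‖(hmem u).toLp‖ ≤ ‖B‖ * (C * ‖u‖) * ‖z‖ := by
    refine Lp.norm_le_mul_norm_of_ae_le_mul ?_
    filter_upwards [hle u, (hmem u).coeFn_toLp] with t h2 h3
    rw [h3]
    exact h2
  refine h1.trans_eq ?_
  ring

end Perturbation

/-! ### Invertibility under Volterra perturbations. -/

section Isomorphism

/-- Perturbation of an isomorphism by a term whose effect on the last component of the data is
of Volterra type. -/
lemma bijective_add_volterra {Y D₁ D₂ D₃ G : Type} [NormedAddCommGroup Y] [NormedSpace ℝ Y]
    [NormedAddCommGroup D₁] [NormedSpace ℝ D₁] [NormedAddCommGroup D₂] [NormedSpace ℝ D₂]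
    [NormedAddCommGroup D₃] [NormedSpace ℝ D₃] [NormedAddCommGroup G] [NormedSpace ℝ G]
    [CompleteSpace G] (M : Y ≃L[ℝ] D₁ × D₂ × D₃ × L2Time G) (N : Y →L[ℝ] L2Time G)
    {μ : ℝ → ℝ} (hμ0 : ∀ t, 0 ≤ μ t) (hμ : Integrable μ timeMeasure)
    (h : ∀ g : L2Time G, ∀ᵐ t ∂timeMeasure,
      ‖N (M.symm (0, 0, 0, g)) t‖ ^ 2 ≤ μ t * ∫ r in (0 : ℝ)..t, ‖g r‖ ^ 2) :
    Function.Bijective fun y => M y + (0, 0, 0, N y) := by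
  let I : L2Time G →L[ℝ] D₁ × D₂ × D₃ × L2Time G :=
    (0 : L2Time G →L[ℝ] D₁).prod ((0 : L2Time G →L[ℝ] D₂).prod
      ((0 : L2Time G →L[ℝ] D₃).prod (ContinuousLinearMap.id ℝ (L2Time G))))
  -- Modulo the other data, `M + N` acts on the last component as `1 + T`.
  let T : L2Time G →L[ℝ] L2Time G := N.comp (M.symm.toContinuousLinearMap.comp I)
  have hT : IsVolterra μ T := h
  obtain ⟨hinj, hsurj⟩ := hT.bijective_id_add hμ0 hμ
  constructor
  · intro y y' hy
    have hy' : M (y - y') + (0, 0, 0, N (y - y')) = 0 := by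
      have e : ((0, 0, 0, N (y - y')) : D₁ × D₂ × D₃ × L2Time G) = I (N y) - I (N y') := by
        rw [← map_sub, ← map_sub]; rfl
      rw [e, map_sub, sub_add_sub_comm, sub_eq_zero]
      exact hy
    have e1 : M (y - y') = I (-N (y - y')) := by
      rw [map_neg]; exact eq_neg_of_add_eq_zero_left hy'
    have e2 : y - y' = M.symm (I (-N (y - y'))) := by
      rw [← e1, ContinuousLinearEquiv.symm_apply_apply]
    -- The quantity `-N (y - y')` lies in the kernel of `1 + T`.
    have e3 : -N (y - y') = 0 := by
      refine hinj ?_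
      have e4 : T (-N (y - y')) = N (y - y') := congrArg N e2.symm
      change -N (y - y') + T (-N (y - y')) = 0 + T 0
      rw [e4, map_zero, neg_add_cancel, add_zero]
    rw [e3, map_zero, map_zero] at e2
    exact sub_eq_zero.mp e2
  · rintro ⟨d₁, d₂, d₃, d₄⟩
    -- The last datum for `M` is corrected to `g` so that, after adding `N`, it equals `d₄`.
    obtain ⟨g, hg⟩ := hsurj (d₄ - N (M.symm (d₁, d₂, d₃, 0)))
    refine ⟨M.symm (d₁, d₂, d₃, g), ?_⟩
    have e : ((d₁, d₂, d₃, g) : D₁ × D₂ × D₃ × L2Time G) = (d₁, d₂, d₃, 0) + I g := by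
      change _ = (d₁, d₂, d₃, (0 : L2Time G)) + (0, 0, 0, g)
      simp
    have e2 : N (M.symm (d₁, d₂, d₃, g)) = N (M.symm (d₁, d₂, d₃, 0)) + T g := by
      rw [e, map_add, map_add]; rfl
    change M (M.symm (d₁, d₂, d₃, g)) + _ = _
    rw [ContinuousLinearEquiv.apply_symm_apply, e2]
    have hg' : g + T g = d₄ - N (M.symm (d₁, d₂, d₃, 0)) := hg
    simp only [Prod.mk_add_mk, add_zero, Prod.mk.injEq, true_and]
    rw [add_left_comm, hg', add_sub_cancel]

variable {V₁ V₂ F₁ F₂ G₁ G₂ K : Type} [NormedAddCommGroup V₁] [InnerProductSpace ℝ V₁]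
  [NormedAddCommGroup V₂] [InnerProductSpace ℝ V₂] [NormedAddCommGroup F₁]
  [InnerProductSpace ℝ F₁] [NormedAddCommGroup F₂] [InnerProductSpace ℝ F₂]
  [NormedAddCommGroup G₁] [InnerProductSpace ℝ G₁] [NormedAddCommGroup G₂]
  [InnerProductSpace ℝ G₂] [NormedAddCommGroup K] [InnerProductSpace ℝ K]
  [CompleteSpace V₁] [CompleteSpace V₂] [CompleteSpace F₁] [CompleteSpace F₂]
  [CompleteSpace G₁] [CompleteSpace G₂]
  {ι₁ : V₁ →L[ℝ] F₁} {ι₂ : V₂ →L[ℝ] F₂} {κ₁ : V₁ →L[ℝ] G₁} {κ₂ : V₂ →L[ℝ] G₂}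
  {A₁ : V₁ × V₂ →L[ℝ] F₁} {A₂ : V₁ × V₂ →L[ℝ] F₂} {m₁ m₂ : ℝ}

/-- A uniquely solvable coupled parabolic system, with a perturbation of the second equation by a
bilinear term in the first unknown and a fixed square integrable function, defines an
isomorphism. -/
theorem exists_coupled_isomorphism
    (htr₁ : ∀ u : Parabolic ι₁, ∃ a : G₁, HasInitialValue κ₁ u.fn a ∧
      ‖a‖ ^ 2 ≤ 2 * ‖u.fn‖ ^ 2 + ‖u.dt‖ ^ 2)
    (htr₂ : ∀ u : Parabolic ι₂, ∃ a : G₂, HasInitialValue κ₂ u.fn a ∧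
      ‖a‖ ^ 2 ≤ 2 * ‖u.fn‖ ^ 2 + ‖u.dt‖ ^ 2)
    (hsol : ∀ (a : G₁) (b : G₂) (f : L2Time F₁) (g : L2Time F₂),
      ∃ (u : Parabolic ι₁) (w : Parabolic ι₂),
        HasInitialValue κ₁ u.fn a ∧ HasInitialValue κ₂ w.fn b ∧
        (∀ᵐ t ∂timeMeasure, m₁ • u.dt t + A₁ (u.fn t, w.fn t) = f t) ∧
        ∀ᵐ t ∂timeMeasure, m₂ • w.dt t + A₂ (u.fn t, w.fn t) = g t)
    {C : ℝ} (hC : 0 ≤ C)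
    (hest : ∀ (u : Parabolic ι₁) (w : Parabolic ι₂) (g : L2Time F₂),
      HasInitialValue κ₁ u.fn 0 → HasInitialValue κ₂ w.fn 0 →
      (∀ᵐ t ∂timeMeasure, m₁ • u.dt t + A₁ (u.fn t, w.fn t) = 0) →
      (∀ᵐ t ∂timeMeasure, m₂ • w.dt t + A₂ (u.fn t, w.fn t) = g t) →
      (∀ᵐ t ∂timeMeasure, ‖ι₁ (u.fn t)‖ ^ 2 ≤ C * ∫ r in (0 : ℝ)..t, ‖g r‖ ^ 2) ∧
        (g = 0 → u = 0 ∧ w = 0))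
    (B : F₁ →L[ℝ] K →L[ℝ] F₂) (z : L2Time K) :
    ∃ M : (Parabolic ι₁ × Parabolic ι₂) ≃L[ℝ] (G₁ × G₂ × L2Time F₁ × L2Time F₂),
      ∀ (u : Parabolic ι₁) (w : Parabolic ι₂),
        HasInitialValue κ₁ u.fn (M (u, w)).1 ∧ HasInitialValue κ₂ w.fn (M (u, w)).2.1 ∧
        (∀ᵐ t ∂timeMeasure, (M (u, w)).2.2.1 t = m₁ • u.dt t + A₁ (u.fn t, w.fn t)) ∧
        ∀ᵐ t ∂timeMeasure, (M (u, w)).2.2.2 t =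
          m₂ • w.dt t + A₂ (u.fn t, w.fn t) + B (ι₁ (u.fn t)) (z t) := by
  have := completeSpace_parabolic ι₁
  have := completeSpace_parabolic ι₂
  obtain ⟨T₁, hT₁⟩ := exists_traceL htr₁
  obtain ⟨T₂, hT₂⟩ := exists_traceL htr₂
  obtain ⟨E₁, hE₁⟩ := exists_equationL (ι := ι₁) (ι' := ι₂)
    (m₁ • ContinuousLinearMap.fst ℝ F₁ F₂) A₁
  obtain ⟨E₂, hE₂⟩ := exists_equationL (ι := ι₁) (ι' := ι₂)
    (m₂ • ContinuousLinearMap.snd ℝ F₁ F₂) A₂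
  obtain ⟨N, hN⟩ := exists_perturbationL ι₁ B z
  let M₀ : Parabolic ι₁ × Parabolic ι₂ →L[ℝ] G₁ × G₂ × L2Time F₁ × L2Time F₂ :=
    (T₁.comp (ContinuousLinearMap.fst ℝ _ _)).prod
      ((T₂.comp (ContinuousLinearMap.snd ℝ _ _)).prod (E₁.prod E₂))
  have z₁ := Lp.coeFn_zero F₁ 2 timeMeasure
  have z₂ := Lp.coeFn_zero F₂ 2 timeMeasure
  have hinj : Function.Injective M₀ := by
    refine (injective_iff_map_eq_zero M₀).mpr ?_
    rintro ⟨u, w⟩ h0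
    have h1 : T₁ u = 0 := congrArg Prod.fst h0
    have h2 : T₂ w = 0 := congrArg (fun x => x.2.1) h0
    have h3 : E₁ (u, w) = 0 := congrArg (fun x => x.2.2.1) h0
    have h4 : E₂ (u, w) = 0 := congrArg (fun x => x.2.2.2) h0
    obtain ⟨e1, e2⟩ := (hest u w 0 (h1 ▸ hT₁ u) (h2 ▸ hT₂ w) (by
      have e := hE₁ u w
      rw [h3] at e
      filter_upwards [e, z₁] with t e1 e2
      rw [e2] at e1
      exact e1.symm) (by
      have e := hE₂ u w
      rw [h4] at e
      filter_upwards [e] with t e1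
      exact e1.symm)).2 rfl
    rw [e1, e2]
    rfl
  have hsurj : Function.Surjective M₀ := by
    rintro ⟨a, b, f, g⟩
    obtain ⟨u, w, h1, h2, h3, h4⟩ := hsol a b f g
    refine ⟨(u, w), ?_⟩
    refine Prod.ext ((hT₁ u).unique h1) (Prod.ext ((hT₂ w).unique h2) (Prod.ext ?_ ?_))
    · refine Lp.ext ?_
      filter_upwards [hE₁ u w, h3] with t e1 e2
      exact e1.trans e2
    · refine Lp.ext ?_
      filter_upwards [hE₂ u w, h4] with t e1 e2
      exact e1.trans e2
  -- The inverse is bounded by the open mapping theorem, since all spaces are complete.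
  let M₁ := ContinuousLinearEquiv.ofBijective M₀ (LinearMap.ker_eq_bot.mpr hinj)
    (LinearMap.range_eq_top.mpr hsurj)
  let N' : Parabolic ι₁ × Parabolic ι₂ →L[ℝ] L2Time F₂ := N.comp (ContinuousLinearMap.fst ℝ _ _)
  have hbij : Function.Bijective fun y => M₁ y + (0, 0, 0, N' y) := by
    -- The energy estimate bounds `ι₁ u` at time `t` by the forcing up to `t`. The remaining factor
    -- is integrable because `z` is square integrable.
    refine bijective_add_volterra M₁ N' (μ := fun t => ‖B‖ ^ 2 * C * ‖z t‖ ^ 2)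
      (fun t => by positivity) ((integrable_norm_sq z).const_mul _) fun g => ?_
    obtain ⟨⟨u, w⟩, huw⟩ : ∃ y, y = M₁.symm (0, 0, 0, g) := ⟨_, rfl⟩
    rw [← huw]
    have h0 : M₀ (u, w) = (0, 0, 0, g) := by
      rw [huw]; exact M₁.apply_symm_apply _
    have h1 : T₁ u = 0 := congrArg Prod.fst h0
    have h2 : T₂ w = 0 := congrArg (fun x => x.2.1) h0
    have h3 : E₁ (u, w) = 0 := congrArg (fun x => x.2.2.1) h0
    have h4 : E₂ (u, w) = g := congrArg (fun x => x.2.2.2) h0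
    have h5 := (hest u w g (h1 ▸ hT₁ u) (h2 ▸ hT₂ w) (by
      have e := hE₁ u w
      rw [h3] at e
      filter_upwards [e, z₁] with t e1 e2
      rw [e2] at e1
      exact e1.symm) (by
      have e := hE₂ u w
      rw [h4] at e
      filter_upwards [e] with t e1
      exact e1.symm)).1
    filter_upwards [hN u, h5] with t e1 e2
    change ‖N u t‖ ^ 2 ≤ _
    rw [e1]
    calc ‖B (ι₁ (u.fn t)) (z t)‖ ^ 2 ≤ (‖B‖ * ‖ι₁ (u.fn t)‖ * ‖z t‖) ^ 2 := by
          gcongr; exact B.le_opNorm₂ _ _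
      _ = ‖B‖ ^ 2 * ‖z t‖ ^ 2 * ‖ι₁ (u.fn t)‖ ^ 2 := by ring
      _ ≤ ‖B‖ ^ 2 * ‖z t‖ ^ 2 * (C * ∫ r in (0 : ℝ)..t, ‖g r‖ ^ 2) := by gcongr
      _ = _ := by ring
  let M : Parabolic ι₁ × Parabolic ι₂ →L[ℝ] G₁ × G₂ × L2Time F₁ × L2Time F₂ :=
    M₀ + (0 : _ →L[ℝ] G₁).prod ((0 : _ →L[ℝ] G₂).prod ((0 : _ →L[ℝ] L2Time F₁).prod N'))
  have hM : Function.Bijective M := hbij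
  refine ⟨ContinuousLinearEquiv.ofBijective M (LinearMap.ker_eq_bot.mpr hM.1)
    (LinearMap.range_eq_top.mpr hM.2), fun u w => ?_⟩
  rw [ContinuousLinearEquiv.coeFn_ofBijective]
  have e : M (u, w) = (T₁ u, T₂ w, E₁ (u, w), E₂ (u, w) + N u) := by
    change ((T₁ u, T₂ w, E₁ (u, w), E₂ (u, w)) : G₁ × G₂ × L2Time F₁ × L2Time F₂) +
      (0, 0, 0, N u) = _
    simp
  rw [e]
  refine ⟨hT₁ u, hT₂ w, hE₁ u w, ?_⟩
  filter_upwards [hE₂ u w, hN u, Lp.coeFn_add (E₂ (u, w)) (N u)] with t e1 e2 e3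
  refine e3.trans ?_
  rw [Pi.add_apply, e1, e2]
  rfl

end Isomorphism

/-! ### The linearised micropolar operator. -/

section Main

variable (P : Params) {s : ℝ} (hs : 0 ≤ s)

lemma momentumEq_iff (u : Xsol s) (w : X s) (f : L2Time (Hsol s)) : MomentumEq P u w f ↔
    ∀ᵐ t ∂timeMeasure, f t = P.rho • u.dt t + momentumL P hs (u.fn t, w.fn t) := by
  refine eventually_congr (.of_forall fun t => ?_)
  rw [Subtype.ext_iff, ← H.field_injective.eq_iff, Submodule.coe_add, Submodule.coe_smul,
    coe_momentumL, map_add, map_sub, map_neg, map_smul, map_smul, map_smul, field_lapL,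
    field_curlL]
  refine Eq.congr rfl ?_
  abel

/-- The statement asks for an identity almost everywhere in space, since the advection term there is
a pointwise product; `B` is a Sobolev-valued representative of it, and the linear terms are unfolded
through their `L²` representatives. -/
lemma microrotationEq_of {r : ℝ} {z : X r} {u : Xsol s} {w : X s} {g : L2Time (H s)}
    {B : H s →L[ℝ] H (r + 2) →L[ℝ] H s}
    (hB : ∀ u z i, (B u z).field i =ᵐ[torusMeasure] advect u.field z.field i)
    (h : ∀ᵐ t ∂timeMeasure, g t = P.j • w.dt t + microL P hs (u.fn t, w.fn t) +
      (P.j • B) (H.incl (le_add_two' s) (u.fn t : H (s + 2))) (z.fn t)) :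
    MicrorotationEq P z u w g := by
  filter_upwards [h] with t ht
  intro i
  set y : H s := H.incl (le_add_two' s) (u.fn t : H (s + 2)) with hy
  have hyf : y.field = (u.fn t).field := H.field_incl _ _
  have e : (g t).field i = P.j • (w.dt t).field i + (-((P.alpha + P.gamma) •
      laplacian (w.fn t).field i) - (P.alpha / 3 + P.beta - P.gamma) •
      grad (divergence (w.fn t).field) i + (2 * P.kappa) • (w.fn t).field i -
      P.kappa • curl (u.fn t).field i) + P.j • (B y (z.fn t)).field i := by
    have e1 : g t = P.j • w.dt t + (-((P.alpha + P.gamma) • lapL hs (w.fn t)) -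
        (P.alpha / 3 + P.beta - P.gamma) • gradDivL hs (w.fn t) +
        (2 * P.kappa) • H.incl (le_add_two' s) (w.fn t) -
        P.kappa • curlL hs (u.fn t : H (s + 2))) + P.j • B y (z.fn t) := ht
    rw [e1, map_add, map_add, map_sub, map_add, map_sub, map_neg, map_smul, map_smul, map_smul,
      map_smul, map_smul, map_smul, field_lapL, field_gradDivL, field_curlL, H.field_incl]
    rfl
  rw [e]
  set a := (w.dt t).field i
  set b := laplacian (w.fn t).field i
  set c := grad (divergence (w.fn t).field) i
  set d := (w.fn t).field i
  set k := curl (u.fn t).field i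
  have hb := hB y (z.fn t) i
  rw [hyf] at hb
  set n := (B y (z.fn t)).field i
  filter_upwards [hb,
    Lp.coeFn_add (P.j • a + (-((P.alpha + P.gamma) • b) - (P.alpha / 3 + P.beta - P.gamma) • c +
      (2 * P.kappa) • d - P.kappa • k)) (P.j • n),
    Lp.coeFn_add (P.j • a) (-((P.alpha + P.gamma) • b) - (P.alpha / 3 + P.beta - P.gamma) • c +
      (2 * P.kappa) • d - P.kappa • k),
    Lp.coeFn_sub (-((P.alpha + P.gamma) • b) - (P.alpha / 3 + P.beta - P.gamma) • c +
      (2 * P.kappa) • d) (P.kappa • k),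
    Lp.coeFn_add (-((P.alpha + P.gamma) • b) - (P.alpha / 3 + P.beta - P.gamma) • c)
      ((2 * P.kappa) • d),
    Lp.coeFn_sub (-((P.alpha + P.gamma) • b)) ((P.alpha / 3 + P.beta - P.gamma) • c),
    Lp.coeFn_neg ((P.alpha + P.gamma) • b), Lp.coeFn_smul P.j a,
    Lp.coeFn_smul (P.alpha + P.gamma) b, Lp.coeFn_smul (P.alpha / 3 + P.beta - P.gamma) c,
    Lp.coeFn_smul (2 * P.kappa) d, Lp.coeFn_smul P.kappa k, Lp.coeFn_smul P.j n]
    with x h0 h1 h2 h3 h4 h5 h6 h7 h8 h9 h10 h11 h12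
  simp only [Pi.add_apply, Pi.sub_apply, Pi.neg_apply, Pi.smul_apply, smul_eq_mul] at *
  rw [h1, h2, h3, h4, h5, h6, h7, h8, h9, h10, h11, h12, h0]
  ring

include hs in
/-- The linearized micropolar operator is an isomorphism. -/
theorem exists_micropolar_isomorphism {q : ℝ} (hq : 5 / 2 < q) (hsq : s + 1 ≤ q)
    (z : X (q - 1)) :
    ∃ M : (Xsol s × X s) ≃L[ℝ] (Hsol (s + 1) × H (s + 1) × L2Time (Hsol s) × L2Time (H s)),
      ∀ (u : Xsol s) (w : X s),
        HasInitialValue (Hsol.incl (one_le_add_two' s)) u.fn (M (u, w)).1 ∧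
        HasInitialValue (H.incl (one_le_add_two' s)) w.fn (M (u, w)).2.1 ∧
        MomentumEq P u w (M (u, w)).2.2.1 ∧
        MicrorotationEq P z u w (M (u, w)).2.2.2 := by
  have := completeSpace_H hs
  have := completeSpace_Hsol hs
  have := completeSpace_H (show 0 ≤ s + 1 by linarith)
  have := completeSpace_Hsol (show 0 ≤ s + 1 by linarith)
  have := completeSpace_H (show 0 ≤ s + 2 by linarith)
  have := completeSpace_Hsol (show 0 ≤ s + 2 by linarith)
  have hle : s ≤ s + 1 := by linarith
  obtain ⟨B, hB⟩ := exists_advectL hs hq hsq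
  obtain ⟨C, hC, hest⟩ := exists_coupled_estimate P hs
  obtain ⟨M, hM⟩ := exists_coupled_isomorphism (κ₁ := Hsol.incl (one_le_add_two' s))
    (κ₂ := H.incl (one_le_add_two' s))
    (fun u => by
      obtain ⟨a, h1, h2, -⟩ := exists_trace_sol hs rfl (one_le_add_two' s) hle u
      exact ⟨a, h1, h2⟩)
    (fun w => by
      obtain ⟨a, h1, h2, -⟩ := exists_trace hs rfl (one_le_add_two' s) hle w
      exact ⟨a, h1, h2⟩)
    -- The bilinear term is `j u · ∇z` with `u` viewed in the full space; `z` enters only as an `L²`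
    -- function of time with values in `H^{q+1}`.
    (exists_coupled_solution P hs) hC hest ((P.j • B).comp (HsolSub s).subtypeL) z.fn
  refine ⟨M, fun u w => ?_⟩
  obtain ⟨h1, h2, h3, h4⟩ := hM u w
  exact ⟨h1, h2, (momentumEq_iff P hs u w _).mpr h3, microrotationEq_of P hs hB h4⟩

end Main

end Micropolar

end

open Micropolar in
theorem theorem3p10 (P : Params) (s q : ℝ) (hs : 0 ≤ s)
    (hq₁ : s ≤ 3 / 2 → 5 / 2 < q) (hq₂ : 3 / 2 < s → s + 1 ≤ q)
    (z₀ : H q) (hz₀ : IsConservative z₀.field) :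
    (∃! z : X (q - 1), IsPotentialMicroflow P z₀ z) ∧
    ∀ z : X (q - 1), IsPotentialMicroflow P z₀ z →
      ∃ M : (Xsol s × X s) ≃L[ℝ] (Hsol (s + 1) × H (s + 1) × L2Time (Hsol s) × L2Time (H s)),
        ∀ (u : Xsol s) (w : X s),
          HasInitialValue (Hsol.incl (one_le_add_two' s)) u.fn (M (u, w)).1 ∧
          HasInitialValue (H.incl (one_le_add_two' s)) w.fn (M (u, w)).2.1 ∧
          MomentumEq P u w (M (u, w)).2.2.1 ∧
          MicrorotationEq P z u w (M (u, w)).2.2.2 := by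
  -- The two cases meet at `s = 3/2`, where `s + 1 = 5/2`; in each of them one inequality implies
  -- the other.
  have hq : 5 / 2 < q ∧ s + 1 ≤ q := by
    rcases le_or_gt s (3 / 2) with h | h
    · exact ⟨hq₁ h, by linarith [hq₁ h]⟩
    · exact ⟨by linarith [hq₂ h], hq₂ h⟩
  exact ⟨existsUnique_isPotentialMicroflow P (by linarith) z₀,
    fun z _ => exists_micropolar_isomorphism P hs hq.1 hq.2 z⟩
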